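/- **Setting.** Let $k\ge 1$, $n=(n_1,\dots,n_k)$ with all $n_j\ge 1$, $a=(a_1,\dots,a_k)$ with $a_j\in\mathbb C^{n_j}$, $r=(r_1,\dots,r_k)$ with all $r_j>0$, and let $$B=B^{n_1}(a_1,r_1)\times\cdots\times B^{n_k}(a_k,r_k)$$ be the corresponding polyball, where $B^{n_j}(a_j,r_j)\subset\mathbb C^{n_j}$ is the open Euclidean ball with center $a_j$ and radius $r_j$. A function $u:B\to\mathbb R$ is *$n$-harmonic* if it is continuous and is harmonic in each vector variable $z_j\in B^{n_j}(a_j,r_j)$ separately. Let $\mathbb H=H^2(\mathbb C,B)$ be the set of analytic $h:B\to\mathbb C$ such that $|h|^2$ has an $n$-harmonic majorant, and for $h\in\mathbb H$ put $\|h\|^2=u(a)$, where $u$ is the least $n$-harmonic majorant of $|h|^2$. Let $R$ be either the algebra of polynomials in all the coordinates, restricted to $B$, or the algebra $H^\infty(\mathbb C,B)$ of bounded analytic functions on $B$. For a function $f$ analytic on $B$, $\operatorname{ord}(f)\in\{0,1,2,\dots\}\cup\{\infty\}$ denotes the order of the zero of $f$ at $a$, i.e. the smallest degree of a nonzero homogeneous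 term of the power series of $f$ around $a$, with $\operatorname{ord}(0)=\infty$. Let $R_1=\{\rho\in R:\operatorname{ord}(\rho)\ge 1\}$. **Theorem.** For each $h \in \mathbb H$ the least $n$-harmonic majorant of $|h|^2$ exists, and $\mathbb H$ with the norm above is a complex Hilbert space. For each of the two choices of $R$, $\mathbb H$ is an analytic Hilbert module over $R$, that is: 1. $\operatorname{ord}$ is an analytic valuation on $R$: $\operatorname{ord}(\rho)=0$ if $\rho$ is the identity element or is invertible in $R$; $\operatorname{ord}(\rho)=\infty$ iff $\rho=0$; $\operatorname{ord}(\rho\sigma)\ge\operatorname{ord}(\rho)+\operatorname{ord}(\sigma)$; $\operatorname{ord}(\lambda\rho)=\operatorname{ord}(\rho)$ for $0\ne\lambda\in\mathbb C$; $\operatorname{ord}(\rho+\sigma)\ge\min(\operatorname{ord}(\rho),\operatorname{ord}(\sigma))$; 2. pointwise multiplication makes $\mathbb H$ an $R$ module, and $h\mapsto\rho h$ is bounded on $\mathbb H$ for each $\rho\in R$; 3. $\operatorname{ord}$ is a Hilbert module valuation on $\mathbb H$: $\operatorname{ord}(h)=\infty$ iff $h=0$; $\operatorname{ord}(\rho h)\ge\operatorname{ord}(\rho)+\operatorname{ord}(h)$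 for $\rho\in R$; $\operatorname{ord}(\lambda h)=\operatorname{ord}(h)$ for $0\ne\lambda\in\mathbb C$; $\operatorname{ord}(h_1+h_2)\ge\min(\operatorname{ord}(h_1),\operatorname{ord}(h_2))$; and $\operatorname{ord}$ is upper semicontinuous on $\mathbb H$; 4. there is an open neighborhood $\Omega_a\subseteq B$ of $a$ such that every sequence converging in the norm of $\mathbb H$ converges to the same limit uniformly on compact subsets of $\Omega_a$. Moreover, the abstract Beurling theorem and its corollary for submodules hold for $\mathbb H$. For a closed subspace $V$ of $\mathbb H$ and $m=0,1,2,\dots$ let $V_m=\{h\in V:\operatorname{ord}(h)\ge m\}$ and $W_m=V_m\ominus V_{m+1}$, and let $P_m$ be the orthogonal projection of $\mathbb H$ onto $\mathbb H_m\ominus\mathbb H_{m+1}$, where $\mathbb H_m=\{h\in\mathbb H:\operatorname{ord}(h)\ge m\}$. Then for every closed subspace $V$ of $\mathbb H$ the following are equivalent: (i) $V$ is $R_1$ invariant: $\rho h\in V$ for all $\rho\in R_1$, $h\in V$; (ii) $V$ is an $R$ submodule: $\rho h\in V$ for all $\rho\in R$, $h\in V$; (iii) the decomposition $W_0,W_1,W_2,\dots$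 of $V$ is $R_1$ inner and has the full projection property. That is, for all $l,m\ge 0$, $\rho\in R_1$, $h\in W_l$ and $g\in V$: if $\operatorname{ord}(\rho h-g)>m$ then $\rho h-g\perp W_m$; and if $\operatorname{ord}(\rho h-g)\ge m$ then $P_m(\rho h-g)\in P_m(W_m)$. -/

import Mathlib

namespace BeurlingModule

/-! ## Analytic functions on a subset of a complex normed space, and the order of a zero -/

section Analytic

variable {E : Type*} [NormedAddCommGroup E] [NormedSpace ℂ E] {Ω : Set E}

/-- The function on the whole space which is `f` on `Ω` and `0` elsewhere.  Below, `Ω` is open and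
only the germs at points of `Ω` of this extension are used. -/
noncomputable def extendZero {M : Type*} [Zero M] (f : Ω → M) : E → M :=
  Function.extend Subtype.val f 0

/-- `f : Ω → ℂ` is complex analytic. -/
def IsAnalytic (f : Ω → ℂ) : Prop := AnalyticOnNhd ℂ (extendZero f) Ω

/-- The homogeneous term of degree `k` of the power series of `f` around `a`, as a function
of `z - a`. -/
noncomputable def homogeneousTerm (a : E) (f : Ω → ℂ) (k : ℕ) (z : E) : ℂ :=
  ((k.factorial : ℂ))⁻¹ * iteratedFDeriv ℂ k (extendZero f) a (fun _ => z)

/-- The order of the zero of `f` at `a`: the smallest degree of a nonvanishing homogeneous term of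
the power series of `f` around `a`, and `∞` if there is none. -/
noncomputable def zeroOrder (a : E) (f : Ω → ℂ) : ℕ∞ :=
  ⨅ (k : ℕ) (_ : ∃ z : E, homogeneousTerm a f k z ≠ 0), (k : ℕ∞)

end Analytic

/-! ## Valuation algebras and valuation Hilbert modules -/

/-- Analytic valuations on a complex algebra, possibly without identity element.  In
`map_unit`, `e` runs over the left or right identity elements, and `r` over the one-sided invertible
elements, which include `e` itself. -/
structure IsAnalyticValuation {R : Type*} [NonUnitalRing R] [Module ℂ R] (ord : R → ℕ∞) :
    Prop where
  map_unit : ∀ e r s : R, ((∀ t, e * t = t) ∨ (∀ t, t * e = t)) → (r * s = e ∨ s * r = e) →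
    ord r = 0
  eq_top_iff : ∀ r, ord r = ⊤ ↔ r = 0
  mul_ge : ∀ r s, ord r + ord s ≤ ord (r * s)
  map_smul : ∀ (c : ℂ) (r : R), c ≠ 0 → ord (c • r) = ord r
  add_ge : ∀ r s, min (ord r) (ord s) ≤ ord (r + s)

section Decomposition

variable {H : Type*} [NormedAddCommGroup H] [InnerProductSpace ℂ H]

/-- The properties of a Hilbert module valuation that do not involve the algebra. -/
structure IsOrderFunction (ord : H → ℕ∞) : Prop where
  eq_top_iff : ∀ h, ord h = ⊤ ↔ h = 0
  map_smul : ∀ (c : ℂ) (h : H), c ≠ 0 → ord (c • h) = ord h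
  add_ge : ∀ h₁ h₂, min (ord h₁) (ord h₂) ≤ ord (h₁ + h₂)
  upperSemicontinuous : UpperSemicontinuous ord

/-- Hilbert module valuations on `H` with respect to `(R, ordR)`, where the action of `R` on `H` is
given by bounded operators. -/
structure IsHilbertModuleValuation {R : Type*} [NonUnitalRing R] [Module ℂ R]
    (act : R →ₙₐ[ℂ] (H →L[ℂ] H)) (ordR : R → ℕ∞) (ord : H → ℕ∞) : Prop
    extends IsOrderFunction ord where
  act_ge : ∀ (r : R) (h : H), ordR r + ord h ≤ ord (act r h)

variable {ord : H → ℕ∞}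

/-- The `k`-th term `V_k = {h ∈ V : ord h ≥ k}` of the valuation subspace series of `V`. -/
def valuationSubspace (ho : IsOrderFunction ord) (V : Submodule ℂ H) (k : ℕ) :
    Submodule ℂ H where
  carrier := {h | h ∈ V ∧ (k : ℕ∞) ≤ ord h}
  zero_mem' := ⟨V.zero_mem, by rw [(ho.eq_top_iff 0).2 rfl]; exact le_top⟩
  add_mem' := fun {x y} hx hy =>
    ⟨V.add_mem hx.1 hy.1, (le_min hx.2 hy.2).trans (ho.add_ge x y)⟩
  smul_mem' := fun c x hx => by
    refine ⟨V.smul_mem c hx.1, ?_⟩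
    by_cases hc : c = 0
    · rw [hc, zero_smul, (ho.eq_top_iff 0).2 rfl]; exact le_top
    · rw [ho.map_smul c x hc]; exact hx.2

/-- The `k`-th valuation homogeneous component `W_k = V_k ⊖ V_{k+1}` of `V`. -/
noncomputable def homogeneousComponent (ho : IsOrderFunction ord) (V : Submodule ℂ H) (k : ℕ) :
    Submodule ℂ H :=
  valuationSubspace ho V k ⊓ (valuationSubspace ho V (k + 1))ᗮ

theorem isClosed_homogeneousComponent_top (ho : IsOrderFunction ord) (k : ℕ) :
    IsClosed (homogeneousComponent ho ⊤ k : Set H) := by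
  have h1 : IsClosed (valuationSubspace ho ⊤ k : Set H) := by
    have h2 : (valuationSubspace ho ⊤ k : Set H) = (ord ⁻¹' Set.Iio (k : ℕ∞))ᶜ := by
      ext x
      simp [valuationSubspace]
    rw [h2]
    exact (ho.upperSemicontinuous.isOpen_preimage _).isClosed_compl
  exact h1.inter (Submodule.isClosed_orthogonal _)

instance [CompleteSpace H] (ho : IsOrderFunction ord) (k : ℕ) :
    (homogeneousComponent ho ⊤ k).HasOrthogonalProjection := by
  have : CompleteSpace (homogeneousComponent ho ⊤ k) :=
    (isClosed_homogeneousComponent_top ho k).completeSpace_coe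
  infer_instance

/-- The orthogonal projection of `H` onto the `k`-th valuation homogeneous component of `H`. -/
noncomputable def componentProjection [CompleteSpace H] (ho : IsOrderFunction ord) (k : ℕ) :
    H →L[ℂ] H :=
  (homogeneousComponent ho ⊤ k).starProjection

end Decomposition

/-! ## Hilbert spaces of functions and analytic Hilbert modules -/

/-- A complex Hilbert space of complex-valued functions on `X`: the elements are identified with
functions by the injective linear map `eval`. -/
structure HilbertFunctionSpace (X : Type) where
  Elem : Type
  [normedAddCommGroup : NormedAddCommGroup Elem]
  [innerProductSpace : InnerProductSpace ℂ Elem]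
  [completeSpace : CompleteSpace Elem]
  eval : Elem →ₗ[ℂ] (X → ℂ)
  eval_injective : Function.Injective eval

attribute [instance] HilbertFunctionSpace.normedAddCommGroup
attribute [instance] HilbertFunctionSpace.innerProductSpace
attribute [instance] HilbertFunctionSpace.completeSpace

section AnalyticModule

variable {E : Type} [NormedAddCommGroup E] [NormedSpace ℂ E] {Ω : Set E}

/-- The structure of an analytic Hilbert module on the domain `Ω` with basepoint `a`, over the
analytic algebra `R`, on the Hilbert space of functions `𝓗`.  Both order functions are the
order of the zero at `a`.  By `eval_act` the field `act` is pointwise multiplication, so that the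
structure is unique if it exists. -/
structure AnalyticHilbertModule (a : E) (R : NonUnitalSubalgebra ℂ (Ω → ℂ))
    (𝓗 : HilbertFunctionSpace Ω) where
  isOpen : IsOpen Ω
  isConnected : IsConnected Ω
  basepoint_mem : a ∈ Ω
  analytic_algebra : ∀ r ∈ R, IsAnalytic r
  analytic_module : ∀ h : 𝓗.Elem, IsAnalytic (𝓗.eval h)
  valuation_algebra : IsAnalyticValuation (fun r : R => zeroOrder a (r : Ω → ℂ))
  act : R →ₙₐ[ℂ] (𝓗.Elem →L[ℂ] 𝓗.Elem)
  eval_act : ∀ (r : R) (h : 𝓗.Elem), 𝓗.eval (act r h) = (r : Ω → ℂ) * 𝓗.eval h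
  valuation_module : IsHilbertModuleValuation act (fun r : R => zeroOrder a (r : Ω → ℂ))
    (fun h => zeroOrder a (𝓗.eval h))
  locally_uniform : ∃ U : Set Ω, IsOpen U ∧ ⟨a, basepoint_mem⟩ ∈ U ∧
    ∀ (h : ℕ → 𝓗.Elem) (g : 𝓗.Elem), Filter.Tendsto h Filter.atTop (nhds g) →
      ∀ K : Set Ω, IsCompact K → K ⊆ U →
        TendstoUniformlyOn (fun m => 𝓗.eval (h m)) (𝓗.eval g) Filter.atTop K

namespace AnalyticHilbertModule

variable {a : E} {R : NonUnitalSubalgebra ℂ (Ω → ℂ)} {𝓗 : HilbertFunctionSpace Ω}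
  (M : AnalyticHilbertModule a R 𝓗)

theorem isOrderFunction (M : AnalyticHilbertModule a R 𝓗) :
    IsOrderFunction (fun h : 𝓗.Elem => zeroOrder a (𝓗.eval h)) :=
  M.valuation_module.toIsOrderFunction

/-- `V` is an `R` submodule: `R V ⊆ V`. -/
def IsInvariant (V : Submodule ℂ 𝓗.Elem) : Prop :=
  ∀ r : R, ∀ h ∈ V, M.act r h ∈ V

/-- `V` is `R₁` invariant, where `R₁ = {r ∈ R : ord r ≥ 1}`. -/
def IsR1Invariant (V : Submodule ℂ 𝓗.Elem) : Prop :=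
  ∀ r : R, 1 ≤ zeroOrder a (r : Ω → ℂ) → ∀ h ∈ V, M.act r h ∈ V

/-- The valuation homogeneous decomposition of `V` is `R₁` inner. -/
def HasR1InnerDecomposition (V : Submodule ℂ 𝓗.Elem) : Prop :=
  ∀ k m : ℕ, ∀ h ∈ homogeneousComponent M.isOrderFunction V k, ∀ g ∈ V, ∀ r : R,
    1 ≤ zeroOrder a (r : Ω → ℂ) → (m : ℕ∞) < zeroOrder a (𝓗.eval (M.act r h - g)) →
    M.act r h - g ∈ (homogeneousComponent M.isOrderFunction V m)ᗮ

/-- The valuation homogeneous decomposition of `V` has the full projection property. -/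
def HasFullProjectionProperty (V : Submodule ℂ 𝓗.Elem) : Prop :=
  ∀ k m : ℕ, ∀ r : R, 1 ≤ zeroOrder a (r : Ω → ℂ) →
    ∀ h ∈ homogeneousComponent M.isOrderFunction V k, ∀ g ∈ V,
    (m : ℕ∞) ≤ zeroOrder a (𝓗.eval (M.act r h - g)) →
    componentProjection M.isOrderFunction m (M.act r h - g) ∈
      componentProjection M.isOrderFunction m ''
        (homogeneousComponent M.isOrderFunction V m : Set 𝓗.Elem)

end AnalyticHilbertModule

end AnalyticModule

/-! ## The polyball, its Hardy space, and the two algebras -/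

section Polyball

variable {k : ℕ} {n : Fin k → ℕ}

/-- The space `ℂ^{n₁} × ⋯ × ℂ^{n_k}`. -/
abbrev PolySpace (n : Fin k → ℕ) : Type := (j : Fin k) → EuclideanSpace ℂ (Fin (n j))

/-- The polyball `B^{n₁}(a₁, r₁) × ⋯ × B^{n_k}(a_k, r_k)`, a product of Euclidean open balls. -/
def polyball (a : PolySpace n) (r : Fin k → ℝ) : Set (PolySpace n) :=
  {z | ∀ j, z j ∈ Metric.ball (a j) (r j)}

variable {a : PolySpace n} {r : Fin k → ℝ}

/-- Multi-index `n`-harmonic functions on the polyball: continuous, and harmonic in each of the `k`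
vector variables separately, with respect to the Laplacian of `ℂ^{n_j} = ℝ^{2 n_j}`. -/
def IsNHarmonic (u : polyball a r → ℝ) : Prop :=
  Continuous u ∧ ∀ (z : polyball a r) (j : Fin k),
    InnerProductSpace.HarmonicOnNhd
      (fun w : EuclideanSpace ℂ (Fin (n j)) =>
        extendZero u (Function.update (z : PolySpace n) j w))
      (Metric.ball (a j) (r j))

/-- The `n`-harmonic majorants of `|h|²`. -/
def nHarmonicMajorants (h : polyball a r → ℂ) : Set (polyball a r → ℝ) :=
  {u | IsNHarmonic u ∧ ∀ z, ‖h z‖ ^ 2 ≤ u z}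

/-- `𝓗` is `H²` of the polyball: its elements are the analytic functions `h` for which `|h|²` admits
an `n`-harmonic majorant, and `‖h‖²` is the value at the center of the least such majorant (which
is required to exist). -/
def IsPolyballH2 (a : PolySpace n) (r : Fin k → ℝ)
    (𝓗 : HilbertFunctionSpace (polyball a r)) : Prop :=
  (∀ f : polyball a r → ℂ,
    (∃ h : 𝓗.Elem, 𝓗.eval h = f) ↔ IsAnalytic f ∧ (nHarmonicMajorants f).Nonempty) ∧
  ∀ h : 𝓗.Elem, ∃ u : polyball a r → ℝ, IsLeast (nHarmonicMajorants (𝓗.eval h)) u ∧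
    ∃ ha : a ∈ polyball a r, ‖h‖ ^ 2 = u ⟨a, ha⟩

/-- The algebra of polynomials in all the coordinates, as functions on the polyball. -/
noncomputable def polynomialAlgebra (a : PolySpace n) (r : Fin k → ℝ) :
    Subalgebra ℂ (polyball a r → ℂ) :=
  (MvPolynomial.aeval (R := ℂ) (fun (i : (j : Fin k) × Fin (n j)) (z : polyball a r) =>
    (z : PolySpace n) i.1 i.2)).range

theorem extendZero_apply (f : polyball a r → ℂ) (z : polyball a r) :
    extendZero f (z : PolySpace n) = f z :=
  Subtype.val_injective.extend_apply f 0 z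

theorem isOpen_polyball (a : PolySpace n) (r : Fin k → ℝ) : IsOpen (polyball a r) := by
  have h : polyball a r = ⋂ j, (fun z : PolySpace n => z j) ⁻¹' Metric.ball (a j) (r j) := by
    ext z; simp [polyball]
  rw [h]
  exact isOpen_iInter_of_finite fun j => Metric.isOpen_ball.preimage (continuous_apply j)

theorem isAnalytic_of_eqOn {f : polyball a r → ℂ} {F : PolySpace n → ℂ}
    (hF : AnalyticOnNhd ℂ F (polyball a r)) (h : ∀ z : polyball a r, F z = f z) :
    IsAnalytic f :=
  hF.congr (isOpen_polyball a r) fun z hz => by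
    rw [h ⟨z, hz⟩]; exact (extendZero_apply f ⟨z, hz⟩).symm

/-- The algebra `H^∞` of bounded analytic functions on the polyball. -/
def boundedAnalyticAlgebra (a : PolySpace n) (r : Fin k → ℝ) :
    Subalgebra ℂ (polyball a r → ℂ) where
  carrier := {f | IsAnalytic f ∧ ∃ C : ℝ, ∀ z, ‖f z‖ ≤ C}
  mul_mem' := by
    rintro f g ⟨hf, C, hC⟩ ⟨hg, D, hD⟩
    refine ⟨isAnalytic_of_eqOn (AnalyticOnNhd.mul hf hg)
      fun z => by simp [extendZero_apply], C * D, fun z => ?_⟩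
    rw [Pi.mul_apply, norm_mul]
    exact mul_le_mul (hC z) (hD z) (norm_nonneg _) ((norm_nonneg _).trans (hC z))
  add_mem' := by
    rintro f g ⟨hf, C, hC⟩ ⟨hg, D, hD⟩
    exact ⟨isAnalytic_of_eqOn (AnalyticOnNhd.add hf hg)
      fun z => by simp [extendZero_apply], C + D,
      fun z => (norm_add_le _ _).trans (add_le_add (hC z) (hD z))⟩
  algebraMap_mem' := fun c =>
    ⟨isAnalytic_of_eqOn (F := fun _ => c) analyticOnNhd_const fun z => by simp, ‖c‖,
      fun z => by simp⟩

end Polyball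

end BeurlingModule

/-!
The squared norm of an analytic function `f` is realized as the supremum of the means of `|f|²` over
the distinguished boundaries (products of spheres) of a sequence of inner polyballs exhausting the
polyball.  That this is the value at the center of the least `n`-harmonic majorant rests on the
Poisson kernel of a ball in `ℝ^d`.  The kernel is harmonic (`laplacian_ballPoissonKernel`), and with
the maximum principle it solves the Dirichlet problem, so that a subharmonic function is dominated by
the Poisson integral of its boundary values (`le_poissonIntegral`).  Now `|f|²` is subharmonic in
each vector variable (`laplacian_normSq_nonneg`), hence it is dominated by its Poisson integrals with
respect to products of spheres, which increase with the radii.  Their limit `leastMajorant` is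
`n`-harmonic if it is finite at the center, by monotone convergence and Harnack's inequality
(`nHarmonicOn_leastMajorant`), and every `n`-harmonic majorant dominates it (`leastMajorant_le`).

As a supremum of increasing squared `L²` norms the squared norm satisfies the parallelogram law, which
gives the inner product.  Harnack's inequality bounds point evaluations locally uniformly
(`exists_norm_hardyEval_le`), which gives completeness, the locally uniform convergence of norm
convergent sequences, and through Cauchy's estimates the continuity of the homogeneous terms at `a`,
that is, the upper semicontinuity of the order (`upperSemicontinuous_zeroOrder`).  The algebraic
properties of the order reduce to one variable, as the order at `a` is the infimum of the orders
along complex lines through `a` (`zeroOrder_eq_iInf`).  Multiplication by a function bounded by `C`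
does not increase the means by more than the factor `C²`.

The Beurling theorem is then a statement about a bounded operator `T` and an order function on a
Hilbert space.  If `T` maps `V` into itself, the two properties follow from `V_m = W_m ⊕ V_{m+1}`.
Conversely (`invariant_of_inner_of_fullProjection`), for `h ∈ W_l` the full projection property
allows correcting an approximation `g ∈ V` of `T h` degree by degree, so that `T h - g` has
arbitrarily large order.  Let `p` be the projection of `T h` to `V`.  By the inner property `p - g` is
orthogonal to the components of low degree, so that it has large order as well.  Thus `T h - p` has
infinite order, `T h = p ∈ V`, and the components `W_l` have dense span in `V`.
-/

namespace BeurlingModule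

set_option linter.unusedSectionVars false

/-! ### Second derivatives along lines and parametric integrals -/

section Calculus

open MeasureTheory Metric Set Filter Topology InnerProductSpace Module

lemma hasDerivAt_add_smul {E : Type} [NormedAddCommGroup E] [NormedSpace ℝ E] (x e : E) (t : ℝ) :
    HasDerivAt (fun t : ℝ => x + t • e) e t := by
  simpa using ((hasDerivAt_id t).smul_const e).const_add x

/-- The second derivative in a direction is computed along the line in that direction. -/
lemma iteratedFDeriv_two_eq_deriv_deriv {E : Type} [NormedAddCommGroup E] [NormedSpace ℝ E]
    {f : E → ℝ} {x : E} (hf : ContDiffAt ℝ 2 f x) (e : E) :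
    iteratedFDeriv ℝ 2 f x ![e, e] = deriv (deriv fun t : ℝ => f (x + t • e)) 0 := by
  have h0 : x + (0 : ℝ) • e = x := by simp
  have hc : Tendsto (fun t : ℝ => x + t • e) (𝓝 0) (𝓝 x) := by
    simpa [ContinuousAt] using (hasDerivAt_add_smul x e 0).continuousAt
  have h1 : deriv (fun t : ℝ => f (x + t • e)) =ᶠ[𝓝 0] fun t => fderiv ℝ f (x + t • e) e := by
    filter_upwards [hc.eventually (hf.eventually (by simp))] with t ht
    have := (ht.differentiableAt (by simp)).hasFDerivAt
    exact (this.comp_hasDerivAt t (hasDerivAt_add_smul x e t)).deriv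
  have h2 : HasFDerivAt (fderiv ℝ f) (fderiv ℝ (fderiv ℝ f) x) (x + (0 : ℝ) • e) := by
    rw [h0]
    exact ((hf.fderiv_right (m := 1) le_rfl).differentiableAt (by simp)).hasFDerivAt
  have h3 : HasDerivAt (fun t : ℝ => fderiv ℝ f (x + t • e)) (fderiv ℝ (fderiv ℝ f) x e) 0 :=
    h2.comp_hasDerivAt (0 : ℝ) (hasDerivAt_add_smul x e 0)
  have h4 : HasDerivAt (fun t : ℝ => fderiv ℝ f (x + t • e) e) (fderiv ℝ (fderiv ℝ f) x e e) 0 := by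
    simpa using h3.clm_apply (hasDerivAt_const (0 : ℝ) e)
  rw [h1.deriv_eq, h4.deriv, iteratedFDeriv_two_apply]
  rfl

lemma laplacian_eq_sum_deriv_deriv {E : Type} [NormedAddCommGroup E] [InnerProductSpace ℝ E]
    [FiniteDimensional ℝ E] {f : E → ℝ} {x : E}
    (hf : ContDiffAt ℝ 2 f x) {ι : Type*} [Fintype ι] (b : OrthonormalBasis ι ℝ E) :
    Laplacian.laplacian f x = ∑ i, deriv (deriv fun t : ℝ => f (x + t • b i)) 0 := by
  rw [laplacian_eq_iteratedFDeriv_orthonormalBasis f b]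
  exact Finset.sum_congr rfl fun i _ => iteratedFDeriv_two_eq_deriv_deriv hf (b i)

section Parametric

/- The integrals considered here are `∫ g z • K x (ζ z) ∂μ` with a bounded density `g` and with a
kernel `K x p` that is smooth for `x` in an open set `U` and `p` in a compact set `C`, where the
parameter `p = ζ z` lies in `C` for almost every `z`. -/

variable {E P F Z : Type} [NormedAddCommGroup E] [NormedSpace ℝ E]
  [NormedAddCommGroup P] [NormedSpace ℝ P] [MeasurableSpace P] [BorelSpace P]
  [NormedAddCommGroup F] [NormedSpace ℝ F] [MeasurableSpace Z]
  {μ : Measure Z} {U : Set E} {C : Set P} {K : E → P → F} {ζ : Z → P}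
  {g : Z → ℝ} {B : ℝ}

omit [MeasurableSpace P] [BorelSpace P] in
lemma contDiffAt_fderiv_left (hK : ∀ x ∈ U, ∀ p ∈ C, ContDiffAt ℝ ⊤ (Function.uncurry K) (x, p)) :
    ∀ x ∈ U, ∀ p ∈ C,
      ContDiffAt ℝ ⊤ (Function.uncurry fun x p => fderiv ℝ (fun y => K y p) x) (x, p) := by
  intro x hx p hp
  have h1 : ContDiffAt ℝ ⊤ (Function.uncurry fun (q : E × P) (y : E) => K y q.2) ((x, p), x) :=
    ContDiffAt.comp (𝕜 := ℝ) ((x, p), x) (g := Function.uncurry K)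
      (f := fun z : (E × P) × E => (z.2, z.1.2)) (hK x hx p hp) (by fun_prop)
  exact ContDiffAt.fderiv (f := fun (q : E × P) (y : E) => K y q.2) (g := Prod.fst)
    (x₀ := (x, p)) h1 contDiffAt_fst (by simp)

omit [MeasurableSpace P] [BorelSpace P] in
lemma contDiffAt_left (hK : ∀ x ∈ U, ∀ p ∈ C, ContDiffAt ℝ ⊤ (Function.uncurry K) (x, p))
    {x : E} (hx : x ∈ U) {p : P} (hp : p ∈ C) : ContDiffAt ℝ ⊤ (fun y => K y p) x :=
  ContDiffAt.comp (𝕜 := ℝ) x (g := Function.uncurry K) (f := fun y : E => (y, p))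
    (hK x hx p hp) (by fun_prop)

lemma aestronglyMeasurable_kernel (hC : IsCompact C) (hζ : Measurable ζ)
    (hζC : ∀ᵐ z ∂μ, ζ z ∈ C) {x : E} (hx : x ∈ U)
    (hK : ∀ x ∈ U, ∀ p ∈ C, ContDiffAt ℝ ⊤ (Function.uncurry K) (x, p)) :
    AEStronglyMeasurable (fun z => K x (ζ z)) μ := by
  have h1 : ContinuousOn (K x) C := fun p hp =>
    ((hK x hx p hp).continuousAt.comp (f := fun p => (x, p)) (by fun_prop)).continuousWithinAt
  have h2 := h1.aestronglyMeasurable_of_isCompact (μ := μ.map ζ) hC hC.measurableSet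
  rw [Measure.restrict_eq_self_of_ae_mem ((ae_map_iff hζ.aemeasurable hC.measurableSet).2 hζC)]
    at h2
  exact h2.comp_measurable hζ

variable [FiniteDimensional ℝ E] [IsFiniteMeasure μ]

omit [MeasurableSpace P] [BorelSpace P] in
lemma exists_bound_kernel (hU : IsOpen U) (hC : IsCompact C) {x : E} (hx : x ∈ U)
    (hK : ∀ x ∈ U, ∀ p ∈ C, ContDiffAt ℝ ⊤ (Function.uncurry K) (x, p)) :
    ∃ ε > 0, ball x ε ⊆ U ∧ ∃ D, 0 ≤ D ∧ ∀ y ∈ ball x ε, ∀ p ∈ C, ‖K y p‖ ≤ D := by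
  obtain ⟨ε, hε, hεU⟩ := nhds_basis_closedBall.mem_iff.1 (hU.mem_nhds hx)
  have : ProperSpace E := FiniteDimensional.proper ℝ E
  obtain ⟨D, hD⟩ := ((isCompact_closedBall x ε).prod hC).exists_bound_of_continuousOn
    (f := Function.uncurry K) fun q hq =>
      (hK q.1 (hεU hq.1) q.2 hq.2).continuousAt.continuousWithinAt
  exact ⟨ε, hε, ball_subset_closedBall.trans hεU, max D 0, le_max_right _ _, fun y hy p hp =>
    (hD (y, p) ⟨ball_subset_closedBall hy, hp⟩).trans (le_max_left _ _)⟩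

lemma integrable_smul_kernel (hU : IsOpen U) (hC : IsCompact C) (hζ : Measurable ζ)
    (hζC : ∀ᵐ z ∂μ, ζ z ∈ C)
    (hK : ∀ x ∈ U, ∀ p ∈ C, ContDiffAt ℝ ⊤ (Function.uncurry K) (x, p))
    (hg : AEStronglyMeasurable g μ) (hB : ∀ᵐ z ∂μ, ‖g z‖ ≤ B) {x : E} (hx : x ∈ U) :
    Integrable (fun z => g z • K x (ζ z)) μ := by
  obtain ⟨ε, hε, -, D, -, hD⟩ := exists_bound_kernel hU hC hx hK
  refine Integrable.of_bound (hg.smul (aestronglyMeasurable_kernel hC hζ hζC hx hK)) (B * D) ?_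
  filter_upwards [hζC, hB] with z hz hz2
  rw [norm_smul]
  exact mul_le_mul hz2 (hD x (mem_ball_self hε) _ hz) (norm_nonneg _) ((norm_nonneg _).trans hz2)

lemma hasFDerivAt_integral_kernel (hU : IsOpen U) (hC : IsCompact C) (hζ : Measurable ζ)
    (hζC : ∀ᵐ z ∂μ, ζ z ∈ C)
    (hK : ∀ x ∈ U, ∀ p ∈ C, ContDiffAt ℝ ⊤ (Function.uncurry K) (x, p))
    (hg : AEStronglyMeasurable g μ) (hB : ∀ᵐ z ∂μ, ‖g z‖ ≤ B) {x : E} (hx : x ∈ U) :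
    HasFDerivAt (fun x => ∫ z, g z • K x (ζ z) ∂μ)
      (∫ z, g z • fderiv ℝ (fun y => K y (ζ z)) x ∂μ) x := by
  have hK' := contDiffAt_fderiv_left hK
  obtain ⟨ε, hε, hεU, D, hD0, hD⟩ := exists_bound_kernel hU hC hx hK'
  refine hasFDerivAt_integral_of_dominated_of_fderiv_le (𝕜 := ℝ) (bound := fun _ => B * D)
    (F := fun x z => g z • K x (ζ z))
    (F' := fun x z => g z • fderiv ℝ (fun y => K y (ζ z)) x) (ball_mem_nhds x hε) ?_ ?_ ?_ ?_ ?_ ?_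
  · filter_upwards [hU.mem_nhds hx] with y hy
    exact hg.smul (aestronglyMeasurable_kernel hC hζ hζC hy hK)
  · exact integrable_smul_kernel hU hC hζ hζC hK hg hB hx
  · exact hg.smul (aestronglyMeasurable_kernel hC hζ hζC hx hK')
  · filter_upwards [hζC, hB] with z hz hz2 y hy
    rw [norm_smul]
    exact mul_le_mul hz2 (hD y hy _ hz) (norm_nonneg _) ((norm_nonneg _).trans hz2)
  · exact integrable_const _
  · filter_upwards [hζC] with z hz y hy
    exact (((contDiffAt_left hK (hεU hy) hz).differentiableAt (by simp)).hasFDerivAt).const_smul _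

/-- The derivative of the integral is an integral of the same kind, with the derivative of the
kernel; hence two differentiations under the integral sign. -/
lemma contDiffOn_integral_kernel (hU : IsOpen U) (hC : IsCompact C) (hζ : Measurable ζ)
    (hζC : ∀ᵐ z ∂μ, ζ z ∈ C)
    (hK : ∀ x ∈ U, ∀ p ∈ C, ContDiffAt ℝ ⊤ (Function.uncurry K) (x, p))
    (hg : AEStronglyMeasurable g μ) (hB : ∀ᵐ z ∂μ, ‖g z‖ ≤ B) :
    ContDiffOn ℝ 2 (fun x => ∫ z, g z • K x (ζ z) ∂μ) U := by
  have h1 (x) (hx : x ∈ U) := hasFDerivAt_integral_kernel hU hC hζ hζC hK hg hB hx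
  have hK1 := contDiffAt_fderiv_left hK
  have h2 (x) (hx : x ∈ U) := hasFDerivAt_integral_kernel hU hC hζ hζC hK1 hg hB hx
  have hK2 := contDiffAt_fderiv_left hK1
  have h3 (x) (hx : x ∈ U) := hasFDerivAt_integral_kernel hU hC hζ hζC hK2 hg hB hx
  refine (contDiffOn_succ_iff_fderiv_of_isOpen (n := 1) hU).2
    ⟨fun x hx => (h1 x hx).differentiableAt.differentiableWithinAt, by simp, ?_⟩
  refine ContDiffOn.congr ?_ fun x hx => (h1 x hx).fderiv
  refine (contDiffOn_succ_iff_fderiv_of_isOpen (n := 0) hU).2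
    ⟨fun x hx => (h2 x hx).differentiableAt.differentiableWithinAt, by simp, ?_⟩
  refine ContDiffOn.congr ?_ fun x hx => (h2 x hx).fderiv
  exact contDiffOn_zero.2 fun x hx => (h3 x hx).continuousAt.continuousWithinAt

end Parametric

/-- Integrating a smooth family of harmonic functions against a bounded density gives a harmonic
function. -/
lemma harmonicOnNhd_integral_kernel {E P Z : Type} [NormedAddCommGroup E] [InnerProductSpace ℝ E]
    [FiniteDimensional ℝ E]
    [NormedAddCommGroup P] [NormedSpace ℝ P] [MeasurableSpace P] [BorelSpace P]
    [MeasurableSpace Z] {μ : Measure Z} {U : Set E} {C : Set P} {K : E → P → ℝ} {ζ : Z → P}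
    {g : Z → ℝ} {B : ℝ} [IsFiniteMeasure μ] (hU : IsOpen U) (hC : IsCompact C) (hζ : Measurable ζ)
    (hζC : ∀ᵐ z ∂μ, ζ z ∈ C)
    (hK : ∀ x ∈ U, ∀ p ∈ C, ContDiffAt ℝ ⊤ (Function.uncurry K) (x, p))
    (hΔ : ∀ x ∈ U, ∀ p ∈ C, Laplacian.laplacian (fun y => K y p) x = 0)
    (hg : AEStronglyMeasurable g μ) (hB : ∀ᵐ z ∂μ, ‖g z‖ ≤ B) :
    HarmonicOnNhd (fun x => ∫ z, g z * K x (ζ z) ∂μ) U := by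
  intro x hx
  refine ⟨(contDiffOn_integral_kernel hU hC hζ hζC hK hg hB).contDiffAt (hU.mem_nhds hx), ?_⟩
  filter_upwards [hU.mem_nhds hx] with y hy
  have h1 (x) (hx : x ∈ U) := hasFDerivAt_integral_kernel hU hC hζ hζC hK hg hB hx
  have hK1 := contDiffAt_fderiv_left hK
  have h2 := hasFDerivAt_integral_kernel hU hC hζ hζC hK1 hg hB hy
  have hK2 := contDiffAt_fderiv_left hK1
  have hi := integrable_smul_kernel hU hC hζ hζC hK2 hg hB hy
  have h4 : fderiv ℝ (fun x => ∫ z, g z * K x (ζ z) ∂μ) =ᶠ[𝓝 y]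
      fun x => ∫ z, g z • fderiv ℝ (fun y => K y (ζ z)) x ∂μ := by
    filter_upwards [hU.mem_nhds hy] with w hw using (h1 w hw).fderiv
  let b := stdOrthonormalBasis ℝ E
  rw [laplacian_eq_iteratedFDeriv_orthonormalBasis _ b]
  simp only [iteratedFDeriv_two_apply, h4.fderiv_eq, h2.fderiv, Pi.zero_apply]
  have h5 (e : E) : (∫ z, g z • fderiv ℝ (fun x => fderiv ℝ (fun y => K y (ζ z)) x) y ∂μ) e e =
      ∫ z, g z * fderiv ℝ (fun x => fderiv ℝ (fun y => K y (ζ z)) x) y e e ∂μ := by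
    rw [ContinuousLinearMap.integral_apply hi, ContinuousLinearMap.integral_apply]
    · rfl
    · exact hi.apply_continuousLinearMap e
  have h6 (e : E) :
      Integrable (fun z => g z * fderiv ℝ (fun x => fderiv ℝ (fun y => K y (ζ z)) x) y e e) μ :=
    (hi.apply_continuousLinearMap e).apply_continuousLinearMap e
  simp only [Matrix.cons_val_zero, Matrix.cons_val_one, h5]
  rw [← integral_finsetSum _ fun i _ => h6 (b i)]
  refine integral_eq_zero_of_ae ?_
  filter_upwards [hζC] with z hz
  have h7 := hΔ y hy _ hz
  rw [laplacian_eq_iteratedFDeriv_orthonormalBasis _ b] at h7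
  simp only [iteratedFDeriv_two_apply, Matrix.cons_val_zero, Matrix.cons_val_one] at h7
  rw [← Finset.mul_sum]
  simp only [h7, mul_zero, Pi.zero_apply]

end Calculus

/-! ### The Poisson kernel of a ball and the rotation invariant measure on a sphere -/

section PoissonKernel

open MeasureTheory Metric Set Filter Topology InnerProductSpace Module

variable {E : Type} [NormedAddCommGroup E] [InnerProductSpace ℝ E]

/-- The Poisson kernel of the ball with center `a` and radius `R` in a real inner product space of
dimension `d`, that is `R ^ (d - 2) * (R ^ 2 - ‖x - a‖ ^ 2) / ‖x - ζ‖ ^ d`.  It is normalized so that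
its value at `x = a` is `1` for `‖ζ - a‖ = R`.  The power is written with the exponent `-d / 2` at
`‖x - ζ‖ ^ 2`, which is smooth. -/
noncomputable def ballPoissonKernel (a : E) (R : ℝ) (x ζ : E) : ℝ :=
  R ^ finrank ℝ E / R ^ 2 * ((R ^ 2 - ‖x - a‖ ^ 2) * (‖x - ζ‖ ^ 2) ^ (-(finrank ℝ E : ℝ) / 2))

omit [InnerProductSpace ℝ E] in
lemma normSq_sub_pos {a x ζ : E} {R : ℝ} (hx : x ∈ ball a R) (hζ : ζ ∈ sphere a R) :
    0 < ‖x - ζ‖ ^ 2 := by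
  have : x ≠ ζ := by
    rintro rfl
    exact (mem_ball.1 hx).ne (mem_sphere.1 hζ)
  exact pow_pos (norm_pos_iff.2 (sub_ne_zero.2 this)) 2

lemma contDiffAt_ballPoissonKernel {a x ζ : E} {R : ℝ} (hx : x ∈ ball a R)
    (hζ : ζ ∈ sphere a R) :
    ContDiffAt ℝ ⊤ (Function.uncurry (ballPoissonKernel a R)) (x, ζ) := by
  unfold ballPoissonKernel Function.uncurry
  refine contDiffAt_const.mul (ContDiffAt.mul ?_ ?_)
  · exact contDiffAt_const.sub ((contDiffAt_fst.sub contDiffAt_const).norm_sq ℝ)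
  · exact ((contDiffAt_fst.sub contDiffAt_snd).norm_sq ℝ).rpow_const_of_ne
      (normSq_sub_pos hx hζ).ne'

lemma ballPoissonKernel_nonneg {a x ζ : E} {R : ℝ} (hx : x ∈ ball a R) :
    0 ≤ ballPoissonKernel a R x ζ := by
  have h : ‖x - a‖ < R := mem_ball_iff_norm.1 hx
  have h0 : 0 ≤ R := (norm_nonneg _).trans h.le
  have : 0 ≤ R ^ 2 - ‖x - a‖ ^ 2 := by nlinarith [norm_nonneg (x - a)]
  unfold ballPoissonKernel
  positivity

lemma ballPoissonKernel_center {a ζ : E} {R : ℝ} (hR : 0 < R) (hζ : ζ ∈ sphere a R) :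
    ballPoissonKernel a R a ζ = 1 := by
  have h1 : ‖a - ζ‖ = R := by rw [norm_sub_rev]; exact mem_sphere_iff_norm.1 hζ
  have h2 : (R ^ 2) ^ (-(finrank ℝ E : ℝ) / 2) = (R ^ finrank ℝ E)⁻¹ := by
    rw [← Real.rpow_natCast R 2, ← Real.rpow_mul hR.le, ← Real.rpow_natCast, ← Real.rpow_neg hR.le]
    congr 1
    push_cast
    ring
  simp only [ballPoissonKernel, h1, h2, sub_self, norm_zero]
  field_simp
  ring

lemma ballPoissonKernel_le {a x ζ : E} {R δ : ℝ} (hx : x ∈ ball a R) (hδ : 0 < δ)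
    (hd : δ ≤ ‖x - ζ‖) : ballPoissonKernel a R x ζ ≤
      R ^ finrank ℝ E / R ^ 2 * ((R ^ 2 - ‖x - a‖ ^ 2) * (δ ^ 2) ^ (-(finrank ℝ E : ℝ) / 2)) := by
  have h : ‖x - a‖ < R := mem_ball_iff_norm.1 hx
  have h0 : 0 ≤ R := (norm_nonneg _).trans h.le
  have : 0 ≤ R ^ 2 - ‖x - a‖ ^ 2 := by nlinarith [norm_nonneg (x - a)]
  unfold ballPoissonKernel
  have h2 : (‖x - ζ‖ ^ 2) ^ (-(finrank ℝ E : ℝ) / 2) ≤ (δ ^ 2) ^ (-(finrank ℝ E : ℝ) / 2) := by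
    refine Real.rpow_le_rpow_of_nonpos (by positivity) (by gcongr) ?_
    have : (0 : ℝ) ≤ finrank ℝ E := by positivity
    linarith
  gcongr

/-- The Poisson kernel is harmonic in its first variable. -/
lemma laplacian_ballPoissonKernel [FiniteDimensional ℝ E] {a x ζ : E} {R : ℝ} (hx : x ∈ ball a R)
    (hζ : ζ ∈ sphere a R) :
    Laplacian.laplacian (fun y => ballPoissonKernel a R y ζ) x = 0 := by
  have hc : ContDiffAt ℝ 2 (fun y => ballPoissonKernel a R y ζ) x :=
    (contDiffAt_left (U := ball a R) (C := sphere a R)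
      (fun x hx p hp => contDiffAt_ballPoissonKernel hx hp) hx hζ).of_le le_top
  let b := stdOrthonormalBasis ℝ E
  rw [laplacian_eq_sum_deriv_deriv hc b]
  set d : ℝ := ((finrank ℝ E : ℕ) : ℝ) with hd
  set p : ℝ := -d / 2 with hp
  set c : ℝ := R ^ finrank ℝ E / R ^ 2 with hcdef
  set q : ℝ := ‖x - ζ‖ ^ 2 with hq
  have hq0 : 0 < q := normSq_sub_pos hx hζ
  set A : ℝ := R ^ 2 - ‖x - a‖ ^ 2 with hA
  -- the restriction of the kernel to the line through `x` in the direction of a unit vector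
  have hline (e : E) (he : ‖e‖ = 1) :
      deriv (deriv fun t : ℝ => ballPoissonKernel a R (x + t • e) ζ) 0 =
      c * (-2 * q ^ p - 8 * p * q ^ (p - 1) * (inner ℝ (x - a) e * inner ℝ (x - ζ) e)
        + A * (4 * p * (p - 1) * q ^ (p - 2) * (inner ℝ (x - ζ) e * inner ℝ (x - ζ) e)
        + 2 * p * q ^ (p - 1))) := by
    set α : ℝ := inner ℝ (x - a) e
    set β : ℝ := inner ℝ (x - ζ) e
    have h1 (t : ℝ) : ballPoissonKernel a R (x + t • e) ζ =
        c * ((A - 2 * t * α - t ^ 2) * (q + 2 * t * β + t ^ 2) ^ p) := by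
      unfold ballPoissonKernel
      rw [show x + t • e - a = (x - a) + t • e by abel,
        show x + t • e - ζ = (x - ζ) + t • e by abel, norm_add_sq_real, norm_add_sq_real,
        norm_smul, he, inner_smul_right, inner_smul_right, Real.norm_eq_abs, mul_one, sq_abs]
      simp only [A, q, hp, hcdef, hd, α, β]
      ring_nf
    have hA' (t : ℝ) : HasDerivAt (fun t : ℝ => A - 2 * t * α - t ^ 2) (-2 * α - 2 * t) t := by
      have := ((((hasDerivAt_id t).const_mul 2).mul_const α).const_sub A).sub (hasDerivAt_pow 2 t)
      refine this.congr_deriv ?_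
      simp
    have hQ' (t : ℝ) : HasDerivAt (fun t : ℝ => q + 2 * t * β + t ^ 2) (2 * β + 2 * t) t := by
      have := ((((hasDerivAt_id t).const_mul 2).mul_const β).const_add q).add (hasDerivAt_pow 2 t)
      refine this.congr_deriv ?_
      simp
    have hpos : ∀ᶠ t : ℝ in 𝓝 0, 0 < q + 2 * t * β + t ^ 2 :=
      (hQ' 0).continuousAt.eventually (lt_mem_nhds (by simpa using hq0))
    have hP (s : ℝ) (t : ℝ) (ht : 0 < q + 2 * t * β + t ^ 2) :
        HasDerivAt (fun t : ℝ => (q + 2 * t * β + t ^ 2) ^ s)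
          ((2 * β + 2 * t) * s * (q + 2 * t * β + t ^ 2) ^ (s - 1)) t :=
      (hQ' t).rpow_const (Or.inl ht.ne')
    have h2 : deriv (fun t : ℝ => ballPoissonKernel a R (x + t • e) ζ) =ᶠ[𝓝 0] fun t =>
        c * ((-2 * α - 2 * t) * (q + 2 * t * β + t ^ 2) ^ p + (A - 2 * t * α - t ^ 2) *
          ((2 * β + 2 * t) * p * (q + 2 * t * β + t ^ 2) ^ (p - 1))) := by
      filter_upwards [hpos] with t ht
      simp only [h1]
      exact (((hA' t).mul (hP p t ht)).const_mul c).deriv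
    rw [h2.deriv_eq]
    have h0 : (0 : ℝ) < q + 2 * 0 * β + 0 ^ 2 := by simpa using hq0
    have hl1 : HasDerivAt (fun t : ℝ => -2 * α - 2 * t) (-2) 0 := by
      simpa using ((hasDerivAt_id (0 : ℝ)).const_mul 2).const_sub (-2 * α)
    have hl2 : HasDerivAt (fun t : ℝ => (2 * β + 2 * t) * p) (2 * p) 0 := by
      simpa using (((hasDerivAt_id (0 : ℝ)).const_mul 2).const_add (2 * β)).mul_const p
    refine (((hl1.mul (hP p 0 h0)).add ((hA' 0).mul (hl2.mul (hP (p - 1) 0 h0)))).const_mul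
      c).deriv.trans ?_
    simp only [Pi.mul_apply, mul_zero, zero_mul, add_zero, sub_zero, ne_eq,
      OfNat.ofNat_ne_zero, not_false_eq_true, zero_pow]
    rw [show p - 1 - 1 = p - 2 by ring]
    ring
  simp only [hline _ (b.norm_eq_one _)]
  rw [← Finset.mul_sum]
  simp only [Finset.sum_add_distrib, Finset.sum_sub_distrib, ← Finset.mul_sum, Finset.sum_const,
    Finset.card_univ, Fintype.card_fin, nsmul_eq_mul]
  have hs1 : ∑ i, inner ℝ (x - a) (b i) * inner ℝ (x - ζ) (b i) = inner ℝ (x - a) (x - ζ) := by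
    simp_rw [← b.sum_inner_mul_inner (x - a) (x - ζ), real_inner_comm (b _) (x - ζ)]
  have hs2 : ∑ i, inner ℝ (x - ζ) (b i) * inner ℝ (x - ζ) (b i) = q := by
    rw [hq, ← real_inner_self_eq_norm_sq, ← b.sum_inner_mul_inner (x - ζ) (x - ζ)]
    simp_rw [real_inner_comm (b _) (x - ζ)]
  rw [hs1, hs2]
  have hq1 : q ^ p = q ^ (p - 1) * q := by
    rw [← Real.rpow_add_one hq0.ne', sub_add_cancel]
  have hq2 : q ^ (p - 1) = q ^ (p - 2) * q := by
    rw [← Real.rpow_add_one hq0.ne']; ring_nf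
  have hkey : -q + 2 * inner ℝ (x - a) (x - ζ) + A = 0 := by
    have h1 : ζ - a = (x - a) - (x - ζ) := by abel
    have h2 : ‖ζ - a‖ = R := mem_sphere_iff_norm.1 hζ
    have h3 := norm_sub_sq_real (x - a) (x - ζ)
    rw [← h1, h2] at h3
    simp only [hA, hq]
    linarith
  rw [← hd, hq1]
  have : d = -2 * p := by rw [hp]; ring
  rw [show 4 * p * (p - 1) * q ^ (p - 2) * q = 4 * p * (p - 1) * q ^ (p - 1) by rw [hq2]; ring,
    this]
  linear_combination (-4 * p * c * q ^ (p - 1)) * hkey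

variable [MeasurableSpace E] [BorelSpace E] [FiniteDimensional ℝ E]

/-- The rotation invariant probability measure on the sphere with center `a` and radius `R`, as a
measure on the whole space: the image of the uniform distribution on the unit ball under the
radial projection. -/
noncomputable def sphereMeasure (a : E) (R : ℝ) : Measure E :=
  (ProbabilityTheory.cond volume (ball (0 : E) 1)).map fun x => a + (R * ‖x‖⁻¹) • x

lemma measurable_radial (a : E) (R : ℝ) : Measurable fun x : E => a + (R * ‖x‖⁻¹) • x := by
  fun_prop

instance (a : E) (R : ℝ) : IsProbabilityMeasure (sphereMeasure a R) := by
  have : IsProbabilityMeasure (ProbabilityTheory.cond volume (ball (0 : E) 1)) :=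
    ProbabilityTheory.cond_isProbabilityMeasure_of_finite (measure_ball_pos _ _ one_pos).ne'
      measure_ball_lt_top.ne
  exact Measure.isProbabilityMeasure_map (measurable_radial a R).aemeasurable

lemma ae_sphereMeasure [Nontrivial E] (a : E) {R : ℝ} (hR : 0 ≤ R) :
    ∀ᵐ ζ ∂sphereMeasure a R, ζ ∈ sphere a R := by
  refine (ae_map_iff (measurable_radial a R).aemeasurable isClosed_sphere.measurableSet).2 ?_
  have h : ∀ᵐ x : E, x ≠ 0 := Measure.ae_ne volume 0
  filter_upwards [ProbabilityTheory.cond_absolutelyContinuous.ae_le h] with x hx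
  simp [norm_smul, abs_of_nonneg hR, hx]

/-- Linear isometries preserve the uniform distribution on the unit ball. -/
lemma map_cond_ball (T : E ≃ₗᵢ[ℝ] E) :
    (ProbabilityTheory.cond volume (ball (0 : E) 1)).map T =
      ProbabilityTheory.cond volume (ball (0 : E) 1) := by
  have hT : MeasurePreserving T volume volume := T.measurePreserving
  unfold ProbabilityTheory.cond
  rw [Measure.map_smul]
  congr 1
  have := (hT.restrict_preimage (s := ball (0 : E) 1) measurableSet_ball).map_eq
  have h2 : T ⁻¹' ball (0 : E) 1 = ball 0 1 := by ext; simp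
  rwa [h2] at this

/-- Rotation invariance of the measure on the sphere. -/
lemma integral_sphereMeasure_rotate (a : E) (R : ℝ) (T : E ≃ₗᵢ[ℝ] E) (f : E → ℝ) :
    ∫ ζ, f (a + T (ζ - a)) ∂sphereMeasure a R = ∫ ζ, f ζ ∂sphereMeasure a R := by
  have he : MeasurableEmbedding fun ζ : E => a + T (ζ - a) :=
    ((Homeomorph.subRight a).trans (T.toHomeomorph.trans (Homeomorph.addLeft a))).measurableEmbedding
  have h : (sphereMeasure a R).map (fun ζ => a + T (ζ - a)) = sphereMeasure a R := by
    unfold sphereMeasure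
    conv_rhs => rw [← map_cond_ball T]
    rw [Measure.map_map he.measurable (measurable_radial a R),
      Measure.map_map (measurable_radial a R) T.continuous.measurable]
    congr 1
    ext x
    simp
  conv_rhs => rw [← h]
  rw [he.integral_map]

end PoissonKernel

/-! ### The maximum principle and the Dirichlet problem on a ball -/

section Dirichlet

open MeasureTheory Metric Set Filter Topology InnerProductSpace Module

/-- If the second derivative were positive, the point would also be a local minimum, and the function
would be locally constant. -/
lemma deriv_deriv_nonpos_of_isLocalMax {f : ℝ → ℝ} {x : ℝ} (h : IsLocalMax f x)
    (hc : ContinuousAt f x) : deriv (deriv f) x ≤ 0 := by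
  by_contra! hpos
  have hmin := isLocalMin_of_deriv_deriv_pos hpos h.deriv_eq_zero hc
  have h1 : f =ᶠ[𝓝 x] fun _ => f x := by
    filter_upwards [h, hmin] with y hy hy' using le_antisymm hy hy'
  have h2 : deriv f =ᶠ[𝓝 x] fun _ => 0 := by
    filter_upwards [h1.eventuallyEq_nhds] with y hy
    rw [hy.deriv_eq, deriv_const]
  rw [h2.deriv_eq, deriv_const] at hpos
  exact lt_irrefl _ hpos

variable {E : Type} [NormedAddCommGroup E] [InnerProductSpace ℝ E] [FiniteDimensional ℝ E]

lemma laplacian_nonpos_of_isLocalMax {f : E → ℝ} {x : E} (h : IsLocalMax f x)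
    (hf : ContDiffAt ℝ 2 f x) : Laplacian.laplacian f x ≤ 0 := by
  rw [laplacian_eq_sum_deriv_deriv hf (stdOrthonormalBasis ℝ E)]
  refine Finset.sum_nonpos fun i _ => deriv_deriv_nonpos_of_isLocalMax ?_ ?_
  · have hc : Tendsto (fun t : ℝ => x + t • stdOrthonormalBasis ℝ E i) (𝓝 0) (𝓝 x) := by
      simpa [ContinuousAt] using (hasDerivAt_add_smul x (stdOrthonormalBasis ℝ E i) 0).continuousAt
    have := hc.eventually h
    simpa [IsLocalMax, IsMaxFilter] using this
  · refine ContinuousAt.comp (f := fun t : ℝ => x + t • stdOrthonormalBasis ℝ E i) ?_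
      (hasDerivAt_add_smul x (stdOrthonormalBasis ℝ E i) 0).continuousAt
    simpa using hf.continuousAt

lemma laplacian_norm_sq (a x : E) :
    Laplacian.laplacian (fun y : E => ‖y - a‖ ^ 2) x = 2 * finrank ℝ E := by
  have hc : ContDiffAt ℝ 2 (fun y : E => ‖y - a‖ ^ 2) x :=
    (contDiffAt_id.sub contDiffAt_const).norm_sq ℝ
  rw [laplacian_eq_sum_deriv_deriv hc (stdOrthonormalBasis ℝ E)]
  have h (e : E) (he : ‖e‖ = 1) : deriv (deriv fun t : ℝ => ‖x + t • e - a‖ ^ 2) 0 = 2 := by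
    have h1 (t : ℝ) : HasDerivAt (fun t : ℝ => ‖x + t • e - a‖ ^ 2)
        (2 * inner ℝ (x - a) e + 2 * t) t := by
      have h2 : (fun t : ℝ => ‖x + t • e - a‖ ^ 2) =
          fun t => ‖x - a‖ ^ 2 + t * (2 * inner ℝ (x - a) e) + t ^ 2 := by
        ext t
        rw [show x + t • e - a = (x - a) + t • e by abel, norm_add_sq_real, norm_smul, he,
          inner_smul_right, Real.norm_eq_abs, mul_one, sq_abs]
        ring
      rw [h2]
      have := (((hasDerivAt_id t).mul_const (2 * inner ℝ (x - a) e)).const_add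
        (‖x - a‖ ^ 2)).add (hasDerivAt_pow 2 t)
      exact this.congr_deriv (by simp)
    have h2 : deriv (fun t : ℝ => ‖x + t • e - a‖ ^ 2) = fun t => 2 * inner ℝ (x - a) e + 2 * t :=
      funext fun t => (h1 t).deriv
    rw [h2]
    have := ((hasDerivAt_id (0 : ℝ)).const_mul 2).const_add (2 * inner ℝ (x - a) e)
    exact this.deriv.trans (by simp)
  simp only [h _ ((stdOrthonormalBasis ℝ E).norm_eq_one _)]
  simp [mul_comm]

/-- The weak maximum principle on a ball. -/
lemma nonpos_of_laplacian_nonneg [Nontrivial E] {a : E} {R : ℝ} {v : E → ℝ}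
    (hc : ContinuousOn v (closedBall a R)) (hv : ∀ x ∈ ball a R, ContDiffAt ℝ 2 v x)
    (hΔ : ∀ x ∈ ball a R, 0 ≤ Laplacian.laplacian v x) (hb : ∀ x ∈ sphere a R, v x ≤ 0)
    {x : E} (hx : x ∈ ball a R) : v x ≤ 0 := by
  by_contra! hpos
  have hR : 0 < R := pos_of_mem_ball hx
  have : ProperSpace E := FiniteDimensional.proper ℝ E
  have hd : (0 : ℝ) < finrank ℝ E := by exact_mod_cast finrank_pos
  -- a strictly subharmonic perturbation which is still positive at `x`
  obtain ⟨ε, hε, hεx⟩ : ∃ ε > 0, 0 < v x - ε * R ^ 2 :=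
    ⟨v x / (2 * R ^ 2), by positivity, by field_simp; linarith⟩
  set w : E → ℝ := v + ε • fun y => ‖y - a‖ ^ 2 - R ^ 2 with hw
  have hwc : ContinuousOn w (closedBall a R) := by
    refine hc.add (Continuous.continuousOn ?_)
    fun_prop
  obtain ⟨y, hy, hmax⟩ := (isCompact_closedBall a R).exists_isMaxOn
    ⟨x, ball_subset_closedBall hx⟩ hwc
  have hxy : 0 < w y := by
    refine lt_of_lt_of_le ?_ (hmax (ball_subset_closedBall hx))
    simp only [hw, Pi.add_apply, Pi.smul_apply, smul_eq_mul]
    nlinarith [sq_nonneg ‖x - a‖]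
  have hyb : y ∈ ball a R := by
    rw [mem_closedBall] at hy
    rcases hy.lt_or_eq with h | h
    · exact h
    · have h1 := hb y h
      have h2 : ‖y - a‖ = R := by rw [← dist_eq_norm]; exact h
      simp only [hw, Pi.add_apply, Pi.smul_apply, smul_eq_mul, h2] at hxy
      linarith
  have hloc : IsLocalMax w y :=
    (hmax.on_subset ball_subset_closedBall).isLocalMax (isOpen_ball.mem_nhds hyb)
  have hq : ContDiffAt ℝ 2 (fun y : E => ‖y - a‖ ^ 2) y :=
    (contDiffAt_id.sub contDiffAt_const).norm_sq ℝ
  have hq' : ContDiffAt ℝ 2 (fun y : E => ‖y - a‖ ^ 2 - R ^ 2) y := hq.sub contDiffAt_const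
  have h1 := laplacian_nonpos_of_isLocalMax hloc ((hv y hyb).add (hq'.const_smul ε))
  have h3 : Laplacian.laplacian (fun y : E => ‖y - a‖ ^ 2 - R ^ 2) y = 2 * finrank ℝ E := by
    rw [← laplacian_norm_sq a y]
    have := hq.laplacian_sub (contDiffAt_const (c := R ^ 2))
    rw [laplacian_const] at this
    simpa using! this
  have h4 : ContDiffAt ℝ 2 (ε • fun y : E => ‖y - a‖ ^ 2 - R ^ 2) y := hq'.const_smul ε
  rw [hw, (hv y hyb).laplacian_add h4, laplacian_smul ε hq', h3, smul_eq_mul] at h1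
  have := hΔ y hyb
  have : 0 < ε * (2 * finrank ℝ E) := by positivity
  linarith

lemma isCompact_sphere_of_finiteDimensional (a : E) (R : ℝ) : IsCompact (sphere a R) :=
  have : ProperSpace E := FiniteDimensional.proper ℝ E
  isCompact_sphere a R

variable [MeasurableSpace E] [BorelSpace E]

lemma harmonicOnNhd_poissonIntegral [Nontrivial E] {a : E} {R B : ℝ} (hR : 0 ≤ R) {g : E → ℝ}
    (hg : AEStronglyMeasurable g (sphereMeasure a R)) (hB : ∀ᵐ z ∂sphereMeasure a R, ‖g z‖ ≤ B) :
    HarmonicOnNhd (fun x => ∫ ζ, g ζ * ballPoissonKernel a R x ζ ∂sphereMeasure a R)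
      (ball a R) :=
  harmonicOnNhd_integral_kernel (K := ballPoissonKernel a R) (ζ := id) isOpen_ball
    (isCompact_sphere_of_finiteDimensional a R) measurable_id (ae_sphereMeasure a hR)
    (fun _ hx _ hp => contDiffAt_ballPoissonKernel hx hp)
    (fun _ hx _ hp => laplacian_ballPoissonKernel hx hp) hg hB

/-- The Poisson kernel has total mass one: its integral is a harmonic function of `x` which by rotation
invariance depends on `‖x - a‖` only, hence is constant by the maximum principle. -/
lemma integral_ballPoissonKernel [Nontrivial E] {a x : E} {R : ℝ} (hx : x ∈ ball a R) :
    ∫ ζ, ballPoissonKernel a R x ζ ∂sphereMeasure a R = 1 := by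
  have hR : 0 < R := pos_of_mem_ball hx
  set F : E → ℝ := fun x => ∫ ζ, ballPoissonKernel a R x ζ ∂sphereMeasure a R with hF
  have hharm : HarmonicOnNhd F (ball a R) := by
    simpa using harmonicOnNhd_poissonIntegral (a := a) hR.le (g := fun _ => 1) (B := 1)
      aestronglyMeasurable_const (by simp)
  have hrad (T : E ≃ₗᵢ[ℝ] E) (y : E) : F (a + T y) = F (a + y) := by
    simp only [hF]
    rw [← integral_sphereMeasure_rotate a R T]
    congr 1 with ζ
    unfold ballPoissonKernel
    have h1 : a + T y - (a + T (ζ - a)) = T (a + y - ζ) := by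
      rw [show a + y - ζ = y - (ζ - a) by abel, map_sub T y]; abel
    rw [h1, T.norm_map, add_sub_cancel_left, add_sub_cancel_left, T.norm_map]
  have hsph (y z : E) (hyz : ‖y‖ = ‖z‖) : F (a + y) = F (a + z) := by
    have := hrad ((ℝ ∙ (y - z))ᗮ.reflection) y
    rwa [Submodule.reflection_sub hyz, eq_comm] at this
  have h0 : F a = 1 := by
    simp only [hF]
    have : ∀ᵐ ζ ∂sphereMeasure a R, ballPoissonKernel a R a ζ = 1 := by
      filter_upwards [ae_sphereMeasure a hR.le] with ζ hζ using ballPoissonKernel_center hR hζ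
    rw [integral_congr_ae this]
    simp
  -- `F` is constant on the sphere through `x`, hence in the ball that it bounds
  rcases eq_or_ne x a with rfl | hxa
  · exact h0
  set ρ := ‖x - a‖ with hρ
  have hρ0 : 0 < ρ := norm_pos_iff.2 (sub_ne_zero.2 hxa)
  have hsub : closedBall a ρ ⊆ ball a R := closedBall_subset_ball (mem_ball_iff_norm.1 hx)
  have hconst (y) (hy : y ∈ sphere a ρ) : F y = F x := by
    have := hsph (y - a) (x - a) (by rw [mem_sphere_iff_norm.1 hy])
    simpa using this
  have hcont : ContinuousOn F (closedBall a ρ) := hharm.continuousOn.mono hsub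
  have hF2 (y) (hy : y ∈ ball a ρ) : ContDiffAt ℝ 2 F y :=
    (hharm y (hsub (ball_subset_closedBall hy))).1
  have hF3 (y) (hy : y ∈ ball a ρ) : Laplacian.laplacian F y = 0 :=
    (hharm y (hsub (ball_subset_closedBall hy))).2.self_of_nhds
  have h1 : F a - F x ≤ 0 := by
    refine nonpos_of_laplacian_nonneg (v := F - fun _ => F x) (hcont.sub continuousOn_const)
      (fun y hy => (hF2 y hy).sub contDiffAt_const) (fun y hy => ?_) (fun y hy => ?_)
      (mem_ball_self hρ0)
    · rw [(hF2 y hy).laplacian_sub contDiffAt_const, hF3 y hy, laplacian_const]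
      simp
    · simp [hconst y hy]
  have h2 : F x - F a ≤ 0 := by
    refine nonpos_of_laplacian_nonneg (v := (fun _ => F x) - F) (continuousOn_const.sub hcont)
      (fun y hy => contDiffAt_const.sub (hF2 y hy)) (fun y hy => ?_) (fun y hy => ?_)
      (mem_ball_self hρ0)
    · rw [ContDiffAt.laplacian_sub contDiffAt_const (hF2 y hy), hF3 y hy, laplacian_const]
      simp
    · simp [hconst y hy]
  change F x = 1
  linarith

/-- The Poisson integral of a function that is continuous on the sphere has the function as
boundary values, because the Poisson kernels concentrate at the boundary point. -/
lemma tendsto_poissonIntegral [Nontrivial E] {a : E} {R : ℝ} {g : E → ℝ}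
    (hg : ContinuousOn g (sphere a R)) (hR : 0 < R) {ζ₀ : E} (hζ₀ : ζ₀ ∈ sphere a R) :
    Tendsto (fun x => ∫ ζ, g ζ * ballPoissonKernel a R x ζ ∂sphereMeasure a R)
      (𝓝[ball a R] ζ₀) (𝓝 (g ζ₀)) := by
  have hae := Measure.restrict_eq_self_of_ae_mem (ae_sphereMeasure a hR.le)
  have key := tendsto_setIntegral_peak_smul_of_integrableOn_of_tendsto
    (μ := sphereMeasure a R) (s := sphere a R) (t := sphere a R) (x₀ := ζ₀) (a := g ζ₀)
    (φ := fun x ζ => ballPoissonKernel a R x ζ) (g := g) (l := 𝓝[ball a R] ζ₀)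
    isClosed_sphere.measurableSet isClosed_sphere.measurableSet subset_rfl self_mem_nhdsWithin
    (measure_ne_top _ _) ?_ ?_ ?_ ?_ ?_ (hg ζ₀ hζ₀)
  · rw [hae] at key
    simpa [mul_comm] using key
  · filter_upwards [self_mem_nhdsWithin] with x hx ζ _ using ballPoissonKernel_nonneg hx
  · intro u hu hζu
    obtain ⟨δ, hδ, hδu⟩ := Metric.isOpen_iff.1 hu ζ₀ hζu
    rw [Metric.tendstoUniformlyOn_iff]
    intro ε hε
    have hlim : Tendsto (fun x : E => R ^ finrank ℝ E / R ^ 2 *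
        ((R ^ 2 - ‖x - a‖ ^ 2) * ((δ / 2) ^ 2) ^ (-(finrank ℝ E : ℝ) / 2)))
        (𝓝[ball a R] ζ₀) (𝓝 0) := by
      have : Continuous fun x : E => R ^ finrank ℝ E / R ^ 2 *
        ((R ^ 2 - ‖x - a‖ ^ 2) * ((δ / 2) ^ 2) ^ (-(finrank ℝ E : ℝ) / 2)) := by fun_prop
      have h2 := (this.tendsto ζ₀).mono_left (nhdsWithin_le_nhds (s := ball a R))
      rw [mem_sphere_iff_norm.1 hζ₀] at h2
      simpa using h2
    filter_upwards [hlim.eventually (gt_mem_nhds hε), self_mem_nhdsWithin,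
      mem_nhdsWithin_of_mem_nhds (ball_mem_nhds ζ₀ (half_pos hδ))] with x h1 hx h2 ζ hζ
    have h3 : δ / 2 ≤ ‖x - ζ‖ := by
      have h4 : δ ≤ dist ζ ζ₀ := by
        by_contra! hlt
        exact hζ.2 (hδu hlt)
      have := dist_triangle ζ x ζ₀
      rw [mem_ball] at h2
      rw [← dist_eq_norm, dist_comm]
      linarith
    rw [Pi.zero_apply, dist_zero_left, Real.norm_eq_abs, abs_of_nonneg (ballPoissonKernel_nonneg hx)]
    exact (ballPoissonKernel_le hx (half_pos hδ) h3).trans_lt h1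
  · refine Tendsto.congr' ?_ tendsto_const_nhds
    filter_upwards [self_mem_nhdsWithin] with x hx
    rw [hae, integral_ballPoissonKernel hx]
  · filter_upwards [self_mem_nhdsWithin] with x hx
    rw [hae]
    exact aestronglyMeasurable_kernel (K := ballPoissonKernel a R) (ζ := id) (U := ball a R)
      (isCompact_sphere_of_finiteDimensional a R) measurable_id (ae_sphereMeasure a hR.le) hx
      (fun _ hx _ hp => contDiffAt_ballPoissonKernel hx hp)
  · exact hg.integrableOn_compact (isCompact_sphere_of_finiteDimensional a R)

/-- A function which is subharmonic in a ball and continuous up to the boundary is at most the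
Poisson integral of its boundary values, which solves the Dirichlet problem. -/
lemma le_poissonIntegral [Nontrivial E] {a : E} {R : ℝ} {v : E → ℝ}
    (hc : ContinuousOn v (closedBall a R)) (hv : ∀ x ∈ ball a R, ContDiffAt ℝ 2 v x)
    (hΔ : ∀ x ∈ ball a R, 0 ≤ Laplacian.laplacian v x) {x : E} (hx : x ∈ ball a R) :
    v x ≤ ∫ ζ, v ζ * ballPoissonKernel a R x ζ ∂sphereMeasure a R := by
  classical
  have hR : 0 < R := pos_of_mem_ball hx
  have hcs : ContinuousOn v (sphere a R) := hc.mono sphere_subset_closedBall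
  set P : E → ℝ := fun x => ∫ ζ, v ζ * ballPoissonKernel a R x ζ ∂sphereMeasure a R with hP
  have hvm : AEStronglyMeasurable v (sphereMeasure a R) := by
    rw [← Measure.restrict_eq_self_of_ae_mem (ae_sphereMeasure a hR.le)]
    exact hcs.aestronglyMeasurable_of_isCompact (isCompact_sphere_of_finiteDimensional a R)
      isClosed_sphere.measurableSet
  obtain ⟨B, hB⟩ := (isCompact_sphere_of_finiteDimensional a R).exists_bound_of_continuousOn hcs
  have hharm : HarmonicOnNhd P (ball a R) := harmonicOnNhd_poissonIntegral hR.le hvm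
    (by filter_upwards [ae_sphereMeasure a hR.le] with z hz using hB z hz)
  -- the Poisson integral, extended by `v` to the boundary
  set w : E → ℝ := fun y => if y ∈ ball a R then P y else v y with hw
  have hwP (y) (hy : y ∈ ball a R) : w =ᶠ[𝓝 y] P := by
    filter_upwards [isOpen_ball.mem_nhds hy] with z hz
    simp only [hw, if_pos hz]
  have hws (y) (hy : y ∈ sphere a R) : w y = v y := by
    simp only [hw]
    rw [if_neg]
    simp [mem_sphere.1 hy]
  have hwc : ContinuousOn w (closedBall a R) := by
    intro y hy
    rw [← ball_union_sphere] at hy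
    rcases hy with hy | hy
    · exact (((hharm y hy).1.continuousAt).congr (hwP y hy).symm).continuousWithinAt
    · rw [← ball_union_sphere]
      refine ContinuousWithinAt.union ?_ ?_
      · unfold ContinuousWithinAt
        rw [hws y hy]
        refine (tendsto_poissonIntegral hcs hR hy).congr' ?_
        filter_upwards [self_mem_nhdsWithin] with z hz
        simp only [hw, if_pos hz, hP]
      · exact (hcs y hy).congr (fun z hz => hws z hz) (hws y hy)
  have h := nonpos_of_laplacian_nonneg (v := v - w) (hc.sub hwc)
    (fun y hy => (hv y hy).sub ((hharm y hy).1.congr_of_eventuallyEq (hwP y hy)))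
    (fun y hy => ?_) (fun y hy => by simp [hws y hy]) hx
  · simp only [Pi.sub_apply, hw, if_pos hx] at h
    linarith
  · rw [(hv y hy).laplacian_sub ((hharm y hy).1.congr_of_eventuallyEq (hwP y hy)),
      (laplacian_congr_nhds (hwP y hy)).self_of_nhds, (hharm y hy).2.self_of_nhds]
    simpa using hΔ y hy

/-- A harmonic function continuous up to the boundary is the Poisson integral of its boundary
values. -/
lemma eq_poissonIntegral [Nontrivial E] {a : E} {R : ℝ} {v : E → ℝ}
    (hc : ContinuousOn v (closedBall a R)) (hv : HarmonicOnNhd v (ball a R)) {x : E}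
    (hx : x ∈ ball a R) :
    v x = ∫ ζ, v ζ * ballPoissonKernel a R x ζ ∂sphereMeasure a R := by
  refine le_antisymm (le_poissonIntegral hc (fun y hy => (hv y hy).1)
    (fun y hy => (hv y hy).2.self_of_nhds.ge) hx) ?_
  have h := le_poissonIntegral (v := -v) hc.neg (fun y hy => (hv y hy).1.neg)
    (fun y hy => ?_) hx
  · simp only [Pi.neg_apply, neg_mul, integral_neg] at h
    linarith
  · have := (hv y hy).2.self_of_nhds
    rw [laplacian_neg]
    simp [this]

end Dirichlet

/-! ### Product Poisson integrals -/

section ProductPoisson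

open MeasureTheory Metric Set Filter Topology InnerProductSpace Module Function
open scoped ENNReal

section SingleBall

variable {E : Type} [NormedAddCommGroup E] [InnerProductSpace ℝ E]

lemma measurable_ballPoissonKernel [MeasurableSpace E] [BorelSpace E] (a : E) (R : ℝ) (x : E) :
    Measurable (ballPoissonKernel a R x) := by
  have h : Measurable fun ζ : E => ‖x - ζ‖ ^ 2 := by
    have : Continuous fun ζ : E => ‖x - ζ‖ ^ 2 := by fun_prop
    exact this.measurable
  unfold ballPoissonKernel
  exact ((h.pow_const _).const_mul _).const_mul _

/-- The Poisson kernel is bounded on smaller concentric balls: the source of Harnack's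
inequality. -/
lemma exists_ballPoissonKernel_le (a : E) {s R : ℝ} (hs : 0 ≤ s) (hsR : s < R) :
    ∃ C, ∀ x ∈ closedBall a s, ∀ ζ ∈ sphere a R, ballPoissonKernel a R x ζ ≤ C := by
  refine ⟨R ^ finrank ℝ E / R ^ 2 * (R ^ 2 * ((R - s) ^ 2) ^ (-(finrank ℝ E : ℝ) / 2)),
    fun x hx ζ hζ => ?_⟩
  have hR : 0 < R := hs.trans_lt hsR
  have h1 : R - s ≤ ‖x - ζ‖ := by
    have h2 := mem_closedBall_iff_norm.1 hx
    have h3 := mem_sphere_iff_norm.1 hζ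
    have := norm_sub_le_norm_sub_add_norm_sub ζ x a
    rw [norm_sub_rev x ζ]
    linarith
  refine (ballPoissonKernel_le (closedBall_subset_ball hsR hx) (sub_pos.2 hsR) h1).trans ?_
  gcongr
  linarith [sq_nonneg ‖x - a‖]

variable [FiniteDimensional ℝ E] [Nontrivial E] [MeasurableSpace E] [BorelSpace E]

lemma ofReal_poissonIntegral {a x : E} {R : ℝ} {v : E → ℝ} (hv : ContinuousOn v (closedBall a R))
    (hx : x ∈ ball a R) (h0 : ∀ y ∈ closedBall a R, 0 ≤ v y) :
    ENNReal.ofReal (∫ ζ, v ζ * ballPoissonKernel a R x ζ ∂sphereMeasure a R) =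
      ∫⁻ ζ, ENNReal.ofReal (ballPoissonKernel a R x ζ) * ENNReal.ofReal (v ζ)
        ∂sphereMeasure a R := by
  have hR : 0 < R := pos_of_mem_ball hx
  have hae := Measure.restrict_eq_self_of_ae_mem (ae_sphereMeasure a hR.le)
  have hK : ContinuousOn (ballPoissonKernel a R x) (sphere a R) := fun p hp =>
    ((contDiffAt_ballPoissonKernel hx hp).continuousAt.comp (f := fun p => (x, p))
      (by fun_prop)).continuousWithinAt
  have hint : Integrable (fun ζ => v ζ * ballPoissonKernel a R x ζ) (sphereMeasure a R) := by
    have := ((hv.mono sphere_subset_closedBall).mul hK).integrableOn_compact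
      (μ := sphereMeasure a R) (isCompact_sphere_of_finiteDimensional a R)
    rwa [IntegrableOn, hae] at this
  rw [ofReal_integral_eq_lintegral_ofReal hint]
  · refine lintegral_congr fun ζ => ?_
    rw [mul_comm, ENNReal.ofReal_mul (ballPoissonKernel_nonneg hx)]
  · filter_upwards [ae_sphereMeasure a hR.le] with ζ hζ
    exact mul_nonneg (h0 ζ (sphere_subset_closedBall hζ)) (ballPoissonKernel_nonneg hx)

end SingleBall

variable {ι : Type} [Fintype ι] [DecidableEq ι] {E : ι → Type} [∀ i, NormedAddCommGroup (E i)]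
  [∀ i, InnerProductSpace ℝ (E i)]

/-- The product of the open balls with centers `a i` and radii `ρ i`. -/
def prodBall (a : ∀ i, E i) (ρ : ι → ℝ) : Set (∀ i, E i) := {z | ∀ i, z i ∈ ball (a i) (ρ i)}

/-- The product of the closed balls with centers `a i` and radii `ρ i`. -/
def prodClosedBall (a : ∀ i, E i) (ρ : ι → ℝ) : Set (∀ i, E i) :=
  {z | ∀ i, z i ∈ closedBall (a i) (ρ i)}

lemma isOpen_prodBall (a : ∀ i, E i) (ρ : ι → ℝ) : IsOpen (prodBall a ρ) := by
  have h : prodBall a ρ = ⋂ i, (fun z : ∀ i, E i => z i) ⁻¹' ball (a i) (ρ i) := by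
    ext z; simp [prodBall]
  rw [h]
  exact isOpen_iInter_of_finite fun i => isOpen_ball.preimage (continuous_apply i)

lemma prodClosedBall_subset_prodBall (a : ∀ i, E i) {ρ r : ι → ℝ} (h : ∀ i, ρ i < r i) :
    prodClosedBall a ρ ⊆ prodBall a r := fun _ hz i => closedBall_subset_ball (h i) (hz i)

lemma prodBall_subset_prodClosedBall (a : ∀ i, E i) (ρ : ι → ℝ) :
    prodBall a ρ ⊆ prodClosedBall a ρ := fun _ hz i => ball_subset_closedBall (hz i)

lemma update_mem_prodClosedBall {a z : ∀ i, E i} {ρ : ι → ℝ} (hz : z ∈ prodClosedBall a ρ) {i : ι}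
    {y : E i} (hy : y ∈ closedBall (a i) (ρ i)) : update z i y ∈ prodClosedBall a ρ := by
  intro j
  rcases eq_or_ne j i with rfl | hj
  · simpa using hy
  · rw [update_of_ne hj]; exact hz j

lemma update_mem_prodBall {a z : ∀ i, E i} {ρ : ι → ℝ} (hz : z ∈ prodBall a ρ) {i : ι}
    {y : E i} (hy : y ∈ ball (a i) (ρ i)) : update z i y ∈ prodBall a ρ := by
  intro j
  rcases eq_or_ne j i with rfl | hj
  · simpa using hy
  · rw [update_of_ne hj]; exact hz j

/-- The Poisson kernel of a product of balls with respect to its distinguished boundary. -/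
noncomputable def prodKernel (a : ∀ i, E i) (ρ : ι → ℝ) (x ζ : ∀ i, E i) : ℝ :=
  ∏ i, ballPoissonKernel (a i) (ρ i) (x i) (ζ i)

lemma prodKernel_nonneg {a x : ∀ i, E i} {ρ : ι → ℝ} (hx : x ∈ prodBall a ρ) (ζ : ∀ i, E i) :
    0 ≤ prodKernel a ρ x ζ :=
  Finset.prod_nonneg fun i _ => ballPoissonKernel_nonneg (hx i)

lemma exists_prodKernel_le (a : ∀ i, E i) {s ρ : ι → ℝ} (hs : ∀ i, 0 ≤ s i)
    (hsρ : ∀ i, s i < ρ i) : ∃ C, ∀ x ∈ prodClosedBall a s, ∀ ζ : ∀ i, E i,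
      (∀ i, ζ i ∈ sphere (a i) (ρ i)) → prodKernel a ρ x ζ ≤ C := by
  choose C hC using fun i => exists_ballPoissonKernel_le (a i) (hs i) (hsρ i)
  exact ⟨∏ i, C i, fun x hx ζ hζ => Finset.prod_le_prod
    (fun i _ => ballPoissonKernel_nonneg (closedBall_subset_ball (hsρ i) (hx i)))
    fun i _ => hC i _ (hx i) _ (hζ i)⟩

variable [∀ i, FiniteDimensional ℝ (E i)] [∀ i, MeasurableSpace (E i)] [∀ i, BorelSpace (E i)]

lemma measurable_prodKernel (a : ∀ i, E i) (ρ : ι → ℝ) (x : ∀ i, E i) :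
    Measurable (prodKernel a ρ x) :=
  Finset.measurable_fun_prod _ fun i _ =>
    (measurable_ballPoissonKernel (a i) (ρ i) (x i)).comp (measurable_pi_apply i)

/-- The rotation invariant probability measure on the product of the spheres with centers `a i` and
radii `ρ i`, the distinguished boundary of the product of balls. -/
noncomputable def boundaryMeasure (a : ∀ i, E i) (ρ : ι → ℝ) : Measure (∀ i, E i) :=
  Measure.pi fun i => sphereMeasure (a i) (ρ i)

instance (a : ∀ i, E i) (ρ : ι → ℝ) : IsProbabilityMeasure (boundaryMeasure a ρ) := by
  unfold boundaryMeasure; infer_instance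

lemma ae_boundaryMeasure [∀ i, Nontrivial (E i)] (a : ∀ i, E i) {ρ : ι → ℝ} (hρ : ∀ i, 0 ≤ ρ i) :
    ∀ᵐ ζ ∂boundaryMeasure a ρ, ∀ i, ζ i ∈ sphere (a i) (ρ i) :=
  ae_all_iff.2 fun i => (measurePreserving_eval (fun i => sphereMeasure (a i) (ρ i)) i
    ).quasiMeasurePreserving.ae (ae_sphereMeasure (a i) (hρ i))

lemma mem_prodClosedBall_of_sphere {a ζ : ∀ i, E i} {ρ : ι → ℝ}
    (h : ∀ i, ζ i ∈ sphere (a i) (ρ i)) : ζ ∈ prodClosedBall a ρ :=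
  fun i => sphere_subset_closedBall (h i)

/-- The Poisson integral of a nonnegative function on a product of balls.  It takes values in
`ℝ≥0∞`, so that it is defined without integrability and commutes with increasing limits. -/
noncomputable def poissonLIntegral (a : ∀ i, E i) (ρ : ι → ℝ) (F : (∀ i, E i) → ℝ≥0∞)
    (x : ∀ i, E i) : ℝ≥0∞ :=
  ∫⁻ ζ, ENNReal.ofReal (prodKernel a ρ x ζ) * F ζ ∂boundaryMeasure a ρ

section Iteration

variable (a : ∀ i, E i) (ρ : ι → ℝ) (x : ∀ i, E i) (F : (∀ i, E i) → ℝ≥0∞)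

/-- The integrand of a partial Poisson integral, over the variables in `J` only. -/
noncomputable def partialIntegrand (J : Finset ι) (ζ : ∀ i, E i) : ℝ≥0∞ :=
  (∏ i ∈ J, ENNReal.ofReal (ballPoissonKernel (a i) (ρ i) (x i) (ζ i))) * F ζ

variable {F}

lemma measurable_partialIntegrand (hF : Measurable F) (J : Finset ι) :
    Measurable (partialIntegrand a ρ x F J) :=
  (Finset.measurable_fun_prod _ fun i _ => ((measurable_ballPoissonKernel (a i) (ρ i) (x i)).comp
    (measurable_pi_apply i)).ennreal_ofReal).mul hF

lemma lmarginal_partialIntegrand_insert (hF : Measurable F) {J : Finset ι} {j : ι} (hj : j ∉ J)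
    (z : ∀ i, E i) :
    lmarginal (fun i => sphereMeasure (a i) (ρ i)) (insert j J)
      (partialIntegrand a ρ x F (insert j J)) z =
    ∫⁻ y, ENNReal.ofReal (ballPoissonKernel (a j) (ρ j) (x j) y) *
      lmarginal (fun i => sphereMeasure (a i) (ρ i)) J (partialIntegrand a ρ x F J) (update z j y)
      ∂sphereMeasure (a j) (ρ j) := by
  rw [lmarginal_insert _ (measurable_partialIntegrand a ρ x hF _) hj]
  refine lintegral_congr fun y => ?_
  unfold lmarginal
  have hm : Measurable fun ζ => partialIntegrand a ρ x F J (updateFinset (update z j y) J ζ) :=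
    (measurable_partialIntegrand a ρ x hF J).comp measurable_updateFinset
  rw [← lintegral_const_mul _ hm]
  refine lintegral_congr fun ζ => ?_
  unfold partialIntegrand
  rw [Finset.prod_insert hj, mul_assoc]
  congr 3
  simp [updateFinset, hj]

lemma lmarginal_partialIntegrand_univ (z : ∀ i, E i) (hx : x ∈ prodBall a ρ) :
    lmarginal (fun i => sphereMeasure (a i) (ρ i)) Finset.univ
      (partialIntegrand a ρ x F Finset.univ) z = poissonLIntegral a ρ F x := by
  rw [lmarginal_univ]
  unfold poissonLIntegral partialIntegrand prodKernel boundaryMeasure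
  refine lintegral_congr fun ζ => ?_
  rw [ENNReal.ofReal_prod_of_nonneg fun i _ => ballPoissonKernel_nonneg (hx i)]

variable {a ρ x} [∀ i, Nontrivial (E i)]

/-- A function which is dominated by its Poisson integrals in each variable separately is dominated
by its product Poisson integral: replace one variable after the other. -/
lemma le_poissonLIntegral (hρ : ∀ i, 0 ≤ ρ i) (hF : Measurable F)
    (h : ∀ z ∈ prodClosedBall a ρ, ∀ i, z i ∈ ball (a i) (ρ i) →
      F z ≤ ∫⁻ y, ENNReal.ofReal (ballPoissonKernel (a i) (ρ i) (z i) y) * F (update z i y)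
        ∂sphereMeasure (a i) (ρ i)) (hx : x ∈ prodBall a ρ) :
    F x ≤ poissonLIntegral a ρ F x := by
  have key : ∀ J : Finset ι, ∀ z ∈ prodClosedBall a ρ, (∀ i ∈ J, z i = x i) →
      F z ≤ lmarginal (fun i => sphereMeasure (a i) (ρ i)) J (partialIntegrand a ρ x F J) z := by
    intro J
    induction J using Finset.induction_on with
    | empty => intro z _ _; simp [partialIntegrand]
    | insert j J hj ih =>
      intro z hz hzx
      rw [lmarginal_partialIntegrand_insert a ρ x hF hj]
      have hzj : z j = x j := hzx j (Finset.mem_insert_self j J)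
      refine (h z hz j (by rw [hzj]; exact hx j)).trans (lintegral_mono_ae ?_)
      filter_upwards [ae_sphereMeasure (a j) (hρ j)] with y hy
      rw [hzj]
      refine mul_le_mul_right (ih _ (update_mem_prodClosedBall hz (sphere_subset_closedBall hy))
        fun i hi => ?_) _
      rw [update_of_ne (ne_of_mem_of_not_mem hi hj)]
      exact hzx i (Finset.mem_insert_of_mem hi)
  have := key Finset.univ x (prodBall_subset_prodClosedBall a ρ hx) fun _ _ => rfl
  rwa [lmarginal_partialIntegrand_univ a ρ x x hx] at this

/-- A function which is the Poisson integral of itself in each variable separately is its own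
product Poisson integral. -/
lemma eq_poissonLIntegral (hρ : ∀ i, 0 ≤ ρ i) (hF : Measurable F)
    (h : ∀ z ∈ prodClosedBall a ρ, ∀ i, z i ∈ ball (a i) (ρ i) →
      F z = ∫⁻ y, ENNReal.ofReal (ballPoissonKernel (a i) (ρ i) (z i) y) * F (update z i y)
        ∂sphereMeasure (a i) (ρ i)) (hx : x ∈ prodBall a ρ) :
    F x = poissonLIntegral a ρ F x := by
  have key : ∀ J : Finset ι, ∀ z ∈ prodClosedBall a ρ, (∀ i ∈ J, z i = x i) →
      F z = lmarginal (fun i => sphereMeasure (a i) (ρ i)) J (partialIntegrand a ρ x F J) z := by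
    intro J
    induction J using Finset.induction_on with
    | empty => intro z _ _; simp [partialIntegrand]
    | insert j J hj ih =>
      intro z hz hzx
      rw [lmarginal_partialIntegrand_insert a ρ x hF hj]
      have hzj : z j = x j := hzx j (Finset.mem_insert_self j J)
      refine (h z hz j (by rw [hzj]; exact hx j)).trans (lintegral_congr_ae ?_)
      filter_upwards [ae_sphereMeasure (a j) (hρ j)] with y hy
      rw [hzj, ih _ (update_mem_prodClosedBall hz (sphere_subset_closedBall hy)) fun i hi => ?_]
      rw [update_of_ne (ne_of_mem_of_not_mem hi hj)]
      exact hzx i (Finset.mem_insert_of_mem hi)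
  have := key Finset.univ x (prodBall_subset_prodClosedBall a ρ hx) fun _ _ => rfl
  rwa [lmarginal_partialIntegrand_univ a ρ x x hx] at this

end Iteration

/-- Functions on an open subset of a product that are continuous and harmonic in each of the
variables separately. -/
def NHarmonicOn (s : Set (∀ i, E i)) (u : (∀ i, E i) → ℝ) : Prop :=
  ContinuousOn u s ∧ ∀ z ∈ s, ∀ i, HarmonicAt (fun w => u (update z i w)) (z i)

variable [∀ i, Nontrivial (E i)] {a : ∀ i, E i} {ρ r : ι → ℝ}

/-- A nonnegative `n`-harmonic function is the product Poisson integral of its values on the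
distinguished boundary of a smaller product of balls. -/
lemma NHarmonicOn.eq_poissonLIntegral {u : (∀ i, E i) → ℝ} (hu : NHarmonicOn (prodBall a r) u)
    (hm : Measurable u) (h0 : ∀ z ∈ prodBall a r, 0 ≤ u z) (hρ : ∀ i, 0 ≤ ρ i)
    (hρr : ∀ i, ρ i < r i) {x : ∀ i, E i} (hx : x ∈ prodBall a ρ) :
    ENNReal.ofReal (u x) = poissonLIntegral a ρ (fun z => ENNReal.ofReal (u z)) x := by
  refine BeurlingModule.eq_poissonLIntegral (F := fun z => ENNReal.ofReal (u z)) hρ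
    hm.ennreal_ofReal (fun z hz i hi => ?_) hx
  have hmem (y : E i) (hy : y ∈ closedBall (a i) (ρ i)) : update z i y ∈ prodBall a r :=
    prodClosedBall_subset_prodBall a hρr (update_mem_prodClosedBall hz hy)
  have hc : ContinuousOn (fun w => u (update z i w)) (closedBall (a i) (ρ i)) :=
    hu.1.comp (continuous_const.update i continuous_id).continuousOn hmem
  have hh : HarmonicOnNhd (fun w => u (update z i w)) (ball (a i) (ρ i)) := fun y hy => by
    simpa using hu.2 _ (hmem y (ball_subset_closedBall hy)) i
  have := eq_poissonIntegral hc hh hi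
  rw [← ofReal_poissonIntegral hc hi fun y hy => h0 _ (hmem y hy), ← this, update_eq_self]

/-- The Poisson integral of a bounded function is `n`-harmonic. -/
lemma nHarmonicOn_poissonLIntegral (hρ : ∀ i, 0 < ρ i) {F : (∀ i, E i) → ℝ≥0∞} (hF : Measurable F)
    {B : ℝ} (hB : ∀ᵐ ζ ∂boundaryMeasure a ρ, F ζ ≤ ENNReal.ofReal B) :
    NHarmonicOn (prodBall a ρ) fun x => (poissonLIntegral a ρ F x).toReal := by
  have hsph := ae_boundaryMeasure a fun i => (hρ i).le
  have hBr : ∀ᵐ ζ ∂boundaryMeasure a ρ, ‖(F ζ).toReal‖ ≤ max B 0 := by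
    filter_upwards [hB] with ζ hζ
    rw [Real.norm_eq_abs, abs_of_nonneg ENNReal.toReal_nonneg]
    exact (ENNReal.toReal_mono ENNReal.ofReal_ne_top hζ).trans (by rw [ENNReal.toReal_ofReal'])
  have hform (x) (hx : x ∈ prodBall a ρ) : (poissonLIntegral a ρ F x).toReal =
      ∫ ζ, prodKernel a ρ x ζ * (F ζ).toReal ∂boundaryMeasure a ρ := by
    unfold poissonLIntegral
    rw [← integral_toReal]
    · refine integral_congr_ae (Eventually.of_forall fun ζ => ?_)
      simp [ENNReal.toReal_mul, ENNReal.toReal_ofReal (prodKernel_nonneg hx ζ)]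
    · exact ((measurable_prodKernel a ρ x).ennreal_ofReal.mul hF).aemeasurable
    · filter_upwards [hB] with ζ hζ
      exact ENNReal.mul_lt_top ENNReal.ofReal_lt_top (hζ.trans_lt ENNReal.ofReal_lt_top)
  have hmeas (x) : AEStronglyMeasurable (fun ζ => prodKernel a ρ x ζ * (F ζ).toReal)
      (boundaryMeasure a ρ) :=
    ((measurable_prodKernel a ρ x).mul hF.ennreal_toReal).aestronglyMeasurable
  constructor
  · refine ContinuousOn.congr ?_ hform
    intro x hx
    refine ContinuousAt.continuousWithinAt ?_
    -- a smaller product of balls on which the kernel is bounded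
    set s : ι → ℝ := fun i => (‖x i - a i‖ + ρ i) / 2 with hs
    have hxi (i) : ‖x i - a i‖ < ρ i := mem_ball_iff_norm.1 (hx i)
    obtain ⟨C, hC⟩ := exists_prodKernel_le a (s := s) (ρ := ρ)
      (fun i => by have := hρ i; positivity) (fun i => by have := hxi i; simp only [hs]; linarith)
    have hxs : prodBall a s ∈ 𝓝 x := (isOpen_prodBall a s).mem_nhds fun i =>
      mem_ball_iff_norm.2 (by have := hxi i; simp only [hs]; linarith)
    refine continuousAt_of_dominated (bound := fun _ => C * max B 0)
      (Eventually.of_forall hmeas) ?_ (integrable_const _) ?_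
    · filter_upwards [hxs, (isOpen_prodBall a ρ).mem_nhds hx] with y hy hyρ
      filter_upwards [hsph, hBr] with ζ hζ hζB
      have hn := prodKernel_nonneg hyρ ζ
      have hle := hC y (prodBall_subset_prodClosedBall a s hy) ζ hζ
      rw [norm_mul, Real.norm_eq_abs, abs_of_nonneg hn]
      exact mul_le_mul hle hζB (norm_nonneg _) (hn.trans hle)
    · filter_upwards [hsph] with ζ hζ
      refine ContinuousAt.mul ?_ continuousAt_const
      unfold prodKernel
      refine tendsto_finsetProd _ fun i _ => ?_
      have h1 := (contDiffAt_ballPoissonKernel (hx i) (hζ i)).continuousAt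
      exact h1.comp (f := fun y : ∀ i, E i => (y i, ζ i)) (x := x)
        ((continuous_apply i).prodMk continuous_const).continuousAt
  · intro z hz i
    -- in the `i`-th variable, the other factors of the kernel belong to the density
    set g : (∀ i, E i) → ℝ := fun ζ =>
      (∏ j ∈ Finset.univ.erase i, ballPoissonKernel (a j) (ρ j) (z j) (ζ j)) * (F ζ).toReal with hg
    have hslice : (fun w => (poissonLIntegral a ρ F (update z i w)).toReal) =ᶠ[𝓝 (z i)]
        fun w => ∫ ζ, g ζ * ballPoissonKernel (a i) (ρ i) w (ζ i) ∂boundaryMeasure a ρ := by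
      filter_upwards [isOpen_ball.mem_nhds (hz i)] with w hw
      rw [hform _ (update_mem_prodBall hz hw)]
      congr 1 with ζ
      unfold prodKernel
      rw [← Finset.mul_prod_erase Finset.univ _ (Finset.mem_univ i), update_self, hg]
      have : ∏ j ∈ Finset.univ.erase i, ballPoissonKernel (a j) (ρ j) (update z i w j) (ζ j) =
          ∏ j ∈ Finset.univ.erase i, ballPoissonKernel (a j) (ρ j) (z j) (ζ j) :=
        Finset.prod_congr rfl fun j hj => by rw [update_of_ne (Finset.ne_of_mem_erase hj)]
      rw [this]
      ring
    rw [harmonicAt_congr_nhds hslice]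
    choose C hC using fun j => exists_ballPoissonKernel_le (a j) (norm_nonneg (z j - a j))
      (mem_ball_iff_norm.1 (hz j))
    refine harmonicOnNhd_integral_kernel (μ := boundaryMeasure a ρ)
      (K := ballPoissonKernel (a i) (ρ i)) (U := ball (a i) (ρ i)) (C := sphere (a i) (ρ i))
      (ζ := fun ζ => ζ i) (g := g) (B := (∏ j ∈ Finset.univ.erase i, C j) * max B 0)
      isOpen_ball (isCompact_sphere_of_finiteDimensional _ _) (measurable_pi_apply i) ?_
      (fun _ hx _ hp => contDiffAt_ballPoissonKernel hx hp)
      (fun _ hx _ hp => laplacian_ballPoissonKernel hx hp) ?_ ?_ (z i) (hz i)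
    · filter_upwards [hsph] with ζ hζ using hζ i
    · exact ((Finset.measurable_fun_prod _ fun j _ =>
        (measurable_ballPoissonKernel (a j) (ρ j) (z j)).comp
        (measurable_pi_apply j)).mul hF.ennreal_toReal).aestronglyMeasurable
    · filter_upwards [hsph, hBr] with ζ hζ hζB
      have hn : 0 ≤ ∏ j ∈ Finset.univ.erase i, ballPoissonKernel (a j) (ρ j) (z j) (ζ j) :=
        Finset.prod_nonneg fun j _ => ballPoissonKernel_nonneg (hz j)
      have hle : ∏ j ∈ Finset.univ.erase i, ballPoissonKernel (a j) (ρ j) (z j) (ζ j) ≤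
          ∏ j ∈ Finset.univ.erase i, C j :=
        Finset.prod_le_prod (fun j _ => ballPoissonKernel_nonneg (hz j)) fun j _ =>
          hC j _ (by simp [dist_eq_norm]) _ (hζ j)
      rw [hg, norm_mul, Real.norm_eq_abs, abs_of_nonneg hn]
      exact mul_le_mul hle hζB (norm_nonneg _) (hn.trans hle)

end ProductPoisson

/-! ### The least `n`-harmonic majorant -/

section LeastMajorant

open MeasureTheory Metric Set Filter Topology InnerProductSpace Module Function
open scoped ENNReal

variable {ι : Type} [Fintype ι] [DecidableEq ι] {E : ι → Type} [∀ i, NormedAddCommGroup (E i)]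
  [∀ i, InnerProductSpace ℝ (E i)] [∀ i, FiniteDimensional ℝ (E i)] [∀ i, MeasurableSpace (E i)]
  [∀ i, BorelSpace (E i)] [∀ i, Nontrivial (E i)]

/-- The radii `(m + 1) / (m + 2) * r i`, increasing to `r i`. -/
noncomputable def innerRadius (r : ι → ℝ) (m : ℕ) (i : ι) : ℝ := (m + 1) / (m + 2) * r i

section InnerRadius

variable {r : ι → ℝ} (hr : ∀ i, 0 < r i)
include hr

lemma innerRadius_pos (m : ℕ) (i : ι) : 0 < innerRadius r m i := by
  have := hr i
  unfold innerRadius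
  positivity

lemma innerRadius_lt (m : ℕ) (i : ι) : innerRadius r m i < r i := by
  unfold innerRadius
  refine mul_lt_of_lt_one_left (hr i) ?_
  rw [div_lt_one (by positivity)]
  linarith

lemma innerRadius_strictMono (i : ι) : StrictMono fun m => innerRadius r m i := by
  refine strictMono_nat_of_lt_succ fun m => ?_
  unfold innerRadius
  refine mul_lt_mul_of_pos_right ?_ (hr i)
  rw [div_lt_div_iff₀ (by positivity) (by positivity)]
  push_cast
  nlinarith

lemma tendsto_innerRadius (i : ι) : Tendsto (fun m => innerRadius r m i) atTop (𝓝 (r i)) := by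
  have h : Tendsto (fun m : ℕ => ((m : ℝ) + 1) / (m + 2)) atTop (𝓝 1) := by
    have h1 := (tendsto_natCast_div_add_atTop (1 : ℝ)).comp (tendsto_add_atTop_nat 1)
    refine h1.congr fun m => ?_
    simp only [comp_apply]
    push_cast
    ring
  simpa [innerRadius] using h.mul_const (r i)

lemma exists_mem_prodBall_innerRadius {a x : ∀ i, E i} (hx : x ∈ prodBall a r) :
    ∃ m, x ∈ prodBall a (innerRadius r m) := by
  have h : ∀ᶠ m in atTop, ∀ i, dist (x i) (a i) < innerRadius r m i :=
    eventually_all.2 fun i => (tendsto_innerRadius hr i).eventually (lt_mem_nhds (hx i))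
  exact h.exists

lemma prodBall_innerRadius_subset (a : ∀ i, E i) (m : ℕ) :
    prodBall a (innerRadius r m) ⊆ prodBall a r := fun _ hz i =>
  ball_subset_ball (innerRadius_lt hr m i).le (hz i)

lemma center_mem_prodBall (a : ∀ i, E i) : a ∈ prodBall a r := fun i => mem_ball_self (hr i)

end InnerRadius

/-- Measurable functions on a product of balls that are locally bounded and subharmonic in each
variable separately, the latter in the sense that they are dominated by their Poisson integrals. -/
structure IsNSubharmonicOn (a : ∀ i, E i) (r : ι → ℝ) (F : (∀ i, E i) → ℝ≥0∞) : Prop where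
  measurable : Measurable F
  bounded : ∀ ρ : ι → ℝ, (∀ i, ρ i < r i) →
    ∃ B, ∀ z ∈ prodClosedBall a ρ, F z ≤ ENNReal.ofReal B
  le_integral : ∀ ρ : ι → ℝ, (∀ i, ρ i < r i) →
    ∀ z ∈ prodClosedBall a ρ, ∀ i, z i ∈ ball (a i) (ρ i) →
      F z ≤ ∫⁻ y, ENNReal.ofReal (ballPoissonKernel (a i) (ρ i) (z i) y) * F (update z i y)
        ∂sphereMeasure (a i) (ρ i)

lemma measurable_poissonLIntegral (a : ∀ i, E i) (ρ : ι → ℝ) {F : (∀ i, E i) → ℝ≥0∞}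
    (hF : Measurable F) : Measurable (poissonLIntegral a ρ F) := by
  unfold poissonLIntegral
  refine Measurable.lintegral_prod_right' (f := fun p : (∀ i, E i) × (∀ i, E i) =>
    ENNReal.ofReal (prodKernel a ρ p.1 p.2) * F p.2) ?_
  refine Measurable.mul (Measurable.ennreal_ofReal ?_) (hF.comp measurable_snd)
  refine Finset.measurable_fun_prod _ fun i _ => ?_
  unfold ballPoissonKernel
  have h1 : Measurable fun p : (∀ i, E i) × (∀ i, E i) => p.1 i :=
    (measurable_pi_apply i).comp measurable_fst
  have h2 : Measurable fun p : (∀ i, E i) × (∀ i, E i) => p.2 i :=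
    (measurable_pi_apply i).comp measurable_snd
  have h3 : Measurable fun p : (∀ i, E i) × (∀ i, E i) => ‖p.1 i - a i‖ := (h1.sub_const _).norm
  have h4 : Measurable fun p : (∀ i, E i) × (∀ i, E i) => ‖p.1 i - p.2 i‖ := (h1.sub h2).norm
  exact (((h3.pow_const 2).const_sub _).mul ((h4.pow_const 2).pow_const _)).const_mul _

lemma poissonLIntegral_mono_ae {a x : ∀ i, E i} {ρ : ι → ℝ} {F G : (∀ i, E i) → ℝ≥0∞}
    (h : ∀ᵐ ζ ∂boundaryMeasure a ρ, F ζ ≤ G ζ) :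
    poissonLIntegral a ρ F x ≤ poissonLIntegral a ρ G x := by
  refine lintegral_mono_ae ?_
  filter_upwards [h] with ζ hζ using mul_le_mul_right hζ _

lemma poissonLIntegral_center (a : ∀ i, E i) {ρ : ι → ℝ} (hρ : ∀ i, 0 < ρ i)
    (F : (∀ i, E i) → ℝ≥0∞) : poissonLIntegral a ρ F a = ∫⁻ ζ, F ζ ∂boundaryMeasure a ρ := by
  refine lintegral_congr_ae ?_
  filter_upwards [ae_boundaryMeasure a fun i => (hρ i).le] with ζ hζ
  have : prodKernel a ρ a ζ = 1 :=
    Finset.prod_eq_one fun i _ => ballPoissonKernel_center (hρ i) (hζ i)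
  simp [this]

lemma poissonLIntegral_one {a x : ∀ i, E i} {ρ : ι → ℝ} (hx : x ∈ prodBall a ρ) :
    poissonLIntegral a ρ 1 x = 1 := by
  refine (eq_poissonLIntegral (fun i => (pos_of_mem_ball (hx i)).le) measurable_one
    (fun z _ i hi => ?_) hx).symm
  have := ofReal_poissonIntegral (v := fun _ => 1) continuousOn_const hi fun _ _ => zero_le_one
  simpa [integral_ballPoissonKernel hi] using this

variable (a : ∀ i, E i) (r : ι → ℝ) (F : (∀ i, E i) → ℝ≥0∞)

/-- The Poisson integral of `F` from the distinguished boundary of the `m`-th inner product of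
balls, extended by `0`. -/
noncomputable def innerPoisson (m : ℕ) : (∀ i, E i) → ℝ≥0∞ :=
  (prodBall a (innerRadius r m)).indicator (poissonLIntegral a (innerRadius r m) F)

/-- The limit of the Poisson integrals of `F`, which for an `n`-subharmonic function is its least
`n`-harmonic majorant. -/
noncomputable def leastMajorant (x : ∀ i, E i) : ℝ≥0∞ := ⨆ m, innerPoisson a r F m x

variable {a r F} (hr : ∀ i, 0 < r i) (hF : IsNSubharmonicOn a r F)
include hr hF

lemma measurable_innerPoisson (m : ℕ) : Measurable (innerPoisson a r F m) :=
  (measurable_poissonLIntegral a _ hF.measurable).indicator (isOpen_prodBall _ _).measurableSet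

lemma measurable_leastMajorant : Measurable (leastMajorant a r F) :=
  Measurable.iSup fun m => measurable_innerPoisson hr hF m

lemma exists_bound_boundary (m : ℕ) : ∃ B, 0 ≤ B ∧
    ∀ᵐ ζ ∂boundaryMeasure a (innerRadius r m), F ζ ≤ ENNReal.ofReal B := by
  obtain ⟨B, hB⟩ := hF.bounded (innerRadius r m) (innerRadius_lt hr m)
  refine ⟨max B 0, le_max_right _ _, ?_⟩
  filter_upwards [ae_boundaryMeasure a fun i => (innerRadius_pos hr m i).le] with ζ hζ
  exact (hB ζ (mem_prodClosedBall_of_sphere hζ)).trans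
    (ENNReal.ofReal_le_ofReal (le_max_left _ _))

lemma innerPoisson_lt_top (m : ℕ) (x : ∀ i, E i) : innerPoisson a r F m x < ⊤ := by
  obtain ⟨B, -, hB⟩ := exists_bound_boundary hr hF m
  unfold innerPoisson
  by_cases hx : x ∈ prodBall a (innerRadius r m)
  · rw [indicator_of_mem hx]
    have h1 : poissonLIntegral a (innerRadius r m) F x ≤
        ENNReal.ofReal B * poissonLIntegral a (innerRadius r m) 1 x := by
      unfold poissonLIntegral
      rw [← lintegral_const_mul' _ _ ENNReal.ofReal_ne_top]
      refine lintegral_mono_ae ?_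
      filter_upwards [hB] with ζ hζ
      rw [Pi.one_apply, mul_one, mul_comm]
      exact mul_le_mul_left hζ _
    rw [poissonLIntegral_one hx, mul_one] at h1
    exact h1.trans_lt ENNReal.ofReal_lt_top
  · rw [indicator_of_notMem hx]
    exact ENNReal.zero_lt_top

lemma nHarmonicOn_innerPoisson (m : ℕ) :
    NHarmonicOn (prodBall a (innerRadius r m)) fun x => (innerPoisson a r F m x).toReal := by
  obtain ⟨B, -, hB⟩ := exists_bound_boundary hr hF m
  have h := nHarmonicOn_poissonLIntegral (innerRadius_pos hr m) hF.measurable hB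
  refine ⟨h.1.congr fun x hx => ?_, fun z hz i => ?_⟩
  · simp only [innerPoisson, indicator_of_mem hx]
  · refine (harmonicAt_congr_nhds ?_).2 (h.2 z hz i)
    filter_upwards [isOpen_ball.mem_nhds (hz i)] with w hw
    simp only [innerPoisson, indicator_of_mem (update_mem_prodBall hz hw)]

lemma innerPoisson_eq {m l : ℕ} (hlm : l < m) {x : ∀ i, E i}
    (hx : x ∈ prodBall a (innerRadius r l)) :
    innerPoisson a r F m x = poissonLIntegral a (innerRadius r l) (innerPoisson a r F m) x := by
  have h := (nHarmonicOn_innerPoisson hr hF m).eq_poissonLIntegral (ρ := innerRadius r l)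
    (measurable_innerPoisson hr hF m).ennreal_toReal (fun _ _ => ENNReal.toReal_nonneg)
    (fun i => (innerRadius_pos hr l i).le) (fun i => innerRadius_strictMono hr i hlm) hx
  simpa only [ENNReal.ofReal_toReal (innerPoisson_lt_top hr hF m _).ne] using h

lemma le_innerPoisson {m : ℕ} {x : ∀ i, E i} (hx : x ∈ prodBall a (innerRadius r m)) :
    F x ≤ innerPoisson a r F m x := by
  rw [innerPoisson, indicator_of_mem hx]
  exact le_poissonLIntegral (fun i => (innerRadius_pos hr m i).le) hF.measurable
    (hF.le_integral _ (innerRadius_lt hr m)) hx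

lemma ae_boundary_mem_prodBall {l m : ℕ} (hlm : l < m) :
    ∀ᵐ ζ ∂boundaryMeasure a (innerRadius r l), ζ ∈ prodBall a (innerRadius r m) := by
  filter_upwards [ae_boundaryMeasure a fun i => (innerRadius_pos hr l i).le] with ζ hζ
  exact prodClosedBall_subset_prodBall a (fun i => innerRadius_strictMono hr i hlm)
    (mem_prodClosedBall_of_sphere hζ)

/-- The Poisson integrals increase, since each of them dominates `F` on the preceding distinguished
boundary and is the Poisson integral of its values there. -/
lemma innerPoisson_mono (x : ∀ i, E i) : Monotone fun m => innerPoisson a r F m x := by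
  refine monotone_nat_of_le_succ fun m => ?_
  by_cases hx : x ∈ prodBall a (innerRadius r m)
  · rw [innerPoisson_eq hr hF (Nat.lt_succ_self m) hx, innerPoisson, indicator_of_mem hx]
    refine poissonLIntegral_mono_ae ?_
    filter_upwards [ae_boundary_mem_prodBall hr hF (Nat.lt_succ_self m)] with ζ hζ
    exact le_innerPoisson hr hF hζ
  · rw [innerPoisson, indicator_of_notMem hx]
    exact zero_le

/-- By monotone convergence the limit is its own Poisson integral on the inner products of balls. -/
lemma leastMajorant_eq {l : ℕ} {x : ∀ i, E i} (hx : x ∈ prodBall a (innerRadius r l)) :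
    leastMajorant a r F x = poissonLIntegral a (innerRadius r l) (leastMajorant a r F) x := by
  have h1 (z) : leastMajorant a r F z = ⨆ m, innerPoisson a r F (m + (l + 1)) z :=
    ((innerPoisson_mono hr hF z).iSup_nat_add (l + 1)).symm
  have h2 : poissonLIntegral a (innerRadius r l) (leastMajorant a r F) x =
      ⨆ m, poissonLIntegral a (innerRadius r l) (innerPoisson a r F (m + (l + 1))) x := by
    unfold poissonLIntegral
    rw [← lintegral_iSup]
    · refine lintegral_congr fun ζ => ?_
      rw [h1, ENNReal.mul_iSup]
    · exact fun m => (measurable_prodKernel a _ x).ennreal_ofReal.mul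
        (measurable_innerPoisson hr hF _)
    · intro m m' hm ζ
      exact mul_le_mul_right (innerPoisson_mono hr hF ζ (by omega)) _
  rw [h1, h2]
  exact iSup_congr fun m => innerPoisson_eq hr hF (by omega) hx

lemma leastMajorant_center :
    leastMajorant a r F a = ⨆ m, ∫⁻ ζ, F ζ ∂boundaryMeasure a (innerRadius r m) := by
  refine iSup_congr fun m => ?_
  rw [innerPoisson, indicator_of_mem (center_mem_prodBall (innerRadius_pos hr m) a),
    poissonLIntegral_center a (innerRadius_pos hr m)]

/-- The means over the distinguished boundaries increase with the radii. -/
lemma monotone_lintegral_boundary :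
    Monotone fun m => ∫⁻ ζ, F ζ ∂boundaryMeasure a (innerRadius r m) := by
  have (m : ℕ) : ∫⁻ ζ, F ζ ∂boundaryMeasure a (innerRadius r m) = innerPoisson a r F m a := by
    rw [innerPoisson, indicator_of_mem (center_mem_prodBall (innerRadius_pos hr m) a),
      poissonLIntegral_center a (innerRadius_pos hr m)]
  simpa only [this] using innerPoisson_mono hr hF a

lemma le_leastMajorant {x : ∀ i, E i} (hx : x ∈ prodBall a r) : F x ≤ leastMajorant a r F x := by
  obtain ⟨m, hm⟩ := exists_mem_prodBall_innerRadius hr hx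
  exact (le_innerPoisson hr hF hm).trans (le_iSup (fun m => innerPoisson a r F m x) m)

omit hF in
/-- Harnack's inequality for the limits of Poisson integrals, with a constant that does not depend
on the function. -/
lemma exists_leastMajorant_le (a : ∀ i, E i) (l : ℕ) : ∃ C : ℝ, ∀ F : (∀ i, E i) → ℝ≥0∞,
    IsNSubharmonicOn a r F → ∀ x ∈ prodClosedBall a (innerRadius r l),
      leastMajorant a r F x ≤ ENNReal.ofReal C * leastMajorant a r F a := by
  obtain ⟨C, hC⟩ := exists_prodKernel_le a (s := innerRadius r l) (ρ := innerRadius r (l + 1))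
    (fun i => (innerRadius_pos hr l i).le)
    (fun i => innerRadius_strictMono hr i (Nat.lt_succ_self l))
  refine ⟨C, fun F hF x hx => ?_⟩
  rw [leastMajorant_eq hr hF (prodClosedBall_subset_prodBall a
      (fun i => innerRadius_strictMono hr i (Nat.lt_succ_self l)) hx),
    leastMajorant_eq hr hF (center_mem_prodBall (innerRadius_pos hr (l + 1)) a),
    poissonLIntegral_center a (innerRadius_pos hr (l + 1)), poissonLIntegral,
    ← lintegral_const_mul' _ _ ENNReal.ofReal_ne_top]
  refine lintegral_mono_ae ?_
  filter_upwards [ae_boundaryMeasure a fun i => (innerRadius_pos hr (l + 1) i).le] with ζ hζ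
  exact mul_le_mul_left (ENNReal.ofReal_le_ofReal (hC x hx ζ hζ)) _

lemma leastMajorant_lt_top (h : leastMajorant a r F a < ⊤) {x : ∀ i, E i}
    (hx : x ∈ prodBall a r) : leastMajorant a r F x < ⊤ := by
  obtain ⟨m, hm⟩ := exists_mem_prodBall_innerRadius hr hx
  obtain ⟨C, hC⟩ := exists_leastMajorant_le hr a m
  exact (hC F hF x (prodBall_subset_prodClosedBall _ _ hm)).trans_lt
    (ENNReal.mul_lt_top ENNReal.ofReal_lt_top h)

lemma nHarmonicOn_leastMajorant (h : leastMajorant a r F a < ⊤) :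
    NHarmonicOn (prodBall a r) fun x => (leastMajorant a r F x).toReal := by
  have key (m : ℕ) : NHarmonicOn (prodBall a (innerRadius r m))
      fun x => (poissonLIntegral a (innerRadius r m) (leastMajorant a r F) x).toReal := by
    obtain ⟨C, hC⟩ := exists_leastMajorant_le hr a m
    refine nHarmonicOn_poissonLIntegral (innerRadius_pos hr m) (measurable_leastMajorant hr hF)
      (B := max C 0 * (leastMajorant a r F a).toReal) ?_
    filter_upwards [ae_boundaryMeasure a fun i => (innerRadius_pos hr m i).le] with ζ hζ
    refine (hC F hF ζ (mem_prodClosedBall_of_sphere hζ)).trans ?_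
    rw [ENNReal.ofReal_mul (le_max_right _ _), ENNReal.ofReal_toReal h.ne]
    exact mul_le_mul_left (ENNReal.ofReal_le_ofReal (le_max_left _ _)) _
  refine ⟨fun x hx => ?_, fun z hz i => ?_⟩
  · obtain ⟨m, hm⟩ := exists_mem_prodBall_innerRadius hr hx
    have hn := (isOpen_prodBall a (innerRadius r m)).mem_nhds hm
    refine ContinuousAt.continuousWithinAt (((key m).1.continuousAt hn).congr ?_)
    filter_upwards [hn] with y hy
    rw [← leastMajorant_eq hr hF hy]
  · obtain ⟨m, hm⟩ := exists_mem_prodBall_innerRadius hr hz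
    refine (harmonicAt_congr_nhds ?_).2 ((key m).2 z hm i)
    filter_upwards [isOpen_ball.mem_nhds (hm i)] with w hw
    rw [← leastMajorant_eq hr hF (update_mem_prodBall hm hw)]

/-- Every `n`-harmonic majorant dominates the limit of the Poisson integrals. -/
lemma leastMajorant_le {w : (∀ i, E i) → ℝ} (hw : NHarmonicOn (prodBall a r) w)
    (hm : Measurable w) (h0 : ∀ z ∈ prodBall a r, 0 ≤ w z)
    (hFw : ∀ z ∈ prodBall a r, F z ≤ ENNReal.ofReal (w z)) (x : ∀ i, E i) :
    leastMajorant a r F x ≤ ENNReal.ofReal (w x) := by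
  refine iSup_le fun m => ?_
  by_cases hxm : x ∈ prodBall a (innerRadius r m)
  · rw [hw.eq_poissonLIntegral hm h0 (fun i => (innerRadius_pos hr m i).le)
      (innerRadius_lt hr m) hxm, innerPoisson, indicator_of_mem hxm]
    refine poissonLIntegral_mono_ae ?_
    filter_upwards [ae_boundary_mem_prodBall hr hF (Nat.lt_succ_self m)] with ζ hζ
    exact hFw ζ (prodBall_innerRadius_subset hr a _ hζ)
  · rw [innerPoisson, indicator_of_notMem hxm]
    exact zero_le

end LeastMajorant

/-! ### Analytic functions of several variables: slices, Cauchy estimates, limits -/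

section AnalyticSlices

open Metric Set Filter Topology Function

variable {E G : Type} [NormedAddCommGroup E] [NormedSpace ℂ E] [NormedAddCommGroup G]
  [NormedSpace ℂ G] {g : E → G} {a : E}

lemma analyticAt_line (a v : E) (t : ℂ) : AnalyticAt ℂ (fun t : ℂ => a + t • v) t := by
  fun_prop

lemma analyticAt_slice {v : E} {t : ℂ} (hg : AnalyticAt ℂ g (a + t • v)) :
    AnalyticAt ℂ (fun t : ℂ => g (a + t • v)) t :=
  AnalyticAt.fun_comp (g := g) (f := fun t : ℂ => a + t • v) hg (analyticAt_line a v t)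

lemma analyticAt_slice_zero (hg : AnalyticAt ℂ g a) (v : E) :
    AnalyticAt ℂ (fun t : ℂ => g (a + t • v)) 0 :=
  analyticAt_slice (by simpa using hg)

lemma hasDerivAt_line (a v : E) (t : ℂ) : HasDerivAt (fun t : ℂ => a + t • v) v t := by
  simpa using ((hasDerivAt_id t).smul_const v).const_add a

variable [CompleteSpace G]

/-- The Taylor coefficients of the restriction of an analytic function to a complex line. -/
lemma iteratedDeriv_slice (hg : AnalyticAt ℂ g a) (v : E) (k : ℕ) :
    iteratedDeriv k (fun t : ℂ => g (a + t • v)) 0 = iteratedFDeriv ℂ k g a fun _ => v := by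
  have hline : Tendsto (fun t : ℂ => a + t • v) (𝓝 0) (𝓝 a) := by
    simpa [ContinuousAt] using (hasDerivAt_line a v 0).continuousAt
  have hev : ∀ᶠ t : ℂ in 𝓝 0, AnalyticAt ℂ g (a + t • v) :=
    hline.eventually (isOpen_analyticAt ℂ g |>.mem_nhds hg)
  have key : ∀ᶠ t : ℂ in 𝓝 0, iteratedDeriv k (fun t : ℂ => g (a + t • v)) t =
      iteratedFDeriv ℂ k g (a + t • v) fun _ => v := by
    induction k with
    | zero => exact Eventually.of_forall fun t => by simp
    | succ k ih =>
      filter_upwards [ih.eventually_nhds, hev] with t ht hgt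
      rw [iteratedDeriv_succ, EventuallyEq.deriv_eq ht, iteratedFDeriv_succ_apply_left]
      have h1 : DifferentiableAt ℂ (iteratedFDeriv ℂ k g) (a + t • v) :=
        (hgt.contDiffAt (n := k + 1)).differentiableAt_iteratedFDeriv (by
          exact_mod_cast Nat.lt_succ_self k)
      have h2 := h1.hasFDerivAt.comp_hasDerivAt t (hasDerivAt_line a v t)
      have h3 := (ContinuousMultilinearMap.apply ℂ (fun _ : Fin k => E) G
        fun _ => v).hasFDerivAt.comp_hasDerivAt t h2
      exact h3.deriv
  simpa using key.self_of_nhds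

omit [CompleteSpace G] in
lemma line_mem_ball {v : E} {R ρ : ℝ} (h : ρ * ‖v‖ < R) {t : ℂ} (ht : ‖t‖ ≤ ρ) :
    a + t • v ∈ ball a R := by
  rw [mem_ball_iff_norm, add_sub_cancel_left, norm_smul]
  exact (mul_le_mul_of_nonneg_right ht (norm_nonneg v)).trans_lt h

omit [CompleteSpace G] in
lemma diffContOnCl_slice {v : E} {R ρ : ℝ} (hg : AnalyticOnNhd ℂ g (ball a R)) (h : ρ * ‖v‖ < R) :
    DiffContOnCl ℂ (fun t : ℂ => g (a + t • v)) (ball 0 ρ) := by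
  refine DifferentiableOn.diffContOnCl fun t ht => ?_
  have : t ∈ closedBall (0 : ℂ) ρ := closure_ball_subset_closedBall ht
  exact (analyticAt_slice (hg _ (line_mem_ball h
    (by simpa using this)))).differentiableAt.differentiableWithinAt

/-- Cauchy's estimate for the homogeneous terms. -/
lemma norm_iteratedFDeriv_diag_le {v : E} {R ρ M : ℝ} (hg : AnalyticOnNhd ℂ g (ball a R))
    (hρ : 0 < ρ) (h : ρ * ‖v‖ < R) (hM : ∀ t : ℂ, ‖t‖ = ρ → ‖g (a + t • v)‖ ≤ M) (k : ℕ) :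
    ‖iteratedFDeriv ℂ k g a fun _ => v‖ ≤ k.factorial * M / ρ ^ k := by
  have hR : 0 < R := (mul_nonneg hρ.le (norm_nonneg v)).trans_lt h
  rw [← iteratedDeriv_slice (hg a (mem_ball_self hR))]
  exact Complex.norm_iteratedDeriv_le_of_forall_mem_sphere_norm_le k hρ (diffContOnCl_slice hg h)
    fun t ht => hM t (by simpa using ht)

omit [CompleteSpace G] in
lemma norm_fderiv_le_of_bound {R δ M : ℝ} (hδ : 0 < δ) (hδR : δ < R)
    (hg : AnalyticOnNhd ℂ g (ball a R)) (hM : ∀ x ∈ ball a R, ‖g x‖ ≤ M) :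
    ‖fderiv ℂ g a‖ ≤ M / δ := by
  have ha : a ∈ ball a R := mem_ball_self (hδ.trans hδR)
  have hM0 : 0 ≤ M := (norm_nonneg _).trans (hM a ha)
  refine ContinuousLinearMap.opNorm_le_bound' _ (by positivity) fun v hv => ?_
  have hv' : 0 < ‖v‖ := lt_of_le_of_ne (norm_nonneg v) hv.symm
  have h : δ / ‖v‖ * ‖v‖ < R := by rwa [div_mul_cancel₀ _ hv]
  have h1 := Complex.norm_deriv_le_of_forall_mem_sphere_norm_le (div_pos hδ hv')
    (diffContOnCl_slice hg h) fun t ht =>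
      hM _ (line_mem_ball h (by simpa using (mem_sphere_iff_norm.1 ht).le))
  have h2 : HasFDerivAt g (fderiv ℂ g a) (a + (0 : ℂ) • v) := by
    simpa using (hg a ha).differentiableAt.hasFDerivAt
  have h3 : deriv (fun t : ℂ => g (a + t • v)) 0 = fderiv ℂ g a v :=
    (h2.comp_hasDerivAt (0 : ℂ) (hasDerivAt_line a v 0)).deriv
  rw [h3] at h1
  refine h1.trans_eq ?_
  field_simp

end AnalyticSlices

section AnalyticLimits

open Metric Set Filter Topology Function

variable {E : Type} [NormedAddCommGroup E] [NormedSpace ℂ E] {a : E}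

/-- Cauchy's estimate for the higher derivatives. -/
lemma norm_iteratedFDeriv_le_of_bound {δ : ℝ} (hδ : 0 < δ) (k : ℕ) :
    ∀ {G : Type} [NormedAddCommGroup G] [NormedSpace ℂ G] [CompleteSpace G] {g : E → G} {R M : ℝ},
      k * δ < R → AnalyticOnNhd ℂ g (ball a R) → (∀ x ∈ ball a R, ‖g x‖ ≤ M) →
      ‖iteratedFDeriv ℂ k g a‖ ≤ M / δ ^ k := by
  induction k with
  | zero =>
    intro G _ _ _ g R M hR hg hM
    simpa using hM a (mem_ball_self (by simpa using hR))
  | succ k ih =>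
    intro G _ _ _ g R M hR hg hM
    rw [← norm_iteratedFDeriv_fderiv]
    push_cast at hR
    -- choose a radius strictly between `k * δ` and `R - δ`
    obtain ⟨R', h1, h2⟩ := exists_between (show k * δ < R - δ by linarith)
    have hsub : ball a R' ⊆ ball a R := ball_subset_ball (by linarith)
    refine (ih (M := M / δ) h1 (fun x hx => (hg x (hsub hx)).fderiv) fun x hx => ?_).trans_eq ?_
    · have hsub' : ball x (R - R') ⊆ ball a R := by
        refine ball_subset_ball' ?_
        have := (mem_ball.1 hx).le
        linarith
      exact norm_fderiv_le_of_bound hδ (by linarith) (fun y hy => hg y (hsub' hy))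
        fun y hy => hM y (hsub' hy)
    · rw [div_div, pow_succ']

/-- A uniform limit of bounded analytic functions on a ball is analytic at the center.  The limits
of the derivatives define a power series, and its sum is identified on complex lines, where the
statement is the theorem of Weierstrass. -/
lemma analyticAt_of_tendstoUniformlyOn {f : ℕ → E → ℂ} {g : E → ℂ} {R M : ℝ} (hR : 0 < R)
    (hf : ∀ n, AnalyticOnNhd ℂ (f n) (ball a R)) (hM : ∀ n, ∀ x ∈ ball a R, ‖f n x‖ ≤ M)
    (hfg : TendstoUniformlyOn f g atTop (ball a R)) : AnalyticAt ℂ g a := by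
  have ha : a ∈ ball a R := mem_ball_self hR
  have hM0 : 0 ≤ M := (norm_nonneg _).trans (hM 0 a ha)
  have hδ (k : ℕ) : 0 < R / (k + 1) := by positivity
  have hkδ (k : ℕ) : (k : ℝ) * (R / (k + 1)) < R := by
    rw [mul_div_assoc', div_lt_iff₀ (by positivity)]
    nlinarith
  have hcauchy (k : ℕ) : CauchySeq fun n => iteratedFDeriv ℂ k (f n) a := by
    rw [Metric.cauchySeq_iff]
    intro ε hε
    obtain ⟨N, hN⟩ := Metric.uniformCauchySeqOn_iff.1 hfg.uniformCauchySeqOn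
      (ε / 2 * (R / (k + 1)) ^ k) (by positivity)
    refine ⟨N, fun m hm n hn => ?_⟩
    rw [dist_eq_norm, ← iteratedFDeriv_sub_apply (hf m a ha).contDiffAt (hf n a ha).contDiffAt]
    refine (norm_iteratedFDeriv_le_of_bound (M := ε / 2 * (R / (k + 1)) ^ k) (hδ k) k (hkδ k)
      ((hf m).sub (hf n)) fun x hx => ?_).trans_lt ?_
    · rw [Pi.sub_apply, ← dist_eq_norm]
      exact (hN m hm n hn x hx).le
    · rw [mul_div_assoc, div_self (by positivity), mul_one]
      linarith
  choose q hq using fun k => cauchySeq_tendsto_of_complete (hcauchy k)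
  set p : FormalMultilinearSeries ℂ E ℂ := fun k => ((k.factorial : ℂ))⁻¹ • q k with hp
  have hqn (k : ℕ) : ‖q k‖ ≤ M / (R / (k + 1)) ^ k :=
    le_of_tendsto (hq k).norm (Eventually.of_forall fun n =>
      norm_iteratedFDeriv_le_of_bound (hδ k) k (hkδ k) (hf n) (hM n))
  -- Cauchy's estimate with steps `R / (k + 1)` and `(k + 1) ^ k ≤ k! * e ^ (k + 1)` show that the
  -- radius of convergence is at least `R / e`
  have hpn (k : ℕ) : ‖p k‖ * (R / Real.exp 1) ^ k ≤ M * Real.exp 1 := by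
    have h1 : ‖p k‖ = ((k.factorial : ℝ))⁻¹ * ‖q k‖ := by
      rw [hp, norm_smul, norm_inv, Complex.norm_natCast]
    have h2 := Real.pow_div_factorial_le_exp (k + 1 : ℝ) (by positivity) k
    rw [h1]
    calc ((k.factorial : ℝ))⁻¹ * ‖q k‖ * (R / Real.exp 1) ^ k
        ≤ ((k.factorial : ℝ))⁻¹ * (M / (R / (k + 1)) ^ k) * (R / Real.exp 1) ^ k := by
          gcongr
          exact hqn k
      _ = M * ((k + 1 : ℝ) ^ k / k.factorial) / Real.exp 1 ^ k := by
          rw [div_pow, div_pow]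
          field_simp
      _ ≤ M * Real.exp (k + 1) / Real.exp 1 ^ k := by gcongr
      _ = M * Real.exp 1 := by
          rw [Real.exp_add, ← Real.exp_nat_mul, mul_one]
          field_simp
  have hRe : 0 < R / Real.exp 1 := by positivity
  have hradius : ENNReal.ofReal (R / Real.exp 1) ≤ p.radius :=
    p.le_radius_of_bound (M * Real.exp 1) (r := (R / Real.exp 1).toNNReal) fun k => by
      rw [Real.coe_toNNReal _ hRe.le]
      exact hpn k
  refine ⟨p, ENNReal.ofReal (R / Real.exp 1), hradius, by simpa using hRe, fun {y} hy => ?_⟩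
  have hy' : ‖y‖ < R / Real.exp 1 := by
    simpa [Metric.eball_ofReal] using hy
  have hyR : 2 * ‖y‖ < R := by
    have h1 : (2 : ℝ) ≤ Real.exp 1 := by linarith [Real.add_one_le_exp (1 : ℝ)]
    have h2 : ‖y‖ * Real.exp 1 < R := by rwa [lt_div_iff₀ (Real.exp_pos 1)] at hy'
    nlinarith [norm_nonneg y]
  have hslice : TendstoUniformlyOn (fun n (t : ℂ) => f n (a + t • y)) (fun t => g (a + t • y)) atTop
      (ball 0 2) := by
    have := hfg.comp fun t : ℂ => a + t • y
    refine this.mono fun t ht => line_mem_ball hyR (by simpa using (mem_ball.1 ht).le)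
  have hdiff (n : ℕ) : DifferentiableOn ℂ (fun t : ℂ => f n (a + t • y)) (ball 0 2) :=
    (diffContOnCl_slice (hf n) hyR).differentiableOn
  have hgdiff : DifferentiableOn ℂ (fun t : ℂ => g (a + t • y)) (ball 0 2) :=
    hslice.tendstoLocallyUniformlyOn.differentiableOn (Eventually.of_forall hdiff) isOpen_ball
  have hsum := Complex.hasSum_taylorSeries_on_ball hgdiff (z := 1) (by simp)
  have hcoef (k : ℕ) : iteratedDeriv k (fun t : ℂ => g (a + t • y)) 0 = q k fun _ => y := by
    have h1 : Tendsto (fun n => iteratedDeriv k (fun t : ℂ => f n (a + t • y)) 0) atTop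
        (𝓝 (q k fun _ => y)) := by
      simp only [iteratedDeriv_slice (hf _ a ha)]
      exact ((ContinuousMultilinearMap.apply ℂ (fun _ : Fin k => E) ℂ
        fun _ => y).continuous.tendsto _).comp (hq k)
    refine tendsto_nhds_unique ?_ h1
    rw [Metric.tendsto_atTop]
    intro ε hε
    obtain ⟨N, hN⟩ := eventually_atTop.1 (Metric.tendstoUniformlyOn_iff.1 hslice
      (ε / 2 / k.factorial) (by positivity))
    refine ⟨N, fun n hn => ?_⟩
    have h0 : (0 : ℂ) ∈ ball (0 : ℂ) 2 := by simp
    have hn1 := (hdiff n).contDiffOn (n := k) isOpen_ball |>.contDiffAt (isOpen_ball.mem_nhds h0)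
    have hn2 := hgdiff.contDiffOn (n := k) isOpen_ball |>.contDiffAt (isOpen_ball.mem_nhds h0)
    rw [dist_eq_norm, ← iteratedDeriv_sub hn1 hn2]
    refine (Complex.norm_iteratedDeriv_le_of_forall_mem_sphere_norm_le (R := 1)
      (C := ε / 2 / k.factorial) k one_pos ?_ fun t ht => ?_).trans_lt ?_
    · refine (((hdiff n).sub hgdiff).mono ?_).diffContOnCl
      exact closure_ball_subset_closedBall.trans (closedBall_subset_ball (by norm_num))
    · rw [Pi.sub_apply, ← dist_eq_norm, dist_comm]
      exact (hN n hn t (sphere_subset_closedBall.trans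
        (closedBall_subset_ball (by norm_num)) ht)).le
    · rw [one_pow, div_one, mul_div_cancel₀ _ (by positivity)]
      linarith
  simp only [hcoef, one_smul, sub_zero, one_pow] at hsum
  simpa [hp] using hsum

end AnalyticLimits

/-! ### Order of vanishing -/

section ZeroOrder

open Metric Set Filter Topology Function

variable {E : Type} [NormedAddCommGroup E] [NormedSpace ℂ E] {Ω : Set E} {a : E}

lemma natCast_le_zeroOrder_iff {f : Ω → ℂ} {m : ℕ} : (m : ℕ∞) ≤ zeroOrder a f ↔
    ∀ k < m, ∀ v, (iteratedFDeriv ℂ k (extendZero f) a fun _ => v) = 0 := by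
  simp only [zeroOrder, le_iInf_iff, homogeneousTerm]
  constructor
  · intro h k hk v
    by_contra hne
    have := h k ⟨v, mul_ne_zero (inv_ne_zero (by exact_mod_cast k.factorial_ne_zero)) hne⟩
    exact absurd (by exact_mod_cast this) (not_le.2 hk)
  · rintro h k ⟨v, hv⟩
    by_contra hlt
    exact hv (by rw [h k (by exact_mod_cast not_le.1 hlt) v, mul_zero])

/-- The order of a zero is the infimum of the orders along complex lines. -/
lemma zeroOrder_eq_iInf {f : Ω → ℂ} (hf : AnalyticAt ℂ (extendZero f) a) :
    zeroOrder a f = ⨅ v : E, analyticOrderAt (fun t : ℂ => extendZero f (a + t • v)) 0 := by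
  refine ENat.eq_of_forall_natCast_le_iff fun m => ?_
  rw [natCast_le_zeroOrder_iff, le_iInf_iff]
  simp only [natCast_le_analyticOrderAt_iff_iteratedDeriv_eq_zero (analyticAt_slice_zero hf _),
    iteratedDeriv_slice hf]
  exact ⟨fun h v k hk => h k hk v, fun h k hk v => h v k hk⟩

lemma extendZero_coe (f : Ω → ℂ) (z : Ω) : extendZero f (z : E) = f z :=
  Subtype.val_injective.extend_apply f 0 z

lemma extendZero_of_notMem {M : Type*} [Zero M] (f : Ω → M) {z : E} (hz : z ∉ Ω) :
    extendZero f z = 0 :=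
  extend_apply' _ _ _ fun ⟨w, hw⟩ => hz (hw ▸ w.2)

lemma extendZero_add (f g : Ω → ℂ) : extendZero (f + g) = extendZero f + extendZero g := by
  ext z
  by_cases hz : z ∈ Ω
  · lift z to Ω using hz
    simp [extendZero_coe]
  · simp [extendZero_of_notMem _ hz]

lemma extendZero_mul (f g : Ω → ℂ) : extendZero (f * g) = extendZero f * extendZero g := by
  ext z
  by_cases hz : z ∈ Ω
  · lift z to Ω using hz
    simp [extendZero_coe]
  · simp [extendZero_of_notMem _ hz]

lemma extendZero_smul (c : ℂ) (f : Ω → ℂ) : extendZero (c • f) = c • extendZero f := by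
  ext z
  by_cases hz : z ∈ Ω
  · lift z to Ω using hz
    simp [extendZero_coe]
  · simp [extendZero_of_notMem _ hz]

lemma extendZero_sub (f g : Ω → ℂ) : extendZero (f - g) = extendZero f - extendZero g := by
  ext z
  by_cases hz : z ∈ Ω
  · lift z to Ω using hz
    simp [extendZero_coe]
  · simp [extendZero_of_notMem _ hz]

lemma extendZero_zero : extendZero (0 : Ω → ℂ) = 0 := by
  ext z
  by_cases hz : z ∈ Ω
  · lift z to Ω using hz
    simp [extendZero_coe]
  · simp [extendZero_of_notMem _ hz]

variable {f g : Ω → ℂ} (ha : a ∈ Ω)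
include ha

lemma zeroOrder_mul_ge (hf : IsAnalytic f) (hg : IsAnalytic g) :
    zeroOrder a f + zeroOrder a g ≤ zeroOrder a (f * g) := by
  have hfg : AnalyticAt ℂ (extendZero (f * g)) a := by
    rw [extendZero_mul]; exact (hf a ha).mul (hg a ha)
  rw [zeroOrder_eq_iInf (hf a ha), zeroOrder_eq_iInf (hg a ha), zeroOrder_eq_iInf hfg,
    extendZero_mul]
  refine le_iInf fun v => ?_
  have := analyticOrderAt_mul (analyticAt_slice_zero (hf a ha) v)
    (analyticAt_slice_zero (hg a ha) v)
  exact (add_le_add (iInf_le _ v) (iInf_le _ v)).trans this.ge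

lemma zeroOrder_add_ge (hf : IsAnalytic f) (hg : IsAnalytic g) :
    min (zeroOrder a f) (zeroOrder a g) ≤ zeroOrder a (f + g) := by
  have hfg : AnalyticAt ℂ (extendZero (f + g)) a := by
    rw [extendZero_add]; exact (hf a ha).add (hg a ha)
  rw [zeroOrder_eq_iInf (hf a ha), zeroOrder_eq_iInf (hg a ha), zeroOrder_eq_iInf hfg,
    extendZero_add]
  refine le_iInf fun v => ?_
  exact (min_le_min (iInf_le _ v) (iInf_le _ v)).trans
    (le_analyticOrderAt_add (f := fun t : ℂ => extendZero f (a + t • v))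
      (g := fun t : ℂ => extendZero g (a + t • v)))

lemma le_zeroOrder_smul (hf : IsAnalytic f) (c : ℂ) :
    zeroOrder a f ≤ zeroOrder a (c • f) := by
  refine ENat.forall_natCast_le_iff_le.1 fun m hm => ?_
  rw [natCast_le_zeroOrder_iff] at hm ⊢
  intro k hk v
  rw [extendZero_smul, iteratedFDeriv_const_smul_apply (hf a ha).contDiffAt]
  simp [hm k hk v]

lemma zeroOrder_smul (hf : IsAnalytic f) {c : ℂ} (hc : c ≠ 0) :
    zeroOrder a (c • f) = zeroOrder a f := by
  refine le_antisymm ?_ (le_zeroOrder_smul ha hf c)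
  have hcf : IsAnalytic (c • f) := fun z hz => by
    rw [extendZero_smul]; exact (hf z hz).const_smul
  simpa [smul_smul, hc] using le_zeroOrder_smul ha hcf c⁻¹

lemma one_le_zeroOrder_iff : 1 ≤ zeroOrder a f ↔ f ⟨a, ha⟩ = 0 := by
  have := natCast_le_zeroOrder_iff (a := a) (f := f) (m := 1)
  rw [Nat.cast_one] at this
  rw [this]
  simp [extendZero_coe f ⟨a, ha⟩]

lemma zeroOrder_eq_top_iff (hΩ : IsPreconnected Ω) (hf : IsAnalytic f) :
    zeroOrder a f = ⊤ ↔ f = 0 := by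
  constructor
  · intro h
    have h0 (k : ℕ) (v : E) : (iteratedFDeriv ℂ k (extendZero f) a fun _ => v) = 0 :=
      natCast_le_zeroOrder_iff.1 (h ▸ le_top : ((k + 1 : ℕ) : ℕ∞) ≤ zeroOrder a f) k
        (Nat.lt_succ_self k) v
    obtain ⟨p, s, hp⟩ := hf a ha
    have hz : extendZero f =ᶠ[𝓝 a] 0 := by
      filter_upwards [Metric.eball_mem_nhds a hp.r_pos] with z hz
      have hsum := hp.hasSum_sub hz
      have hterm (k : ℕ) : (p k fun _ => z - a) = 0 := by
        have := hp.factorial_smul (z - a) k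
        rw [h0 k, nsmul_eq_mul] at this
        exact (mul_eq_zero.1 this).resolve_left (by exact_mod_cast k.factorial_ne_zero)
      simp only [hterm] at hsum
      exact hsum.unique hasSum_zero
    have := hf.eqOn_zero_of_preconnected_of_eventuallyEq_zero hΩ ha hz
    ext z
    rw [← extendZero_coe f z]
    exact this z.2
  · rintro rfl
    refine ENat.eq_top_iff_forall_ge.2 fun m => natCast_le_zeroOrder_iff.2 fun k _ v => ?_
    rw [extendZero_zero, show (0 : E → ℂ) = fun _ => 0 from rfl, iteratedFDeriv_fun_zero]
    rfl

end ZeroOrder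

/-! ### Plurisubharmonicity of the squared modulus of an analytic function -/

section Plurisubharmonic

open MeasureTheory Metric Set Filter Topology Function InnerProductSpace
open scoped ENNReal

lemma hasDerivAt_comp_real_line {E G : Type} [NormedAddCommGroup E] [NormedSpace ℂ E]
    [NormedSpace ℝ E] [IsScalarTower ℝ ℂ E] [NormedAddCommGroup G] [NormedSpace ℂ G]
    [NormedSpace ℝ G] [IsScalarTower ℝ ℂ G] {F : E → G} {F' : E →L[ℂ] G} {x e : E} {t : ℝ}
    (h : HasFDerivAt F F' (x + t • e)) : HasDerivAt (fun t : ℝ => F (x + t • e)) (F' e) t := by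
  have h2 : HasFDerivAt F (F'.restrictScalars ℝ) (x + t • e) := h.restrictScalars ℝ
  exact h2.comp_hasDerivAt t (hasDerivAt_add_smul x e t)

lemma deriv_deriv_normSq_line {E : Type} [NormedAddCommGroup E] [NormedSpace ℂ E]
    [NormedSpace ℝ E] [IsScalarTower ℝ ℂ E] {f : E → ℂ} {x : E} (hf : AnalyticAt ℂ f x) (e : E) :
    deriv (deriv fun t : ℝ => ‖f (x + t • e)‖ ^ 2) 0 =
      2 * (inner ℝ (f x) (fderiv ℂ (fderiv ℂ f) x e e) + ‖fderiv ℂ f x e‖ ^ 2) := by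
  have hl := hasDerivAt_add_smul x e
  have hline : Tendsto (fun t : ℝ => x + t • e) (𝓝 0) (𝓝 x) := by
    simpa [ContinuousAt] using (hl 0).continuousAt
  have hev : ∀ᶠ t : ℝ in 𝓝 0, AnalyticAt ℂ f (x + t • e) :=
    hline.eventually ((isOpen_analyticAt ℂ f).mem_nhds hf)
  have h1 (t : ℝ) (ht : AnalyticAt ℂ f (x + t • e)) :
      HasDerivAt (fun t : ℝ => f (x + t • e)) (fderiv ℂ f (x + t • e) e) t :=
    hasDerivAt_comp_real_line ht.differentiableAt.hasFDerivAt
  have h2 : deriv (fun t : ℝ => ‖f (x + t • e)‖ ^ 2) =ᶠ[𝓝 0]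
      fun t => 2 * inner ℝ (f (x + t • e)) (fderiv ℂ f (x + t • e) e) := by
    filter_upwards [hev] with t ht using (h1 t ht).norm_sq.deriv
  have h3 : HasFDerivAt (fderiv ℂ f) (fderiv ℂ (fderiv ℂ f) x) (x + (0 : ℝ) • e) := by
    simpa using hf.fderiv.differentiableAt.hasFDerivAt
  have h4 : HasFDerivAt (fun y => fderiv ℂ f y e)
      ((ContinuousLinearMap.apply ℂ ℂ e).comp (fderiv ℂ (fderiv ℂ f) x)) (x + (0 : ℝ) • e) :=
    (ContinuousLinearMap.apply ℂ ℂ e).hasFDerivAt.comp _ h3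
  have h5 : HasDerivAt (fun t : ℝ => fderiv ℂ f (x + t • e) e)
      (fderiv ℂ (fderiv ℂ f) x e e) 0 := hasDerivAt_comp_real_line h4
  have h6 := ((h1 0 (by simpa using hf)).inner ℝ h5).const_mul 2
  rw [h2.deriv_eq, h6.deriv]
  simp

lemma contDiffAt_normSq {E : Type} [NormedAddCommGroup E] [NormedSpace ℂ E] [NormedSpace ℝ E]
    [IsScalarTower ℝ ℂ E] {f : E → ℂ} {x : E} (hf : AnalyticAt ℂ f x) :
    ContDiffAt ℝ 2 (fun y => ‖f y‖ ^ 2) x :=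
  (hf.contDiffAt.restrict_scalars ℝ).norm_sq ℝ

/-- The squared modulus of an analytic function is subharmonic: along `e` and `I • e` the terms of
the second derivative that contain the second derivative of `f` cancel. -/
lemma laplacian_normSq_nonneg {n : ℕ} {f : EuclideanSpace ℂ (Fin n) → ℂ}
    {x : EuclideanSpace ℂ (Fin n)} (hf : AnalyticAt ℂ f x) :
    0 ≤ Laplacian.laplacian (fun y => ‖f y‖ ^ 2) x := by
  -- the real orthonormal basis that consists of the `e_i` and the `I • e_i`
  let b : OrthonormalBasis ((_ : Fin n) × Fin 2) ℝ (EuclideanSpace ℂ (Fin n)) :=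
    Pi.orthonormalBasis fun _ => Complex.orthonormalBasisOneI
  rw [laplacian_eq_sum_deriv_deriv (contDiffAt_normSq hf) b, Fintype.sum_sigma]
  refine Finset.sum_nonneg fun i _ => ?_
  have h0 : b ⟨i, 1⟩ = Complex.I • b ⟨i, 0⟩ := by
    simp only [b, Pi.orthonormalBasis_apply]
    ext j
    by_cases hj : j = i
    · subst hj; simp
    · simp [hj]
  rw [Fin.sum_univ_two, h0, deriv_deriv_normSq_line hf, deriv_deriv_normSq_line hf]
  simp only [map_smul, _root_.smul_apply, smul_smul, Complex.I_mul_I, neg_smul,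
    one_smul, inner_neg_right, norm_smul, Complex.norm_I, one_mul]
  nlinarith [sq_nonneg ‖fderiv ℂ f x (b ⟨i, 0⟩)‖]

variable {k : ℕ} {n : Fin k → ℕ} {a : PolySpace n} {r : Fin k → ℝ}

lemma analyticAt_update (z : PolySpace n) (i : Fin k) (w : EuclideanSpace ℂ (Fin (n i))) :
    AnalyticAt ℂ (fun w => update z i w) w := by
  refine AnalyticAt.pi (f := fun j w => update z i w j) fun j => ?_
  rcases eq_or_ne j i with rfl | hj
  · simpa using! analyticAt_id
  · simpa [update_of_ne hj] using analyticAt_const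

lemma measurable_extendZero {M : Type} [Zero M] [TopologicalSpace M] [MeasurableSpace M]
    [BorelSpace M] {f : polyball a r → M} (hf : Continuous f) : Measurable (extendZero f) := by
  classical
  have h : extendZero f = (polyball a r).piecewise (extendZero f) 0 := by
    ext z
    by_cases hz : z ∈ polyball a r
    · rw [piecewise_eq_of_mem _ _ _ hz]
    · rw [piecewise_eq_of_notMem _ _ _ hz, extendZero_of_notMem _ hz]; rfl
  rw [h]
  refine ContinuousOn.measurable_piecewise ?_ continuousOn_const
    (isOpen_polyball a r).measurableSet
  rw [continuousOn_iff_continuous_domRestrict]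
  convert hf
  ext z
  exact Subtype.val_injective.extend_apply f 0 z

lemma IsAnalytic.continuous {f : polyball a r → ℂ} (hf : IsAnalytic f) : Continuous f := by
  have h := continuousOn_iff_continuous_domRestrict.1 (AnalyticOnNhd.continuousOn hf)
  convert h
  ext z
  exact (extendZero_coe f z).symm

lemma isCompact_prodClosedBall (a : PolySpace n) (ρ : Fin k → ℝ) :
    IsCompact (prodClosedBall a ρ) := by
  have h : prodClosedBall a ρ = Set.pi univ fun i => closedBall (a i) (ρ i) := by
    ext z; simp [prodClosedBall]
  rw [h]
  exact isCompact_univ_pi fun i => isCompact_closedBall _ _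

lemma nontrivial_of_one_le (hn : ∀ j, 1 ≤ n j) (j : Fin k) :
    Nontrivial (EuclideanSpace ℂ (Fin (n j))) := by
  have : Nonempty (Fin (n j)) := ⟨⟨0, hn j⟩⟩
  infer_instance

/-- The squared modulus of an analytic function is `n`-subharmonic. -/
lemma isNSubharmonicOn_normSq [∀ j, Nontrivial (EuclideanSpace ℂ (Fin (n j)))]
    {f : polyball a r → ℂ} (hf : IsAnalytic f) :
    IsNSubharmonicOn a r fun z => ENNReal.ofReal (‖extendZero f z‖ ^ 2) := by
  have hc : ContinuousOn (fun z => ‖extendZero f z‖ ^ 2) (polyball a r) :=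
    (AnalyticOnNhd.continuousOn hf).norm.pow 2
  refine ⟨((measurable_extendZero hf.continuous).norm.pow_const 2).ennreal_ofReal,
    fun ρ hρ => ?_, fun ρ hρ z hz i hi => ?_⟩
  · obtain ⟨B, hB⟩ := (isCompact_prodClosedBall a ρ).exists_bound_of_continuousOn
      (hc.mono (prodClosedBall_subset_prodBall a hρ))
    exact ⟨B, fun z hz => ENNReal.ofReal_le_ofReal ((Real.le_norm_self _).trans (hB z hz))⟩
  · have hmem (y) (hy : y ∈ closedBall (a i) (ρ i)) : update z i y ∈ polyball a r :=
      prodClosedBall_subset_prodBall a hρ (update_mem_prodClosedBall hz hy)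
    have han (y) (hy : y ∈ closedBall (a i) (ρ i)) :
        AnalyticAt ℂ (fun w => extendZero f (update z i w)) y :=
      AnalyticAt.fun_comp (hf _ (hmem y hy)) (analyticAt_update z i y)
    have hcv : ContinuousOn (fun w => ‖extendZero f (update z i w)‖ ^ 2)
        (closedBall (a i) (ρ i)) := fun y hy =>
      ((han y hy).continuousAt.norm.pow 2).continuousWithinAt
    have h := le_poissonIntegral hcv
      (fun y hy => contDiffAt_normSq (han y (ball_subset_closedBall hy)))
      (fun y hy => laplacian_normSq_nonneg (han y (ball_subset_closedBall hy))) hi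
    have h2 := ENNReal.ofReal_le_ofReal h
    rw [ofReal_poissonIntegral hcv hi fun _ _ => sq_nonneg _] at h2
    simpa only [update_eq_self] using h2

lemma isNHarmonic_iff {u : polyball a r → ℝ} :
    IsNHarmonic u ↔ NHarmonicOn (prodBall a r) (extendZero u) := by
  unfold IsNHarmonic NHarmonicOn
  refine and_congr ?_ ⟨fun h z hz i => h ⟨z, hz⟩ i (z i) (hz i), fun h z j w hw => ?_⟩
  · change _ ↔ ContinuousOn _ (polyball a r)
    rw [continuousOn_iff_continuous_domRestrict]
    have : (polyball a r).domRestrict (extendZero u) = u := by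
      ext z
      exact Subtype.val_injective.extend_apply u 0 z
    rw [this]
  · have := h (update z j w) (update_mem_prodBall z.2 hw) j
    simpa using this

lemma NHarmonicOn.congr {s : Set (PolySpace n)} (hs : IsOpen s) {u v : PolySpace n → ℝ}
    (hu : NHarmonicOn s u) (h : EqOn v u s) : NHarmonicOn s v := by
  refine ⟨hu.1.congr h, fun z hz i => (harmonicAt_congr_nhds ?_).2 (hu.2 z hz i)⟩
  have hc : Tendsto (fun w => update z i w) (𝓝 (z i)) (𝓝 z) := by
    have := (continuous_const (y := z)).update i continuous_id |>.tendsto (z i)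
    simpa using this
  filter_upwards [hc.eventually (hs.mem_nhds hz)] with w hw using h hw

/-! ### The square norm of a function in the Hardy space -/

/-- The supremum of the means of `|f|²` over the distinguished boundaries of the inner polyballs.
For an analytic function with an `n`-harmonic majorant of `|f|²` it is the value at the center of
the least one. -/
noncomputable def hardySq (a : PolySpace n) (r : Fin k → ℝ) (f : polyball a r → ℂ) : ℝ≥0∞ :=
  ⨆ m, ∫⁻ ζ, ENNReal.ofReal (‖extendZero f ζ‖ ^ 2) ∂boundaryMeasure a (innerRadius r m)

variable [∀ j, Nontrivial (EuclideanSpace ℂ (Fin (n j)))] (hr : ∀ j, 0 < r j)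
include hr

lemma hardySq_eq_leastMajorant {f : polyball a r → ℂ} (hf : IsAnalytic f) :
    hardySq a r f = leastMajorant a r (fun z => ENNReal.ofReal (‖extendZero f z‖ ^ 2)) a :=
  (leastMajorant_center hr (isNSubharmonicOn_normSq hf)).symm

lemma leastMajorant_le_of_mem_nHarmonicMajorants {f : polyball a r → ℂ} (hf : IsAnalytic f)
    {w : polyball a r → ℝ} (hw : w ∈ nHarmonicMajorants f) (x : polyball a r) :
    leastMajorant a r (fun z => ENNReal.ofReal (‖extendZero f z‖ ^ 2)) x ≤
      ENNReal.ofReal (w x) := by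
  have h (z : polyball a r) : extendZero w (z : PolySpace n) = w z :=
    Subtype.val_injective.extend_apply w 0 z
  rw [← h]
  refine leastMajorant_le hr (isNSubharmonicOn_normSq hf) (isNHarmonic_iff.1 hw.1)
    (measurable_extendZero hw.1.1) (fun z hz => ?_) (fun z hz => ?_) x
  · rw [h ⟨z, hz⟩]
    exact (sq_nonneg _).trans (hw.2 ⟨z, hz⟩)
  · rw [h ⟨z, hz⟩, extendZero_coe f ⟨z, hz⟩]
    exact ENNReal.ofReal_le_ofReal (hw.2 ⟨z, hz⟩)

/-- If the square norm is finite, the least `n`-harmonic majorant exists, and the square norm is its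
value at the center. -/
lemma exists_isLeast_nHarmonicMajorants {f : polyball a r → ℂ} (hf : IsAnalytic f)
    (h : hardySq a r f < ⊤) : ∃ u : polyball a r → ℝ, IsLeast (nHarmonicMajorants f) u ∧
      ∃ ha : a ∈ polyball a r, (hardySq a r f).toReal = u ⟨a, ha⟩ := by
  have hF := isNSubharmonicOn_normSq hf
  rw [hardySq_eq_leastMajorant hr hf] at h ⊢
  set U := leastMajorant a r fun z => ENNReal.ofReal (‖extendZero f z‖ ^ 2) with hU
  have hlt (x : polyball a r) : U x < ⊤ := leastMajorant_lt_top hr hF h x.2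
  refine ⟨fun x => (U x).toReal, ⟨⟨?_, fun z => ?_⟩, fun w hw x => ?_⟩,
    center_mem_prodBall hr a, rfl⟩
  · refine isNHarmonic_iff.2 (NHarmonicOn.congr (isOpen_prodBall a r)
      (nHarmonicOn_leastMajorant hr hF h) fun z hz => ?_)
    exact Subtype.val_injective.extend_apply (fun x : polyball a r => (U x).toReal) 0 ⟨z, hz⟩
  · have := le_leastMajorant hr hF z.2
    rw [← hU] at this
    simp only [extendZero_coe] at this
    exact (ENNReal.ofReal_le_iff_le_toReal (hlt z).ne).1 this
  · refine ENNReal.toReal_le_of_le_ofReal ((sq_nonneg _).trans (hw.2 x)) ?_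
    exact leastMajorant_le_of_mem_nHarmonicMajorants hr hf hw x

lemma hardySq_lt_top_iff {f : polyball a r → ℂ} (hf : IsAnalytic f) :
    hardySq a r f < ⊤ ↔ (nHarmonicMajorants f).Nonempty := by
  constructor
  · intro h
    obtain ⟨u, hu, -⟩ := exists_isLeast_nHarmonicMajorants hr hf h
    exact ⟨u, hu.1⟩
  · rintro ⟨w, hw⟩
    rw [hardySq_eq_leastMajorant hr hf]
    exact (leastMajorant_le_of_mem_nHarmonicMajorants hr hf hw ⟨a, center_mem_prodBall hr a⟩).trans_lt
      ENNReal.ofReal_lt_top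

/-- Point evaluations are bounded, uniformly on smaller polyballs. -/
lemma exists_normSq_le_hardySq (a : PolySpace n) (l : ℕ) : ∃ C : ℝ, ∀ f : polyball a r → ℂ,
    IsAnalytic f → ∀ x ∈ prodClosedBall a (innerRadius r l),
      ENNReal.ofReal (‖extendZero f x‖ ^ 2) ≤ ENNReal.ofReal C * hardySq a r f := by
  obtain ⟨C, hC⟩ := exists_leastMajorant_le hr a l
  refine ⟨C, fun f hf x hx => ?_⟩
  rw [hardySq_eq_leastMajorant hr hf]
  exact (le_leastMajorant hr (isNSubharmonicOn_normSq hf)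
    (prodClosedBall_subset_prodBall a (innerRadius_lt hr l) hx)).trans
    (hC _ (isNSubharmonicOn_normSq hf) x hx)

end Plurisubharmonic

/-! ### The Hardy space as a Hilbert space of functions -/

section HardySpace

open MeasureTheory Metric Set Filter Topology Function
open scoped ENNReal

section IsAnalytic

variable {E : Type} [NormedAddCommGroup E] [NormedSpace ℂ E] {Ω : Set E} {f g : Ω → ℂ}

lemma IsAnalytic.add (hf : IsAnalytic f) (hg : IsAnalytic g) : IsAnalytic (f + g) := by
  unfold IsAnalytic
  rw [extendZero_add]
  exact AnalyticOnNhd.add hf hg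

lemma IsAnalytic.mul (hf : IsAnalytic f) (hg : IsAnalytic g) : IsAnalytic (f * g) := by
  unfold IsAnalytic
  rw [extendZero_mul]
  exact AnalyticOnNhd.mul hf hg

lemma IsAnalytic.smul (c : ℂ) (hf : IsAnalytic f) : IsAnalytic (c • f) := by
  unfold IsAnalytic
  rw [extendZero_smul]
  exact fun z hz => (hf z hz).const_smul

lemma IsAnalytic.sub (hf : IsAnalytic f) (hg : IsAnalytic g) : IsAnalytic (f - g) := by
  unfold IsAnalytic
  rw [extendZero_sub]
  exact AnalyticOnNhd.sub hf hg

lemma isAnalytic_zero : IsAnalytic (0 : Ω → ℂ) := by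
  unfold IsAnalytic
  rw [extendZero_zero]
  exact analyticOnNhd_const

end IsAnalytic

variable {k : ℕ} {n : Fin k → ℕ} {a : PolySpace n} {r : Fin k → ℝ}

/-- The supremum of the `L²` norms over the distinguished boundaries of the inner polyballs. -/
noncomputable def hardyNorm (a : PolySpace n) (r : Fin k → ℝ) (f : polyball a r → ℂ) : ℝ≥0∞ :=
  ⨆ m, eLpNorm (extendZero f) 2 (boundaryMeasure a (innerRadius r m))

lemma ofReal_norm_sq (z : ℂ) : ENNReal.ofReal (‖z‖ ^ 2) = ‖z‖ₑ ^ 2 := by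
  rw [ENNReal.ofReal_pow (norm_nonneg z), ofReal_norm]

lemma hardyNorm_sq (f : polyball a r → ℂ) : hardyNorm a r f ^ 2 = hardySq a r f := by
  unfold hardyNorm hardySq
  rw [ENNReal.iSup_pow]
  refine iSup_congr fun m => ?_
  have := eLpNorm_nnreal_pow_eq_lintegral (f := extendZero f) (p := 2)
    (μ := boundaryMeasure a (innerRadius r m)) two_ne_zero
  simp only [ofReal_norm_sq]
  simpa using this

lemma IsAnalytic.measurable_extendZero {f : polyball a r → ℂ} (hf : IsAnalytic f) :
    Measurable (extendZero f) := BeurlingModule.measurable_extendZero hf.continuous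

lemma hardyNorm_add_le {f g : polyball a r → ℂ} (hf : IsAnalytic f) (hg : IsAnalytic g) :
    hardyNorm a r (f + g) ≤ hardyNorm a r f + hardyNorm a r g := by
  refine iSup_le fun m => ?_
  rw [extendZero_add]
  exact (eLpNorm_add_le hf.measurable_extendZero.aestronglyMeasurable
    hg.measurable_extendZero.aestronglyMeasurable one_le_two).trans
    (add_le_add (le_iSup (fun m => eLpNorm (extendZero f) 2 (boundaryMeasure a (innerRadius r m))) m)
      (le_iSup (fun m => eLpNorm (extendZero g) 2 (boundaryMeasure a (innerRadius r m))) m))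

lemma hardyNorm_smul (c : ℂ) (f : polyball a r → ℂ) :
    hardyNorm a r (c • f) = ‖c‖ₑ * hardyNorm a r f := by
  unfold hardyNorm
  rw [ENNReal.mul_iSup]
  exact iSup_congr fun m => by rw [extendZero_smul, eLpNorm_const_smul]

lemma hardyNorm_zero : hardyNorm a r 0 = 0 := by
  simp [hardyNorm, extendZero_zero]

/-- Multiplication by a function bounded by `C` is bounded by `C` on the Hardy space. -/
lemma hardyNorm_mul_le {f g : polyball a r → ℂ} {C : ℝ} (hC : ∀ z, ‖f z‖ ≤ C) (h0 : 0 ≤ C) :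
    hardyNorm a r (f * g) ≤ ENNReal.ofReal C * hardyNorm a r g := by
  unfold hardyNorm
  rw [ENNReal.mul_iSup]
  refine iSup_mono fun m => ?_
  refine (eLpNorm_le_mul_eLpNorm_of_ae_le_mul (Eventually.of_forall fun z => ?_) 2)
  rw [extendZero_mul, Pi.mul_apply, norm_mul]
  refine mul_le_mul_of_nonneg_right ?_ (norm_nonneg _)
  by_cases hz : z ∈ polyball a r
  · rw [extendZero_coe f ⟨z, hz⟩]; exact hC _
  · rw [extendZero_of_notMem _ hz]; simpa using h0

/-- The analytic functions of finite Hardy norm. -/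
def hardySubmodule (a : PolySpace n) (r : Fin k → ℝ) : Submodule ℂ (polyball a r → ℂ) where
  carrier := {f | IsAnalytic f ∧ hardyNorm a r f < ⊤}
  zero_mem' := ⟨isAnalytic_zero, by simp [hardyNorm_zero]⟩
  add_mem' := fun hf hg => ⟨hf.1.add hg.1,
    (hardyNorm_add_le hf.1 hg.1).trans_lt (ENNReal.add_lt_top.2 ⟨hf.2, hg.2⟩)⟩
  smul_mem' := fun c f hf => ⟨hf.1.smul c, by
    rw [hardyNorm_smul]; exact ENNReal.mul_lt_top enorm_lt_top hf.2⟩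

/-- The Hardy space `H²` of the polyball, as a type that does not carry the topology of pointwise
convergence. -/
def HardyElem (a : PolySpace n) (r : Fin k → ℝ) : Type := hardySubmodule a r

noncomputable instance : AddCommGroup (HardyElem a r) :=
  inferInstanceAs (AddCommGroup (hardySubmodule a r))

noncomputable instance : Module ℂ (HardyElem a r) :=
  inferInstanceAs (Module ℂ (hardySubmodule a r))

/-- The function on the polyball given by an element of the Hardy space. -/
noncomputable def hardyEval : HardyElem a r →ₗ[ℂ] (polyball a r → ℂ) := (hardySubmodule a r).subtype

lemma hardyEval_injective : Injective (hardyEval (a := a) (r := r)) :=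
  (hardySubmodule a r).injective_subtype

lemma isAnalytic_hardyEval (h : HardyElem a r) : IsAnalytic (hardyEval h) := h.2.1

lemma hardyNorm_hardyEval_lt_top (h : HardyElem a r) : hardyNorm a r (hardyEval h) < ⊤ := h.2.2

lemma exists_hardyEval_eq {f : polyball a r → ℂ} (hf : IsAnalytic f) (hfin : hardyNorm a r f < ⊤) :
    ∃ h : HardyElem a r, hardyEval h = f := ⟨⟨f, hf, hfin⟩, rfl⟩

variable [∀ j, Nontrivial (EuclideanSpace ℂ (Fin (n j)))]

/-- Each mean satisfies the parallelogram law, and by monotonicity so do the suprema. -/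
lemma hardySq_parallelogram (hr : ∀ j, 0 < r j) {f g : polyball a r → ℂ} (hf : IsAnalytic f)
    (hg : IsAnalytic g) :
    hardySq a r (f + g) + hardySq a r (f - g) = 2 * (hardySq a r f + hardySq a r g) := by
  have hmono {h : polyball a r → ℂ} (hh : IsAnalytic h) :=
    monotone_lintegral_boundary hr (isNSubharmonicOn_normSq hh)
  unfold hardySq
  rw [ENNReal.iSup_add_iSup_of_monotone (hmono (hf.add hg)) (hmono (hf.sub hg)),
    ENNReal.iSup_add_iSup_of_monotone (hmono hf) (hmono hg), ENNReal.mul_iSup]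
  refine iSup_congr fun m => ?_
  have hm {h : polyball a r → ℂ} (hh : IsAnalytic h) :
      Measurable fun ζ => ENNReal.ofReal (‖extendZero h ζ‖ ^ 2) :=
    (hh.measurable_extendZero.norm.pow_const 2).ennreal_ofReal
  have hadd : Measurable fun ζ =>
      ENNReal.ofReal (‖extendZero f ζ‖ ^ 2) + ENNReal.ofReal (‖extendZero g ζ‖ ^ 2) :=
    (hm hf).add (hm hg)
  rw [← lintegral_add_left (hm (hf.add hg)), ← lintegral_add_left (hm hf),
    ← lintegral_const_mul 2 hadd]
  refine lintegral_congr fun ζ => ?_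
  have h2 : (2 : ℝ≥0∞) = ENNReal.ofReal 2 := by simp
  rw [← ENNReal.ofReal_add (by positivity) (by positivity),
    ← ENNReal.ofReal_add (by positivity) (by positivity), h2, ← ENNReal.ofReal_mul zero_le_two,
    extendZero_add, extendZero_sub, Pi.add_apply, Pi.sub_apply]
  congr 1
  have := parallelogram_law_with_norm ℝ (extendZero f ζ) (extendZero g ζ)
  nlinarith

lemma exists_norm_extendZero_le (hr : ∀ j, 0 < r j) (a : PolySpace n) (l : ℕ) :
    ∃ C : ℝ, 0 ≤ C ∧ ∀ f : polyball a r → ℂ, IsAnalytic f → hardyNorm a r f < ⊤ →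
      ∀ x ∈ prodClosedBall a (innerRadius r l),
        ‖extendZero f x‖ ≤ C * (hardyNorm a r f).toReal := by
  obtain ⟨C, hC⟩ := exists_normSq_le_hardySq hr a l
  refine ⟨√(max C 0), Real.sqrt_nonneg _, fun f hf hfin x hx => ?_⟩
  have h := hC f hf x hx
  rw [← hardyNorm_sq] at h
  have h2 : ‖extendZero f x‖ ^ 2 ≤ max C 0 * (hardyNorm a r f).toReal ^ 2 := by
    rw [← ENNReal.ofReal_toReal hfin.ne, ← ENNReal.ofReal_pow ENNReal.toReal_nonneg,
      ← ENNReal.ofReal_mul' (by positivity)] at h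
    refine ((ENNReal.ofReal_le_ofReal_iff' ).1 h).elim (fun h => h.trans ?_) (fun h => h.trans ?_)
    · gcongr
      exact le_max_left _ _
    · positivity
  refine abs_le_of_sq_le_sq' ?_ (by positivity) |>.2
  rwa [mul_pow, Real.sq_sqrt (le_max_right _ _)]

variable [hr : Fact (∀ j, 0 < r j)]

noncomputable instance : NormedAddCommGroup (HardyElem a r) :=
  AddGroupNorm.toNormedAddCommGroup
    { toFun := fun h => (hardyNorm a r (hardyEval h)).toReal
      map_zero' := by simp [hardyNorm_zero]
      add_le' := fun f g => by
        rw [map_add, ← ENNReal.toReal_add (hardyNorm_hardyEval_lt_top f).ne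
          (hardyNorm_hardyEval_lt_top g).ne]
        exact ENNReal.toReal_mono (ENNReal.add_ne_top.2 ⟨(hardyNorm_hardyEval_lt_top f).ne,
          (hardyNorm_hardyEval_lt_top g).ne⟩)
          (hardyNorm_add_le (isAnalytic_hardyEval f) (isAnalytic_hardyEval g))
      neg' := fun f => by
        rw [← neg_one_smul ℂ f, map_smul, hardyNorm_smul]
        simp
      eq_zero_of_map_eq_zero' := fun f hf => by
        refine hardyEval_injective ?_
        ext x
        obtain ⟨m, hm⟩ := exists_mem_prodBall_innerRadius hr.out x.2
        obtain ⟨C, -, hC⟩ := exists_norm_extendZero_le hr.out a m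
        have h := hC _ (isAnalytic_hardyEval f) (hardyNorm_hardyEval_lt_top f) x
          (prodBall_subset_prodClosedBall _ _ hm)
        rw [show (hardyNorm a r (hardyEval f)).toReal = 0 from hf, mul_zero, extendZero_coe] at h
        simpa using h }

lemma hardyElem_norm_def (h : HardyElem a r) : ‖h‖ = (hardyNorm a r (hardyEval h)).toReal := rfl

lemma hardyElem_norm_sq (h : HardyElem a r) : ‖h‖ ^ 2 = (hardySq a r (hardyEval h)).toReal := by
  rw [hardyElem_norm_def, ← ENNReal.toReal_pow, hardyNorm_sq]

noncomputable instance : NormedSpace ℂ (HardyElem a r) where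
  norm_smul_le c h := by
    rw [hardyElem_norm_def, hardyElem_norm_def, map_smul, hardyNorm_smul, ENNReal.toReal_mul]
    simp

noncomputable instance : InnerProductSpace ℂ (HardyElem a r) :=
  InnerProductSpace.ofNorm ℂ fun f g => by
    have hlt (h : HardyElem a r) : hardySq a r (hardyEval h) ≠ ⊤ := by
      rw [← hardyNorm_sq]
      exact ENNReal.pow_ne_top (hardyNorm_hardyEval_lt_top h).ne
    have h := congrArg ENNReal.toReal (hardySq_parallelogram hr.out (isAnalytic_hardyEval f)
      (isAnalytic_hardyEval g))
    rw [← map_add, ← map_sub, ENNReal.toReal_add (hlt _) (hlt _), ENNReal.toReal_mul,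
      ENNReal.toReal_add (hlt _) (hlt _)] at h
    simp only [← sq, hardyElem_norm_sq]
    simpa using h

/-- Point evaluations on the Hardy space are uniformly bounded on smaller polyballs. -/
lemma exists_norm_hardyEval_le (a : PolySpace n) (l : ℕ) :
    ∃ C : ℝ, 0 ≤ C ∧ ∀ h : HardyElem a r, ∀ x ∈ prodClosedBall a (innerRadius r l),
      ‖extendZero (hardyEval h) x‖ ≤ C * ‖h‖ := by
  obtain ⟨C, hC0, hC⟩ := exists_norm_extendZero_le hr.out a l
  exact ⟨C, hC0, fun h => hC _ (isAnalytic_hardyEval h) (hardyNorm_hardyEval_lt_top h)⟩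

/-- The Hardy norm is lower semicontinuous with respect to pointwise convergence. -/
lemma hardySq_le_of_tendsto {f : ℕ → polyball a r → ℂ} {g : polyball a r → ℂ} {ε : ℝ≥0∞}
    (hf : ∀ p, IsAnalytic (f p)) (hlim : ∀ z, Tendsto (fun p => f p z) atTop (𝓝 (g z)))
    (hε : ∀ᶠ p in atTop, hardySq a r (f p) ≤ ε) : hardySq a r g ≤ ε := by
  refine iSup_le fun m => ?_
  have hae : ∀ᵐ ζ ∂boundaryMeasure a (innerRadius r m),
      ENNReal.ofReal (‖extendZero g ζ‖ ^ 2) =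
        liminf (fun p => ENNReal.ofReal (‖extendZero (f p) ζ‖ ^ 2)) atTop := by
    filter_upwards [ae_boundaryMeasure a fun i => (innerRadius_pos hr.out m i).le] with ζ hζ
    have hmem : ζ ∈ polyball a r := prodClosedBall_subset_prodBall a (innerRadius_lt hr.out m)
      (mem_prodClosedBall_of_sphere hζ)
    lift ζ to polyball a r using hmem
    simp only [extendZero_coe]
    exact (((ENNReal.continuous_ofReal.tendsto _).comp
      ((hlim ζ).norm.pow 2)).liminf_eq).symm
  rw [lintegral_congr_ae hae]
  refine (lintegral_liminf_le fun p =>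
    ((hf p).measurable_extendZero.norm.pow_const 2).ennreal_ofReal).trans ?_
  refine (liminf_le_of_frequently_le' (Eventually.frequently ?_))
  filter_upwards [hε] with p hp
  exact (le_iSup (fun m => ∫⁻ ζ, ENNReal.ofReal (‖extendZero (f p) ζ‖ ^ 2)
    ∂boundaryMeasure a (innerRadius r m)) m).trans hp

/-- A Cauchy sequence converges locally uniformly by the bounds on point evaluations.  The limit is
analytic, and by the lower semicontinuity of the norm it is the limit in norm. -/
instance : CompleteSpace (HardyElem a r) := by
  refine Metric.complete_of_cauchySeq_tendsto fun u hu => ?_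
  have hunif (l : ℕ) : UniformCauchySeqOn (fun p => extendZero (hardyEval (u p))) atTop
      (prodClosedBall a (innerRadius r l)) := by
    obtain ⟨C, hC0, hC⟩ := exists_norm_hardyEval_le (r := r) a l
    refine Metric.uniformCauchySeqOn_iff.2 fun ε hε => ?_
    obtain ⟨N, hN⟩ := Metric.cauchySeq_iff.1 hu (ε / (C + 1)) (by positivity)
    refine ⟨N, fun p hp q hq x hx => ?_⟩
    have h1 := hC (u p - u q) x hx
    rw [map_sub, extendZero_sub, Pi.sub_apply, ← dist_eq_norm, ← dist_eq_norm] at h1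
    refine h1.trans_lt ?_
    have h2 := hN p hp q hq
    rw [lt_div_iff₀ (by positivity)] at h2
    nlinarith [dist_nonneg (x := u p) (y := u q)]
  have hpt (x : polyball a r) : ∃ y, Tendsto (fun p => hardyEval (u p) x) atTop (𝓝 y) := by
    obtain ⟨l, hl⟩ := exists_mem_prodBall_innerRadius hr.out x.2
    have := (hunif l).cauchy_map (prodBall_subset_prodClosedBall _ _ hl)
    simp only [extendZero_coe] at this
    exact CompleteSpace.complete this
  choose f hf using hpt
  have hf' (l : ℕ) : ∀ x ∈ prodClosedBall a (innerRadius r l),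
      Tendsto (fun p => extendZero (hardyEval (u p)) x) atTop (𝓝 (extendZero f x)) := by
    intro x hx
    lift x to polyball a r using prodClosedBall_subset_prodBall a (innerRadius_lt hr.out l) hx
    simpa only [extendZero_coe] using hf x
  have hfan : IsAnalytic f := by
    intro x hx
    obtain ⟨l, hl⟩ := exists_mem_prodBall_innerRadius hr.out hx
    obtain ⟨R, hR, hRl⟩ := Metric.isOpen_iff.1 (isOpen_prodBall a (innerRadius r l)) x hl
    have hsub := hRl.trans (prodBall_subset_prodClosedBall a (innerRadius r l))
    obtain ⟨C, hC0, hC⟩ := exists_norm_hardyEval_le (r := r) a l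
    obtain ⟨D, hD⟩ := hu.norm_bddAbove
    refine analyticAt_of_tendstoUniformlyOn (M := C * D) hR
      (fun p y hy => isAnalytic_hardyEval (u p) y (prodBall_innerRadius_subset hr.out a l (hRl hy)))
      (fun p y hy => (hC (u p) y (hsub hy)).trans ?_)
      (((hunif l).tendstoUniformlyOn_of_tendsto (hf' l)).mono hsub)
    exact mul_le_mul_of_nonneg_left (hD ⟨p, rfl⟩) hC0
  have hdist (ε : ℝ) (hε : 0 < ε) : ∃ N, ∀ p ≥ N,
      hardyNorm a r (hardyEval (u p) - f) ≤ ENNReal.ofReal ε := by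
    obtain ⟨N, hN⟩ := Metric.cauchySeq_iff.1 hu ε hε
    refine ⟨N, fun p hp => ?_⟩
    have h1 : hardySq a r (hardyEval (u p) - f) ≤ ENNReal.ofReal ε ^ 2 := by
      refine hardySq_le_of_tendsto (f := fun q => hardyEval (u p) - hardyEval (u q))
        (fun q => (isAnalytic_hardyEval _).sub (isAnalytic_hardyEval _))
        (fun z => (tendsto_const_nhds (x := hardyEval (u p) z)).sub (hf z)) ?_
      filter_upwards [eventually_ge_atTop N] with q hq
      rw [← map_sub, ← hardyNorm_sq]
      refine pow_le_pow_left₀ zero_le ?_ 2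
      rw [← ENNReal.ofReal_toReal (hardyNorm_hardyEval_lt_top _).ne, ← hardyElem_norm_def,
        ← dist_eq_norm]
      exact ENNReal.ofReal_le_ofReal (hN p hp q hq).le
    rw [← hardyNorm_sq] at h1
    exact (ENNReal.pow_right_strictMono two_ne_zero).le_iff_le.1 h1
  have hffin : hardyNorm a r f < ⊤ := by
    obtain ⟨N, hN⟩ := hdist 1 one_pos
    have h2 := (isAnalytic_hardyEval (u N)).sub hfan
    have h3 := hardyNorm_add_le (isAnalytic_hardyEval (u N)) (h2.smul (-1))
    rw [hardyNorm_smul, show hardyEval (u N) + (-1 : ℂ) • (hardyEval (u N) - f) = f by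
      rw [neg_one_smul]; abel] at h3
    refine h3.trans_lt (ENNReal.add_lt_top.2 ⟨hardyNorm_hardyEval_lt_top _,
      ENNReal.mul_lt_top enorm_lt_top ((hN N le_rfl).trans_lt ENNReal.ofReal_lt_top)⟩)
  obtain ⟨h, rfl⟩ := exists_hardyEval_eq hfan hffin
  refine ⟨h, Metric.tendsto_atTop.2 fun ε hε => ?_⟩
  obtain ⟨N, hN⟩ := hdist (ε / 2) (half_pos hε)
  refine ⟨N, fun p hp => ?_⟩
  have h1 := hN p hp
  rw [← map_sub] at h1
  rw [dist_eq_norm, hardyElem_norm_def]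
  exact (ENNReal.toReal_le_of_le_ofReal (half_pos hε).le h1).trans_lt (half_lt_self hε)

/-- The Hardy space as a Hilbert space of functions on the polyball. -/
noncomputable def hardySpace (a : PolySpace n) (r : Fin k → ℝ) [Fact (∀ j, 0 < r j)] :
    HilbertFunctionSpace (polyball a r) where
  Elem := HardyElem a r
  eval := hardyEval
  eval_injective := hardyEval_injective

lemma isPolyballH2_hardySpace : IsPolyballH2 a r (hardySpace a r) := by
  refine ⟨fun f => ⟨?_, fun ⟨hf, hmaj⟩ => ?_⟩, fun h => ?_⟩
  · rintro ⟨h, rfl⟩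
    refine ⟨isAnalytic_hardyEval h, (hardySq_lt_top_iff hr.out (isAnalytic_hardyEval h)).1 ?_⟩
    rw [← hardyNorm_sq]
    exact ENNReal.pow_lt_top (hardyNorm_hardyEval_lt_top h)
  · have h1 := (hardySq_lt_top_iff hr.out hf).2 hmaj
    rw [← hardyNorm_sq] at h1
    exact exists_hardyEval_eq hf (by simpa using h1)
  · have h1 : hardySq a r (hardyEval h) < ⊤ := by
      rw [← hardyNorm_sq]
      exact ENNReal.pow_lt_top (hardyNorm_hardyEval_lt_top h)
    obtain ⟨u, hu, ha, hua⟩ := exists_isLeast_nHarmonicMajorants hr.out (isAnalytic_hardyEval h) h1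
    exact ⟨u, hu, ha, (hardyElem_norm_sq h).trans hua⟩

end HardySpace

/-! ### The abstract Beurling theorem -/

section AbstractBeurling

open Metric Set Filter Topology
open scoped InnerProductSpace

variable {H : Type*} [NormedAddCommGroup H] [InnerProductSpace ℂ H] [CompleteSpace H] {ord : H → ℕ∞}
  (ho : IsOrderFunction ord) {V : Submodule ℂ H}

lemma mem_valuationSubspace {m : ℕ} {x : H} :
    x ∈ valuationSubspace ho V m ↔ x ∈ V ∧ (m : ℕ∞) ≤ ord x := Iff.rfl

lemma isClosed_valuationSubspace (hV : IsClosed (V : Set H)) (m : ℕ) :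
    IsClosed (valuationSubspace ho V m : Set H) := by
  have h : (valuationSubspace ho V m : Set H) = (V : Set H) ∩ (ord ⁻¹' Iio (m : ℕ∞))ᶜ := by
    ext x
    simp [mem_valuationSubspace]
  rw [h]
  exact hV.inter (ho.upperSemicontinuous.isOpen_preimage _).isClosed_compl

lemma exists_homogeneousComponent_add (hV : IsClosed (V : Set H)) {m : ℕ} {x : H}
    (hx : x ∈ valuationSubspace ho V m) :
    ∃ w ∈ homogeneousComponent ho V m, ∃ v ∈ valuationSubspace ho V (m + 1), x = w + v := by
  have hc : CompleteSpace (valuationSubspace ho V (m + 1)) :=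
    (isClosed_valuationSubspace ho hV (m + 1)).completeSpace_coe
  set v := (valuationSubspace ho V (m + 1)).starProjection x with hv
  have hvm : v ∈ valuationSubspace ho V (m + 1) := Submodule.starProjection_apply_mem _ x
  have hvm' : v ∈ valuationSubspace ho V m :=
    ⟨hvm.1, le_trans (by exact_mod_cast Nat.le_succ m) hvm.2⟩
  exact ⟨x - v, ⟨Submodule.sub_mem _ hx hvm', Submodule.sub_starProjection_mem_orthogonal x⟩,
    v, hvm, by abel⟩

/-- Since `V_m = W_m ⊕ V_{m+1}`, an element of `V_m` orthogonal to `W_m` belongs to `V_{m+1}`. -/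
lemma mem_valuationSubspace_succ (hV : IsClosed (V : Set H)) {m : ℕ} {x : H}
    (hx : x ∈ valuationSubspace ho V m) (hx' : x ∈ (homogeneousComponent ho V m)ᗮ) :
    x ∈ valuationSubspace ho V (m + 1) := by
  obtain ⟨w, hw, v, hv, rfl⟩ := exists_homogeneousComponent_add ho hV hx
  have h1 : ⟪w, w + v⟫_ℂ = 0 := hx' w hw
  have h2 : ⟪w, v⟫_ℂ = 0 := (Submodule.mem_orthogonal' _ _).1 hw.2 v hv
  rw [inner_add_right, h2, add_zero, inner_self_eq_zero] at h1
  rwa [h1, zero_add]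

lemma mem_valuationSubspace_of_orthogonal (hV : IsClosed (V : Set H)) {m : ℕ} {x : H} (hx : x ∈ V)
    (hx' : ∀ i < m, x ∈ (homogeneousComponent ho V i)ᗮ) : x ∈ valuationSubspace ho V m := by
  induction m with
  | zero => exact ⟨hx, by simp⟩
  | succ m ih =>
    exact mem_valuationSubspace_succ ho hV (ih fun i hi => hx' i (by omega))
      (hx' m (Nat.lt_succ_self m))

/-- The homogeneous components of a closed subspace have dense span in it, since an element
orthogonal to all of them has infinite order. -/
lemma eq_zero_of_orthogonal_components (hV : IsClosed (V : Set H)) {x : H} (hx : x ∈ V)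
    (hx' : ∀ i, x ∈ (homogeneousComponent ho V i)ᗮ) : x = 0 :=
  (ho.eq_top_iff x).1 (ENat.eq_top_iff_forall_ge.2 fun _ =>
    (mem_valuationSubspace_of_orthogonal ho hV hx fun i _ => hx' i).2)

lemma componentProjection_eq_zero_iff {m : ℕ} {x : H} :
    componentProjection ho m x = 0 ↔ x ∈ (homogeneousComponent ho ⊤ m)ᗮ :=
  Submodule.starProjection_apply_eq_zero_iff _

lemma componentProjection_eq_zero {m : ℕ} {x : H} (hx : ((m + 1 : ℕ) : ℕ∞) ≤ ord x) :
    componentProjection ho m x = 0 :=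
  (componentProjection_eq_zero_iff ho).2 fun _ hw =>
    (Submodule.mem_orthogonal' _ _).1 hw.2 x ⟨Submodule.mem_top, hx⟩

lemma succ_le_ord_of_componentProjection_eq_zero {m : ℕ} {x : H} (hx : (m : ℕ∞) ≤ ord x)
    (h : componentProjection ho m x = 0) : ((m + 1 : ℕ) : ℕ∞) ≤ ord x :=
  (mem_valuationSubspace_succ ho (V := ⊤) isClosed_univ ⟨Submodule.mem_top, hx⟩
    ((componentProjection_eq_zero_iff ho).1 h)).2

lemma natCast_lt_iff_succ_le {m : ℕ} {x : ℕ∞} : (m : ℕ∞) < x ↔ ((m + 1 : ℕ) : ℕ∞) ≤ x := by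
  rw [Nat.cast_add, Nat.cast_one, ENat.add_one_le_iff (ENat.natCast_ne_top m)]

lemma inner_of_invariant {T : H →L[ℂ] H} (hT : ∀ h ∈ V, T h ∈ V) {m : ℕ} {h g : H} (hh : h ∈ V)
    (hg : g ∈ V) (hord : (m : ℕ∞) < ord (T h - g)) :
    T h - g ∈ (homogeneousComponent ho V m)ᗮ := fun _ hw =>
  (Submodule.mem_orthogonal' _ _).1 hw.2 _
    ⟨V.sub_mem (hT h hh) hg, natCast_lt_iff_succ_le.1 hord⟩

lemma fullProjection_of_invariant (hV : IsClosed (V : Set H)) {T : H →L[ℂ] H}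
    (hT : ∀ h ∈ V, T h ∈ V) {m : ℕ} {h g : H} (hh : h ∈ V) (hg : g ∈ V)
    (hord : (m : ℕ∞) ≤ ord (T h - g)) :
    componentProjection ho m (T h - g) ∈
      componentProjection ho m '' (homogeneousComponent ho V m : Set H) := by
  obtain ⟨w, hw, v, hv, hx⟩ := exists_homogeneousComponent_add ho hV
    (⟨V.sub_mem (hT h hh) hg, hord⟩ : T h - g ∈ valuationSubspace ho V m)
  exact ⟨w, hw, by rw [hx, map_add, componentProjection_eq_zero ho hv.2, add_zero]⟩

/-- The converse half of the abstract Beurling theorem, for a single operator `T`.  For `h` in a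
homogeneous component, the full projection property produces `g ∈ V` with `T h - g` of arbitrarily
large order, and by the inner property `g` may be replaced by the orthogonal projection of `T h`
to `V`. -/
lemma invariant_of_inner_of_fullProjection (hV : IsClosed (V : Set H)) {T : H →L[ℂ] H}
    (hinner : ∀ k m : ℕ, ∀ h ∈ homogeneousComponent ho V k, ∀ g ∈ V,
      (m : ℕ∞) < ord (T h - g) → T h - g ∈ (homogeneousComponent ho V m)ᗮ)
    (hfull : ∀ k m : ℕ, ∀ h ∈ homogeneousComponent ho V k, ∀ g ∈ V, (m : ℕ∞) ≤ ord (T h - g) →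
      componentProjection ho m (T h - g) ∈
        componentProjection ho m '' (homogeneousComponent ho V m : Set H)) :
    ∀ h ∈ V, T h ∈ V := by
  have hcV : CompleteSpace V := hV.completeSpace_coe
  have key (k : ℕ) (h : H) (hh : h ∈ homogeneousComponent ho V k) : T h ∈ V := by
    -- `T h` can be approximated by elements of `V` to arbitrarily large order
    have happrox (m : ℕ) : ∃ g ∈ V, (m : ℕ∞) ≤ ord (T h - g) := by
      induction m with
      | zero => exact ⟨0, V.zero_mem, by simp⟩
      | succ m ih =>
        obtain ⟨g, hg, hgm⟩ := ih
        obtain ⟨w, hw, hwg⟩ := hfull k m h hh g hg hgm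
        refine ⟨g + w, V.add_mem hg hw.1.1, ?_⟩
        rw [← sub_sub]
        refine succ_le_ord_of_componentProjection_eq_zero ho ?_ (by rw [map_sub, hwg, sub_self])
        exact (Submodule.sub_mem (valuationSubspace ho ⊤ m) ⟨Submodule.mem_top, hgm⟩
          ⟨Submodule.mem_top, hw.1.2⟩).2
    set p := V.starProjection (T h) with hp
    have hle (i : ℕ) : homogeneousComponent ho V i ≤ V :=
      fun w (hw : w ∈ homogeneousComponent ho V i) => hw.1.1
    have hpV : p ∈ V := Submodule.starProjection_apply_mem _ _
    have hpo : T h - p ∈ Vᗮ := Submodule.sub_starProjection_mem_orthogonal _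
    have hzero : T h - p = 0 := by
      refine (ho.eq_top_iff _).1 (ENat.eq_top_iff_forall_ge.2 fun m => ?_)
      obtain ⟨g, hg, hgm⟩ := happrox m
      -- `p - g = (T h - g) - (T h - p)` is orthogonal to the components of degree below `m`
      have hpg : p - g ∈ valuationSubspace ho V m := by
        refine mem_valuationSubspace_of_orthogonal ho hV (V.sub_mem hpV hg) fun i hi => ?_
        have h1 := hinner k i h hh g hg (lt_of_lt_of_le (by exact_mod_cast hi) hgm)
        have h2 : T h - p ∈ (homogeneousComponent ho V i)ᗮ :=
          Submodule.orthogonal_le (hle i) hpo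
        have := Submodule.sub_mem _ h1 h2
        rwa [sub_sub_sub_cancel_left] at this
      have := (Submodule.sub_mem (valuationSubspace ho ⊤ m)
        (⟨Submodule.mem_top, hgm⟩ : T h - g ∈ valuationSubspace ho ⊤ m)
        ⟨Submodule.mem_top, hpg.2⟩).2
      rwa [sub_sub_sub_cancel_right] at this
    rw [sub_eq_zero.1 hzero]
    exact hpV
  -- the elements of `V` mapped into `V` form a closed subspace containing all components
  set V' : Submodule ℂ H := V ⊓ V.comap (T : H →ₗ[ℂ] H) with hV'
  have hV'c : IsClosed (V' : Set H) := hV.inter (hV.preimage T.continuous)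
  have hcV' : CompleteSpace V' := hV'c.completeSpace_coe
  intro h hh
  have hmem : V'.starProjection h ∈ V' := Submodule.starProjection_apply_mem _ _
  have hperp : h - V'.starProjection h ∈ V'ᗮ := Submodule.sub_starProjection_mem_orthogonal _
  have hle (i : ℕ) : homogeneousComponent ho V i ≤ V' :=
    fun w (hw : w ∈ homogeneousComponent ho V i) => ⟨hw.1.1, key i w hw⟩
  have : h - V'.starProjection h = 0 :=
    eq_zero_of_orthogonal_components ho hV (V.sub_mem hh hmem.1) fun i =>
      Submodule.orthogonal_le (hle i) hperp
  rw [sub_eq_zero.1 this]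
  exact hmem.2

end AbstractBeurling

/-! ### Analytic Hilbert modules -/

section Modules

open Metric Set Filter Topology

variable {E : Type} [NormedAddCommGroup E] [NormedSpace ℂ E] {Ω : Set E} {a : E}

lemma isR1Invariant_iff {R : NonUnitalSubalgebra ℂ (Ω → ℂ)} {𝓗 : HilbertFunctionSpace Ω}
    (M : AnalyticHilbertModule a R 𝓗) {V : Submodule ℂ 𝓗.Elem}
    (hV : IsClosed (V : Set 𝓗.Elem)) :
    M.IsR1Invariant V ↔ M.HasR1InnerDecomposition V ∧ M.HasFullProjectionProperty V := by
  constructor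
  · intro h
    exact ⟨fun k m x hx g hg ρ hρ hord =>
      inner_of_invariant M.isOrderFunction (h ρ hρ) hx.1.1 hg hord,
      fun k m ρ hρ x hx g hg hord =>
        fullProjection_of_invariant M.isOrderFunction hV (h ρ hρ) hx.1.1 hg hord⟩
  · rintro ⟨h1, h2⟩ ρ hρ
    exact invariant_of_inner_of_fullProjection M.isOrderFunction hV
      (fun k m x hx g hg => h1 k m x hx g hg ρ hρ) (fun k m => h2 k m ρ hρ)

/-- Every element of a unital algebra differs from an element of positive order by a constant. -/
lemma isInvariant_iff_isR1Invariant {R : Subalgebra ℂ (Ω → ℂ)} {𝓗 : HilbertFunctionSpace Ω}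
    (M : AnalyticHilbertModule a R.toNonUnitalSubalgebra 𝓗) (V : Submodule ℂ 𝓗.Elem) :
    M.IsInvariant V ↔ M.IsR1Invariant V := by
  refine ⟨fun h ρ _ => h ρ, fun h ρ x hx => ?_⟩
  set c : ℂ := (ρ : Ω → ℂ) ⟨a, M.basepoint_mem⟩ with hc
  let σ : R.toNonUnitalSubalgebra :=
    ⟨(ρ : Ω → ℂ) - algebraMap ℂ (Ω → ℂ) c, R.sub_mem ρ.2 (R.algebraMap_mem c)⟩
  have hσ : 1 ≤ zeroOrder a (σ : Ω → ℂ) := by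
    rw [one_le_zeroOrder_iff M.basepoint_mem]
    simp [σ, hc]
  have heq : M.act ρ x = M.act σ x + c • x := by
    refine 𝓗.eval_injective ?_
    rw [map_add, map_smul, M.eval_act, M.eval_act]
    ext z
    simp [σ]
    ring
  rw [heq]
  exact V.add_mem (h σ hσ x hx) (V.smul_mem c hx)

/-- If point evaluations are uniformly bounded near `a`, the homogeneous terms at `a` are bounded
linear functionals, so that the order is upper semicontinuous. -/
lemma upperSemicontinuous_zeroOrder (𝓗 : HilbertFunctionSpace Ω)
    (hH : ∀ h : 𝓗.Elem, IsAnalytic (𝓗.eval h)) {ε : ℝ} (hε : 0 < ε) (hεΩ : ball a ε ⊆ Ω)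
    {C : ℝ} (hC : ∀ h : 𝓗.Elem, ∀ x ∈ ball a ε, ‖extendZero (𝓗.eval h) x‖ ≤ C * ‖h‖) :
    UpperSemicontinuous fun h : 𝓗.Elem => zeroOrder a (𝓗.eval h) := by
  have ha : a ∈ Ω := hεΩ (mem_ball_self hε)
  have hclosed (m : ℕ) : IsClosed {h : 𝓗.Elem | (m : ℕ∞) ≤ zeroOrder a (𝓗.eval h)} := by
    simp only [natCast_le_zeroOrder_iff, Set.ofPred_forall]
    refine isClosed_iInter fun k => isClosed_iInter fun _ => isClosed_iInter fun v => ?_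
    let L : 𝓗.Elem →ₗ[ℂ] ℂ :=
      { toFun := fun h => iteratedFDeriv ℂ k (extendZero (𝓗.eval h)) a fun _ => v
        map_add' := fun f g => by
          rw [map_add, extendZero_add, iteratedFDeriv_add_apply (hH f a ha).contDiffAt
            (hH g a ha).contDiffAt]
          rfl
        map_smul' := fun c f => by
          rw [map_smul, extendZero_smul, iteratedFDeriv_const_smul_apply (hH f a ha).contDiffAt]
          rfl }
    set δ : ℝ := ε / (‖v‖ + 1) with hδ
    have hδ0 : 0 < δ := by positivity
    have hδv : δ * ‖v‖ < ε := by
      rw [hδ, div_mul_eq_mul_div, div_lt_iff₀ (by positivity)]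
      nlinarith [norm_nonneg v]
    have hL : Continuous L := (L.mkContinuous (k.factorial * C / δ ^ k) fun h => by
      refine (norm_iteratedFDeriv_diag_le (fun x hx => hH h x (hεΩ hx)) hδ0 hδv
        (M := C * ‖h‖) (fun t ht => hC h _ (line_mem_ball hδv ht.le)) k).trans_eq ?_
      ring).continuous
    exact isClosed_singleton.preimage hL
  refine upperSemicontinuous_iff_isOpen_preimage.2 fun y => ?_
  rw [← isClosed_compl_iff]
  have : ((fun h : 𝓗.Elem => zeroOrder a (𝓗.eval h)) ⁻¹' Iio y)ᶜ =
      ⋂ (m : ℕ) (_ : (m : ℕ∞) ≤ y), {h : 𝓗.Elem | (m : ℕ∞) ≤ zeroOrder a (𝓗.eval h)} := by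
    ext h
    simp only [mem_compl_iff, mem_preimage, mem_Iio, not_lt, mem_iInter, Set.mem_ofPred_eq]
    exact ENat.forall_natCast_le_iff_le.symm
  rw [this]
  exact isClosed_iInter fun m => isClosed_iInter fun _ => hclosed m

/-- A Hilbert space of analytic functions with locally bounded point evaluations, on which a unital
algebra of analytic functions acts by bounded multiplication operators, is an analytic Hilbert
module. -/
lemma exists_analyticHilbertModule (R : Subalgebra ℂ (Ω → ℂ)) (𝓗 : HilbertFunctionSpace Ω)
    (hΩ : IsOpen Ω) (hΩc : IsConnected Ω) (hR : ∀ ρ ∈ R, IsAnalytic ρ)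
    (hH : ∀ h : 𝓗.Elem, IsAnalytic (𝓗.eval h)) {ε : ℝ} (hε : 0 < ε) (hεΩ : ball a ε ⊆ Ω)
    {C : ℝ} (hC0 : 0 ≤ C)
    (hC : ∀ h : 𝓗.Elem, ∀ x ∈ ball a ε, ‖extendZero (𝓗.eval h) x‖ ≤ C * ‖h‖)
    (hact : ∀ ρ ∈ R, ∃ T : 𝓗.Elem →L[ℂ] 𝓗.Elem, ∀ h, 𝓗.eval (T h) = ρ * 𝓗.eval h) :
    Nonempty (AnalyticHilbertModule a R.toNonUnitalSubalgebra 𝓗) := by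
  have ha : a ∈ Ω := hεΩ (mem_ball_self hε)
  choose T hT using fun ρ : R.toNonUnitalSubalgebra => hact ρ ρ.2
  have hext {S S' : 𝓗.Elem →L[ℂ] 𝓗.Elem} (h : ∀ x, 𝓗.eval (S x) = 𝓗.eval (S' x)) : S = S' :=
    ContinuousLinearMap.ext fun x => 𝓗.eval_injective (h x)
  let act : R.toNonUnitalSubalgebra →ₙₐ[ℂ] (𝓗.Elem →L[ℂ] 𝓗.Elem) :=
    { toFun := T
      map_smul' := fun c ρ => hext fun x => by
        simp [hT]
      map_zero' := hext fun x => by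
        simp [hT]
      map_add' := fun ρ σ => hext fun x => by
        simp [hT, add_mul]
      map_mul' := fun ρ σ => hext fun x => by
        simp [hT, mul_assoc] }
  exact ⟨
    { isOpen := hΩ
      isConnected := hΩc
      basepoint_mem := ha
      analytic_algebra := hR
      analytic_module := hH
      valuation_algebra :=
        { map_unit := fun e ρ σ he hρσ => by
            have he1 : (e : Ω → ℂ) = 1 := by
              rcases he with he | he
              · simpa using congrArg Subtype.val (he ⟨1, R.one_mem⟩)
              · simpa using congrArg Subtype.val (he ⟨1, R.one_mem⟩)
            have hρa : (ρ : Ω → ℂ) ⟨a, ha⟩ * (σ : Ω → ℂ) ⟨a, ha⟩ = 1 := by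
              rcases hρσ with h | h
              · have := congrFun (congrArg Subtype.val h) ⟨a, ha⟩
                simpa [he1] using this
              · have := congrFun (congrArg Subtype.val h) ⟨a, ha⟩
                rw [mul_comm]
                simpa [he1] using this
            by_contra hne
            have h1 := (one_le_zeroOrder_iff ha).1 (Order.one_le_iff_ne_zero.2 hne)
            rw [h1, zero_mul] at hρa
            exact zero_ne_one hρa
          eq_top_iff := fun ρ => (zeroOrder_eq_top_iff ha hΩc.isPreconnected (hR ρ ρ.2)).trans
            (by simp)
          mul_ge := fun ρ σ => zeroOrder_mul_ge ha (hR ρ ρ.2) (hR σ σ.2)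
          map_smul := fun c ρ hc => zeroOrder_smul ha (hR ρ ρ.2) hc
          add_ge := fun ρ σ => zeroOrder_add_ge ha (hR ρ ρ.2) (hR σ σ.2) }
      act := act
      eval_act := hT
      valuation_module :=
        { eq_top_iff := fun h =>
            (zeroOrder_eq_top_iff ha hΩc.isPreconnected (hH h)).trans
              (map_eq_zero_iff 𝓗.eval 𝓗.eval_injective)
          map_smul := fun c h hc => by
            rw [map_smul]; exact zeroOrder_smul ha (hH h) hc
          add_ge := fun h₁ h₂ => by
            rw [map_add]; exact zeroOrder_add_ge ha (hH h₁) (hH h₂)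
          upperSemicontinuous := upperSemicontinuous_zeroOrder 𝓗 hH hε hεΩ hC
          act_ge := fun ρ h => by
            rw [show 𝓗.eval (act ρ h) = ρ * 𝓗.eval h from hT ρ h]
            exact zeroOrder_mul_ge ha (hR ρ ρ.2) (hH h) }
      locally_uniform := by
        refine ⟨Subtype.val ⁻¹' ball a ε, isOpen_ball.preimage continuous_subtype_val,
          mem_ball_self hε, fun h g hlim K _ hK => ?_⟩
        rw [Metric.tendstoUniformlyOn_iff]
        intro δ hδ
        filter_upwards [Metric.tendsto_nhds.1 hlim (δ / (C + 1)) (by positivity)] with m hm z hz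
        have h1 := hC (h m - g) z (hK hz)
        rw [extendZero_coe, map_sub, Pi.sub_apply, ← dist_eq_norm, ← dist_eq_norm, dist_comm] at h1
        refine h1.trans_lt ?_
        rw [lt_div_iff₀ (by positivity)] at hm
        nlinarith [dist_nonneg (x := h m) (y := g)] }⟩

end Modules

/-! ### The Hardy space of the polyball as an analytic Hilbert module -/

section Main

open Metric Set Function

variable {k : ℕ} {n : Fin k → ℕ} {a : PolySpace n} {r : Fin k → ℝ}

lemma isConnected_polyball (hr : ∀ j, 0 < r j) (a : PolySpace n) :
    IsConnected (polyball a r) := by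
  have h : polyball a r = univ.pi fun j => ball (a j) (r j) := by
    ext z
    simp [polyball]
  refine ⟨⟨a, fun j => mem_ball_self (hr j)⟩, ?_⟩
  rw [h]
  exact (convex_pi fun j _ => convex_ball (a j) (r j)).isPreconnected

lemma polynomialAlgebra_le_boundedAnalyticAlgebra (a : PolySpace n) (r : Fin k → ℝ) :
    polynomialAlgebra a r ≤ boundedAnalyticAlgebra a r := by
  rw [polynomialAlgebra, ← Algebra.adjoin_range_eq_range_aeval, Algebra.adjoin_le_iff]
  rintro _ ⟨i, rfl⟩
  refine ⟨isAnalytic_of_eqOn (F := fun z => z i.1 i.2) (fun z _ => ?_) fun _ => rfl,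
    ‖a i.1‖ + r i.1, fun z => ?_⟩
  · exact ((EuclideanSpace.proj i.2 : EuclideanSpace ℂ (Fin (n i.1)) →L[ℂ] ℂ).comp
      (ContinuousLinearMap.proj i.1 : PolySpace n →L[ℂ] _)).analyticAt z
  · refine (PiLp.norm_apply_le _ _).trans ?_
    have h := z.2 i.1
    rw [mem_ball, dist_eq_norm] at h
    calc ‖(z : PolySpace n) i.1‖ = ‖a i.1 + ((z : PolySpace n) i.1 - a i.1)‖ := by
          rw [add_sub_cancel]
      _ ≤ ‖a i.1‖ + r i.1 := (norm_add_le _ _).trans (by gcongr)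

variable [∀ j, Nontrivial (EuclideanSpace ℂ (Fin (n j)))] [hr : Fact (∀ j, 0 < r j)]

/-- Bounded analytic functions multiply the Hardy space boundedly into itself. -/
lemma exists_mul_hardySpace {ρ : polyball a r → ℂ} (hρ : ρ ∈ boundedAnalyticAlgebra a r) :
    ∃ T : (hardySpace a r).Elem →L[ℂ] (hardySpace a r).Elem,
      ∀ h, (hardySpace a r).eval (T h) = ρ * (hardySpace a r).eval h := by
  obtain ⟨hρa, C, hC⟩ := hρ
  have hC' (z : polyball a r) : ‖ρ z‖ ≤ max C 0 := (hC z).trans (le_max_left _ _)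
  have hle (h : HardyElem a r) := hardyNorm_mul_le (g := hardyEval h) hC' (le_max_right _ _)
  have hlt (h : HardyElem a r) : ENNReal.ofReal (max C 0) * hardyNorm a r (hardyEval h) < ⊤ :=
    ENNReal.mul_lt_top ENNReal.ofReal_lt_top (hardyNorm_hardyEval_lt_top h)
  choose T hT using fun h : HardyElem a r =>
    exists_hardyEval_eq (hρa.mul (isAnalytic_hardyEval h)) ((hle h).trans_lt (hlt h))
  let L : HardyElem a r →ₗ[ℂ] HardyElem a r :=
    { toFun := T
      map_add' := fun f g => hardyEval_injective (by simp [hT, mul_add])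
      map_smul' := fun c f => hardyEval_injective (by simp [hT]) }
  refine ⟨L.mkContinuous (max C 0) fun h => ?_, hT⟩
  have h1 := ENNReal.toReal_mono (hlt h).ne (hle h)
  rwa [← hT, ENNReal.toReal_mul, ENNReal.toReal_ofReal (le_max_right _ _)] at h1

lemma exists_analyticHilbertModule_hardySpace {R : Subalgebra ℂ (polyball a r → ℂ)}
    (hR : R ≤ boundedAnalyticAlgebra a r) :
    Nonempty (AnalyticHilbertModule a R.toNonUnitalSubalgebra (hardySpace a r)) := by
  obtain ⟨C, hC0, hC⟩ := exists_norm_hardyEval_le (r := r) a 0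
  obtain ⟨ε, hε, hεl⟩ := Metric.isOpen_iff.1 (isOpen_prodBall a (innerRadius r 0)) a
    (center_mem_prodBall (innerRadius_pos hr.out 0) a)
  exact exists_analyticHilbertModule R (hardySpace a r) (isOpen_polyball a r)
    (isConnected_polyball hr.out a) (fun ρ hρ => (hR hρ).1) isAnalytic_hardyEval hε
    (hεl.trans (prodBall_innerRadius_subset hr.out a 0)) hC0
    (fun h x hx => hC h x (prodBall_subset_prodClosedBall _ _ (hεl hx)))
    fun ρ hρ => exists_mul_hardySpace (hR hρ)

end Main
end BeurlingModule

open BeurlingModule in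
theorem theorem14p8 (k : ℕ) (hk : 1 ≤ k) (n : Fin k → ℕ) (hn : ∀ j, 1 ≤ n j)
    (a : PolySpace n) (r : Fin k → ℝ) (hr : ∀ j, 0 < r j) :
    ∃ 𝓗 : HilbertFunctionSpace (polyball a r), IsPolyballH2 a r 𝓗 ∧
      ∀ R : Subalgebra ℂ (polyball a r → ℂ),
        (R = polynomialAlgebra a r ∨ R = boundedAnalyticAlgebra a r) →
        ∃ M : AnalyticHilbertModule a R.toNonUnitalSubalgebra 𝓗,
          ∀ V : Submodule ℂ 𝓗.Elem, IsClosed (V : Set 𝓗.Elem) →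
            (M.IsR1Invariant V ↔
              M.HasR1InnerDecomposition V ∧ M.HasFullProjectionProperty V) ∧
            (M.IsInvariant V ↔
              M.HasR1InnerDecomposition V ∧ M.HasFullProjectionProperty V) := by
  have : Fact (∀ j, 0 < r j) := ⟨hr⟩
  have := nontrivial_of_one_le hn
  refine ⟨hardySpace a r, isPolyballH2_hardySpace, fun R hR => ?_⟩
  have hle : R ≤ boundedAnalyticAlgebra a r := by
    rcases hR with rfl | rfl
    · exact polynomialAlgebra_le_boundedAnalyticAlgebra a r
    · exact le_rfl
  obtain ⟨M⟩ := exists_analyticHilbertModule_hardySpace hle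
  exact ⟨M, fun V hV => ⟨isR1Invariant_iff M hV,
    (isInvariant_iff_isR1Invariant M V).trans (isR1Invariant_iff M hV)⟩⟩
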